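/- **Terms and flows.** Consider first-order terms over a signature with infinitely many variables, a distinguished binary symbol $\bullet$ (infix, associated to the right), distinguished constants $\star,\mathtt l,\mathtt r$ with $\mathtt l\neq\mathtt r$, a finite alphabet $\Sigma$ of constants with $\star\notin\Sigma$, a set $\mathtt Q$ of state constants and an infinite set $\mathtt P$ of position constants. A *flow* $t\leftharpoonup u$ is a pair of terms with the same variables, up to bijective renaming of variables. Choosing representatives without common variables, the product $(u\leftharpoonup v)(t\leftharpoonup w)$ is defined if $v,t$ are unifiable, and is then $\theta u\leftharpoonup\theta w$ for a most general unifier $\theta$ of $v,t$. *Wirings* are finite formal $\mathbb C$-linear combinations of flows, multiplied by bilinear extension of this partial product (undefined products count as $0$), with unit $x\leftharpoonup x$; a wiring $F$ is *nilpotent* if $F^k=0$ for some $k\in\mathbb N$. A wiring is *concrete* if it is a finite sum of distinct flows with coefficients $1$. A concrete wiring $\sum_i u_i\leftharpoonup t_i$ is *isometric* if for $i\ne j$ the terms $u_i,u_j$ are not unifiable after their variables are renamed apart, and neither are $t_i,t_j$. **Words.** For a word $W=\mathtt c_1\dots\mathtt c_n$ over $\Sigma$ ($n\ge 0$) and distinct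 $\mathtt p_0,\dots,\mathtt p_n\in\mathtt P$, put $\mathtt c_0=\star$ and, reading indices modulo $n+1$, $$W(\mathtt p_0,\dots,\mathtt p_n)=\sum_{i=0}^{n}\Big[\big(A_i\leftharpoonup B_{i+1}\big)+\big(B_{i+1}\leftharpoonup A_i\big)\Big],\qquad A_i=(\mathtt c_i\bullet\mathtt r\bullet x)\bullet(\mathtt p_i\bullet y),\quad B_i=(\mathtt c_i\bullet\mathtt l\bullet x)\bullet(\mathtt p_i\bullet y).$$ **Observations.** An *$\mathfrak S$-observation* is a concrete wiring $\varphi$ each of whose flows has the form $$(\mathtt c'\bullet\mathtt d'\bullet\mathtt q')\bullet(x_1\bullet\cdots\bullet x_m\bullet y)\;\leftharpoonup\;(\mathtt c\bullet\mathtt d\bullet\mathtt q)\bullet(x_{\sigma(1)}\bullet\cdots\bullet x_{\sigma(m)}\bullet y)$$ (that is, $(\mathtt c'\bullet\mathtt d'\bullet\mathtt q'\leftharpoonup\mathtt c\bullet\mathtt d\bullet\mathtt q)\otimes[\sigma]$) with $\mathtt c,\mathtt c'\in\Sigma\cup\{\star\}$, $\mathtt d,\mathtt d'\in\{\mathtt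 l,\mathtt r\}$, $\mathtt q,\mathtt q'\in\mathtt Q$ and $\sigma$ a permutation of $\{1,\dots,m\}$, $m\ge0$. Its language is $$\mathcal L(\varphi)=\{W \text{ word over }\Sigma : \varphi\,W(\mathtt p_0,\dots,\mathtt p_n)\text{ is nilpotent for all distinct }\mathtt p_0,\dots,\mathtt p_n\in\mathtt P\}.$$ **Theorem.** For every $\mathfrak S$-observation $\varphi$, the language $\mathcal L(\varphi)$ is in $\mathrm{NLogspace}$: it is decided by a nondeterministic Turing machine with a read-only input tape and finitely many work tapes that halts along every computation and visits $O(\log n)$ work tape cells on inputs of length $n$. If moreover $\varphi$ is isometric, then $\mathcal L(\varphi)$ is in $\mathrm{Logspace}$: it is decided by a deterministic such machine. -/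

import Mathlib

/-!
The unification algebra, words and observations, and the classes `Logspace` and `NLogspace`.
First-order terms over a signature `L` are Mathlib's `L.Term ℕ`, with variables indexed by `ℕ`.
-/

namespace UnifLog

universe u v w

open FirstOrder

section Unification

variable {L : FirstOrder.Language.{u, v}}

/-- `θ` is a unifier of `t` and `s`. -/
def IsUnifier (θ : ℕ → L.Term ℕ) (t s : L.Term ℕ) : Prop :=
  t.subst θ = s.subst θ

/-- `θ` is a most general unifier: every unifier is an instance `σθ` of it. -/
def IsMGU (θ : ℕ → L.Term ℕ) (t s : L.Term ℕ) : Prop :=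
  IsUnifier θ t s ∧
    ∀ ψ : ℕ → L.Term ℕ, IsUnifier ψ t s → ∃ σ : ℕ → L.Term ℕ, ∀ x, ψ x = (θ x).subst σ

/-- Two terms are matchable if they are unifiable after their variables have been renamed apart. -/
def Matchable (t s : L.Term ℕ) : Prop :=
  ∃ α β : Equiv.Perm ℕ,
    Disjoint (t.relabel α).varFinset (s.relabel β).varFinset ∧
      ∃ θ : ℕ → L.Term ℕ, IsUnifier θ (t.relabel α) (s.relabel β)

theorem varFinset_subst (t : L.Term ℕ) (θ : ℕ → L.Term ℕ) :
    (t.subst θ).varFinset = t.varFinset.biUnion (fun x => (θ x).varFinset) := by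
  induction t with
  | var x => simp [Language.Term.subst, Language.Term.varFinset]
  | func f ts ih =>
    ext y
    simp only [Language.Term.subst, Language.Term.varFinset, Finset.mem_biUnion, ih]
    constructor
    · rintro ⟨i, hi, x, hx, hy⟩
      exact ⟨x, ⟨i, hi, hx⟩, hy⟩
    · rintro ⟨x, ⟨i, hi, hx⟩, hy⟩
      exact ⟨i, hi, x, hx, hy⟩

end Unification

section Flows

variable (L : FirstOrder.Language.{u, v})

/-- A representative `tgt ↼ src` of a flow. -/
structure PreFlow where
  tgt : L.Term ℕ
  src : L.Term ℕ
  vars_eq : tgt.varFinset = src.varFinset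

/-- Equality up to a (bijective) renaming of the variables. -/
instance PreFlow.setoid : Setoid (PreFlow L) where
  r a b := ∃ α : Equiv.Perm ℕ, a.tgt.relabel α = b.tgt ∧ a.src.relabel α = b.src
  iseqv :=
    { refl := fun a => ⟨Equiv.refl ℕ, by simp⟩
      symm := by
        rintro a b ⟨α, h₁, h₂⟩
        refine ⟨α.symm, ?_, ?_⟩
        · rw [← h₁]; simp
        · rw [← h₂]; simp
      trans := by
        rintro a b c ⟨α, h₁, h₂⟩ ⟨β, h₃, h₄⟩
        refine ⟨α.trans β, ?_, ?_⟩
        · rw [← h₃, ← h₁]; simp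
        · rw [← h₄, ← h₂]; simp }

/-- Flows, considered up to renaming. -/
def Flow : Type u := Quotient (PreFlow.setoid L)

variable {L}

/-- The renaming class of `a`. -/
def PreFlow.toFlow (a : PreFlow L) : Flow L := Quotient.mk (PreFlow.setoid L) a

/-- The representative `θu ↼ θw` of the product of `u ↼ v` and `t ↼ w`, for `θ` a unifier of
`v` and `t`. -/
def PreFlow.resolve (a b : PreFlow L) (θ : ℕ → L.Term ℕ) (h : IsUnifier θ a.src b.tgt) :
    PreFlow L where
  tgt := a.tgt.subst θ
  src := b.src.subst θ
  vars_eq := by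
    have h' : a.src.subst θ = b.tgt.subst θ := h
    rw [varFinset_subst, a.vars_eq, ← varFinset_subst, h', varFinset_subst, b.vars_eq,
      ← varFinset_subst]

/-- `h` is the product `fg`: for representatives `a` of `f` and `b` of `g` without common
variables and a most general unifier `θ` of the source of `a` and the target of `b`, it is the
class of `θ(tgt a) ↼ θ(src b)`. The product is defined if there is such an `h`; it does not depend
on the representatives or on `θ`. -/
def Flow.IsProduct (f g h : Flow L) : Prop :=
  ∃ (a b : PreFlow L) (θ : ℕ → L.Term ℕ) (hθ : IsMGU θ a.src b.tgt),
    a.toFlow = f ∧ b.toFlow = g ∧ Disjoint a.src.varFinset b.tgt.varFinset ∧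
      (a.resolve b θ hθ.1).toFlow = h

variable (L) in
/-- Wirings: finite formal linear combinations of flows with complex coefficients. -/
def Wiring : Type u := Flow L →₀ ℂ

namespace Wiring

noncomputable instance : AddCommGroup (Wiring L) := inferInstanceAs (AddCommGroup (Flow L →₀ ℂ))

/-- A flow with a coefficient, as a wiring. -/
noncomputable def single (f : Flow L) (c : ℂ) : Wiring L := Finsupp.single f c

/-- The coefficient of a flow in a wiring. -/
def coeff (F : Wiring L) (f : Flow L) : ℂ := Finsupp.toFun F f

/-- The unit `x ↼ x`. -/
noncomputable instance : One (Wiring L) :=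
  ⟨single (PreFlow.toFlow ⟨Language.Term.var 0, Language.Term.var 0, rfl⟩) 1⟩

open Classical in
/-- The product of two flows as a formal sum: zero if it is not defined. -/
noncomputable def flowMul (f g : Flow L) : Flow L →₀ ℂ :=
  if h : ∃ k, Flow.IsProduct f g k then Finsupp.single h.choose 1 else 0

/-- The bilinear extension of the partial product of flows. -/
noncomputable def mul (F G : Flow L →₀ ℂ) : Flow L →₀ ℂ :=
  F.sum fun f a => G.sum fun g b => (a * b) • flowMul f g

noncomputable instance : Mul (Wiring L) := ⟨mul⟩

noncomputable instance : Pow (Wiring L) ℕ := ⟨fun F n => npowRec n F⟩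

/-- All coefficients of the flows that occur are equal to one. -/
def IsConcrete (F : Wiring L) : Prop := ∀ f : Flow L, F.coeff f ≠ 0 → F.coeff f = 1

/-- A concrete wiring is isometric if the targets of its flows are pairwise disjoint (not
matchable), and so are their sources. -/
def IsIsometric (F : Wiring L) : Prop :=
  F.IsConcrete ∧ ∀ a b : PreFlow L, F.coeff a.toFlow ≠ 0 → F.coeff b.toFlow ≠ 0 →
    a.toFlow ≠ b.toFlow → ¬ Matchable a.tgt b.tgt ∧ ¬ Matchable a.src b.src

end Wiring

end Flows

/-- The distinguished symbols: the binary symbol `dot`, the constants `⋆`, `l`, `r`, the finite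
alphabet `Σ` with `⋆ ∉ Σ`, the state constants and the (infinitely many) position constants. -/
structure Vocabulary (L : FirstOrder.Language.{u, v}) where
  dot : L.Functions 2
  star : L.Constants
  lft : L.Constants
  rgt : L.Constants
  alphabet : Finset L.Constants
  states : Set L.Constants
  positions : Set L.Constants
  lft_ne_rgt : lft ≠ rgt
  star_notMem : star ∉ alphabet
  positions_infinite : positions.Infinite

namespace Vocabulary

variable {L : FirstOrder.Language.{u, v}} (V : Vocabulary L)

/-- The term `t • s`. -/
def cons (t s : L.Term ℕ) : L.Term ℕ := V.dot.apply₂ t s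

/-- The constant `c` as a term. -/
def const (c : L.Constants) : L.Term ℕ := Language.Constants.term c

theorem varFinset_cons (t s : L.Term ℕ) :
    (V.cons t s).varFinset = t.varFinset ∪ s.varFinset := by
  ext x
  simp [cons, Language.Functions.apply₂, Language.Term.varFinset, Fin.exists_fin_two]

theorem varFinset_const (c : L.Constants) : (const c : L.Term ℕ).varFinset = ∅ := by
  ext x
  simp [const, Language.Constants.term, Language.Term.varFinset]

/-- The term `t₁ • t₂ • ⋯ • tₙ • s`, with `•` associated to the right. -/
def consList (ts : List (L.Term ℕ)) (s : L.Term ℕ) : L.Term ℕ := ts.foldr V.cons s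

theorem mem_varFinset_consList (ts : List (L.Term ℕ)) (s : L.Term ℕ) (x : ℕ) :
    x ∈ (V.consList ts s).varFinset ↔ (∃ t ∈ ts, x ∈ t.varFinset) ∨ x ∈ s.varFinset := by
  induction ts with
  | nil => simp [consList]
  | cons t ts ih =>
    have h : V.consList (t :: ts) s = V.cons t (V.consList ts s) := rfl
    rw [h, varFinset_cons, Finset.mem_union, ih]
    simp [or_assoc]

/-- `[σ] = x₁ • ⋯ • xₙ • y ↼ x_{σ(1)} • ⋯ • x_{σ(n)} • y`. -/
def perm {n : ℕ} (σ : Equiv.Perm (Fin n)) : PreFlow L where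
  tgt := V.consList (List.ofFn fun i : Fin n => Language.Term.var (i : ℕ)) (Language.Term.var n)
  src := V.consList (List.ofFn fun i : Fin n => Language.Term.var (σ i : ℕ)) (Language.Term.var n)
  vars_eq := by
    ext x
    simp only [mem_varFinset_consList, List.mem_ofFn, Language.Term.varFinset,
      Finset.mem_singleton]
    refine or_congr ⟨?_, ?_⟩ Iff.rfl
    · rintro ⟨_, ⟨i, rfl⟩, hx⟩
      exact ⟨_, ⟨σ.symm i, rfl⟩, by simpa [Language.Term.varFinset] using hx⟩
    · rintro ⟨_, ⟨i, rfl⟩, hx⟩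
      exact ⟨_, ⟨σ i, rfl⟩, hx⟩

/-- The closed term `c • d • q`. -/
def head (c d q : L.Constants) : L.Term ℕ :=
  V.cons (const c) (V.cons (const d) (const q))

/-- The flow `(c' • d' • q' ↼ c • d • q) ⊗ [σ]`. The first factor has no variables, so the
representatives below have no variable in common. -/
def obsFlow {n : ℕ} (c' d' q' c d q : L.Constants) (σ : Equiv.Perm (Fin n)) : PreFlow L where
  tgt := V.cons (V.head c' d' q') (V.perm σ).tgt
  src := V.cons (V.head c d q) (V.perm σ).src
  vars_eq := by
    simp only [head, varFinset_cons, varFinset_const, (V.perm σ).vars_eq]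

/-- `c ∈ Σ ∪ {⋆}`. -/
def IsLetter (c : L.Constants) : Prop := c ∈ V.alphabet ∨ c = V.star

/-- `d ∈ {l, r}`. -/
def IsDir (d : L.Constants) : Prop := d = V.lft ∨ d = V.rgt

/-- `φ` is a concrete (finite) sum of flows `(c' • d' • q' ↼ c • d • q) ⊗ [σ]`, with
`c, c' ∈ Σ ∪ {⋆}`, `d, d' ∈ {l, r}`, state constants `q, q'` and a permutation `σ` of a finite
set `{1, …, n}`, where `n` may differ from one flow to another. -/
def IsObservation (φ : Wiring L) : Prop :=
  φ.IsConcrete ∧ ∀ f : Flow L, φ.coeff f ≠ 0 →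
    ∃ (n : ℕ) (σ : Equiv.Perm (Fin n)) (c' d' q' c d q : L.Constants),
      V.IsLetter c' ∧ V.IsDir d' ∧ q' ∈ V.states ∧
      V.IsLetter c ∧ V.IsDir d ∧ q ∈ V.states ∧
      f = (V.obsFlow c' d' q' c d q σ).toFlow

/-- The term `(c • d • x) • (p • y)`, with distinct variables `x`, `y`. -/
def cell (c d p : L.Constants) : L.Term ℕ :=
  V.cons (V.cons (const c) (V.cons (const d) (Language.Term.var 0)))
    (V.cons (const p) (Language.Term.var 1))

/-- The flow `(c' • d' • x) • (p' • y) ↼ (c • d • x) • (p • y)`. -/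
def wordFlow (c' d' p' c d p : L.Constants) : PreFlow L where
  tgt := V.cell c' d' p'
  src := V.cell c d p
  vars_eq := by
    simp only [cell, varFinset_cons, varFinset_const]

/-- The symbol in cell `i`: `⋆` in cell `0`, and `cᵢ` in cell `i` for `1 ≤ i ≤ n`. -/
def letter (W : List V.alphabet) (i : Fin (W.length + 1)) : L.Constants :=
  Fin.cases V.star (fun j => ((W.get j : V.alphabet) : L.Constants)) i

/-- The representation `W(p₀, …, pₙ)`: the sum over all cells `i` of
`(cᵢ • r • x) • (pᵢ • y) ⇌ (cᵢ₊₁ • l • x) • (pᵢ₊₁ • y)`, with `c₀ = ⋆` and `i + 1` taken modulo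
`n + 1`. -/
noncomputable def wordRep (W : List V.alphabet) (p : Fin (W.length + 1) → L.Constants) :
    Wiring L :=
  ∑ i : Fin (W.length + 1),
    (Wiring.single (V.wordFlow (V.letter W i) V.rgt (p i)
        (V.letter W (i + 1)) V.lft (p (i + 1))).toFlow 1 +
      Wiring.single (V.wordFlow (V.letter W (i + 1)) V.lft (p (i + 1))
        (V.letter W i) V.rgt (p i)).toFlow 1)

/-- The language of `φ`: the words `W` such that `φ W(p₀, …, pₙ)` is nilpotent for any choice of
distinct position constants. -/
def language (φ : Wiring L) : _root_.Language V.alphabet :=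
  {W | ∀ p : Fin (W.length + 1) → L.Constants, Function.Injective p →
    (∀ i, p i ∈ V.positions) → IsNilpotent (φ * V.wordRep W p)}

end Vocabulary

section Machines

/-- Head moves. -/
inductive Move
  | left
  | stay
  | right

/-- Contents of an input cell: an end marker or a letter. -/
inductive InSym (A : Type w)
  | leftEnd
  | letter (a : A)
  | rightEnd

/-- A nondeterministic Turing machine with a read-only two-way input tape and `tapes` work tapes,
each infinite to the right. `trans` lists the possible actions: new state, move of the input head,
and for each work tape the symbol written and the move of its head. -/
structure TM (A : Type w) where
  State : Type
  Sym : Type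
  finite_state : Finite State
  finite_sym : Finite Sym
  tapes : ℕ
  blank : Sym
  start : State
  accept : Set State
  trans : State → InSym A → (Fin tapes → Sym) → Set (State × Move × (Fin tapes → Sym × Move))

namespace TM

variable {A : Type w} (M : TM A)

/-- A configuration: state, input head position, and contents and head positions of the work
tapes. -/
structure Cfg where
  state : M.State
  inPos : ℕ
  tape : Fin M.tapes → ℕ → M.Sym
  head : Fin M.tapes → ℕ

/-- The input tape holds the left end marker in cell `0`, the word in cells `1, …, n` and the right
end marker in cell `n + 1`. -/
def readInput (W : List A) : ℕ → InSym A
  | 0 => InSym.leftEnd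
  | i + 1 => match W[i]? with
    | some a => InSym.letter a
    | none => InSym.rightEnd

/-- Moving a head; a head that would leave its tape on the left stays where it is. -/
def _root_.UnifLog.Move.apply : Move → ℕ → ℕ
  | Move.left, i => i - 1
  | Move.stay, i => i
  | Move.right, i => i + 1

/-- The initial configuration: blank work tapes and all heads on cell `0`. -/
def init : M.Cfg where
  state := M.start
  inPos := 0
  tape := fun _ _ => M.blank
  head := fun _ => 0

/-- One step on input `W`. The input head does not move beyond the right end marker. -/
def Step (W : List A) (c c' : M.Cfg) : Prop :=
  ∃ o ∈ M.trans c.state (readInput W c.inPos) (fun j => c.tape j (c.head j)),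
    c'.state = o.1 ∧
    c'.inPos = min (o.2.1.apply c.inPos) (W.length + 1) ∧
    (∀ j, c'.tape j = Function.update (c.tape j) (c.head j) (o.2.2 j).1) ∧
    (∀ j, c'.head j = (o.2.2 j).2.apply (c.head j))

/-- `c` is reachable from the initial configuration on input `W`. -/
def Reaches (W : List A) (c : M.Cfg) : Prop := Relation.ReflTransGen (M.Step W) M.init c

/-- Every computation on input `W` is finite. -/
def Halts (W : List A) : Prop :=
  ¬ ∃ run : ℕ → M.Cfg, run 0 = M.init ∧ ∀ i, M.Step W (run i) (run (i + 1))

/-- Some computation on input `W` halts in an accepting state. -/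
def Accepts (W : List A) : Prop :=
  ∃ c, M.Reaches W c ∧ (∀ c', ¬ M.Step W c c') ∧ c.state ∈ M.accept

/-- `M` halts on every input, along every computation, and accepts exactly the words of `K`. -/
def Decides (K : _root_.Language A) : Prop :=
  ∀ W : List A, M.Halts W ∧ (M.Accepts W ↔ W ∈ K)

/-- At most one action is possible in any situation. -/
def IsDeterministic : Prop := ∀ q a s, (M.trans q a s).Subsingleton

/-- Along every computation on an input of length `n`, only the first `O(log n)` cells of each work
tape are visited. -/
def IsLogSpace : Prop :=
  ∃ C : ℕ, ∀ (W : List A) (c : M.Cfg), M.Reaches W c →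
    ∀ j, c.head j < C * (Nat.log 2 W.length + 1)

end TM

/-- Languages decided by a nondeterministic Turing machine in logarithmic space. -/
def NLogspace (A : Type w) : Set (_root_.Language A) :=
  {K | ∃ M : TM A, M.IsLogSpace ∧ M.Decides K}

/-- Languages decided by a deterministic Turing machine in logarithmic space. -/
def Logspace (A : Type w) : Set (_root_.Language A) :=
  {K | ∃ M : TM A, M.IsDeterministic ∧ M.IsLogSpace ∧ M.Decides K}

end Machines

end UnifLog

/-! A flow acts on terms as the relation formed by its instances. Since products are taken along
most general unifiers, the product of flows is composition of relations (`Flow.IsProduct.rel_iff`).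
All coefficients that occur are natural numbers, so nothing cancels, and `F ^ k = 0` says that the
relation of `F` has no walk with `k` edges: nilpotency is boundedness of walks
(`Wiring.isNilpotent_iff`).

For `F = φ W(p₀, …, pₙ)` the infinite graph of terms can be replaced by a finite one. One step moves
the position on top of a stack to an adjacent cell, then permutes boundedly many top entries and
replaces a closed head. After one step, all that matters is which of the `f` flows of `φ` was
applied last and which positions fill the first `K + 1` stack entries, where `K + 1` bounds the
sizes of the permutations. This leaves `(n + 1) ^ (K + 1) * (f + 1)` vertices, one label being
padding (`Vocabulary.boundedWalks_obsRel_iff`). The graph does not depend on the chosen position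
constants, and its edges can be decided from finitely many pointers into the input.

Membership in the language thus means that a graph of polynomial size has no long walks. A
nondeterministic machine has to certify an absence, which is done by the inductive counting of
Immerman and Szelepcsényi: the number of vertices at which a walk of length `t` starts is computed
for growing `t`, until it is zero or repeats (`countMachine_ends`). If `φ` is isometric, two
different flows cannot have the same source head, because their sources would be matchable. So each
vertex has at most one outgoing edge (`Vocabulary.obsEdge_unique`), and it suffices to follow the
walk from every vertex deterministically (`traceMachine_ends`).

Both programs use registers that hold vertices. They are compiled downwards: a vertex becomes a
tuple of pointers with a label in the finite control, a pointer becomes a pair of numerical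
registers with contents at most `n + 2`, and these registers are stored in binary on parallel tracks
of one work tape. `Settles` carries termination, the space bound and the result through each
simulation. -/

namespace UnifLog

/-! ### Computations that settle -/

/-- Every computation from `c` is finite and visits safe configurations only, and some computation
from `c` halts in an accepting configuration if and only if `r` holds. -/
inductive Settles {C : Type*} (step : C → C → Prop) (acc safe : C → Prop) : C → Prop → Prop
  | mk (c : C) (r : Prop) (rs : C → Prop) (hsafe : safe c)
      (hstep : ∀ e, step c e → Settles step acc safe e (rs e))
      (hr : r ↔ ((∀ e, ¬ step c e) ∧ acc c) ∨ ∃ e, step c e ∧ rs e) :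
      Settles step acc safe c r

namespace Settles

variable {C : Type*} {step : C → C → Prop} {acc safe : C → Prop} {c : C} {r : Prop}

theorem safe_self (h : Settles step acc safe c r) : safe c := by
  cases h; assumption

theorem congr {r' : Prop} (h : Settles step acc safe c r) (hr : r ↔ r') :
    Settles step acc safe c r' := by
  rwa [← propext hr]

theorem of_halted (hs : safe c) (hh : ∀ e, ¬ step c e) (hr : r ↔ acc c) :
    Settles step acc safe c r :=
  ⟨c, r, fun _ => False, hs, fun e he => (hh e he).elim, by simp [hr, hh]⟩

theorem of_forall_step (rs : C → Prop) (hs : safe c) (hne : ∃ e, step c e)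
    (h : ∀ e, step c e → Settles step acc safe e (rs e)) (hr : r ↔ ∃ e, step c e ∧ rs e) :
    Settles step acc safe c r := by
  refine ⟨c, r, rs, hs, h, ?_⟩
  obtain ⟨e, he⟩ := hne
  rw [hr]
  constructor
  · exact Or.inr
  · rintro (⟨h', -⟩ | h')
    · exact (h' e he).elim
    · exact h'

theorem of_unique_step (e : C) (hs : safe c) (he : ∀ e', step c e' ↔ e' = e)
    (h : Settles step acc safe e r) : Settles step acc safe c r := by
  refine of_forall_step (fun _ => r) hs ⟨e, (he e).2 rfl⟩ ?_ ?_
  · intro e' he'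
    rw [(he e').1 he']
    exact h
  · constructor
    · exact fun hr => ⟨e, (he e).2 rfl, hr⟩
    · rintro ⟨_, _, hr⟩
      exact hr

/-- The derivation is well founded, and an infinite run would descend in it forever. -/
theorem not_infinite (h : Settles step acc safe c r) :
    ∀ run : ℕ → C, run 0 = c → ¬ ∀ i, step (run i) (run (i + 1)) := by
  induction h with
  | mk c r rs _ _ _ ih =>
    intro run h0 hrun
    exact ih (run 1) (h0 ▸ hrun 0) (fun i => run (i + 1)) rfl fun i => hrun (i + 1)

theorem accepts_iff (h : Settles step acc safe c r) :
    (∃ d, Relation.ReflTransGen step c d ∧ (∀ e, ¬ step d e) ∧ acc d) ↔ r := by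
  induction h with
  | mk c r rs _ _ hr ih =>
    rw [hr]
    constructor
    · rintro ⟨d, hcd, hd, ha⟩
      rcases Relation.ReflTransGen.cases_head hcd with rfl | ⟨e, he, hed⟩
      · exact Or.inl ⟨hd, ha⟩
      · exact Or.inr ⟨e, he, (ih e he).1 ⟨d, hed, hd, ha⟩⟩
    · rintro (⟨hh, ha⟩ | ⟨e, he, hre⟩)
      · exact ⟨c, .refl, hh, ha⟩
      · obtain ⟨d, hed, hd⟩ := (ih e he).2 hre
        exact ⟨d, .head he hed, hd⟩

theorem safe_of_reaches (h : Settles step acc safe c r) :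
    ∀ d, Relation.ReflTransGen step c d → safe d := by
  induction h with
  | mk c r rs hs _ _ ih =>
    intro d hd
    rcases Relation.ReflTransGen.cases_head hd with rfl | ⟨e, he, hed⟩
    · exact hs
    · exact ih e he d hed

/-- The successors of `c` are the `f o` for `o ∈ T`. -/
theorem of_image {O : Type*} (T : Set O) (f : O → C) (rs : O → Prop) (hs : safe c)
    (hstep : ∀ e, step c e ↔ ∃ o ∈ T, e = f o)
    (h : ∀ o ∈ T, Settles step acc safe (f o) (rs o))
    (hr : r ↔ ((∀ o, o ∉ T) ∧ acc c) ∨ ∃ o ∈ T, rs o) : Settles step acc safe c r := by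
  refine ⟨c, r, fun e => ∃ o ∈ T, e = f o ∧ rs o, hs, ?_, ?_⟩
  · intro e he
    obtain ⟨o, ho, rfl⟩ := (hstep e).1 he
    -- Since `f` need not be injective, the result attached to a successor is the disjunction over
    -- all actions that lead to it.
    by_cases hex : ∃ o' ∈ T, f o = f o' ∧ rs o'
    · obtain ⟨o', ho', h1, h2⟩ := hex
      rw [h1]
      exact (h o' ho').congr ⟨fun _ => ⟨o', ho', rfl, h2⟩, fun _ => h2⟩
    · exact (h o ho).congr ⟨fun h => ⟨o, ho, rfl, h⟩, fun h => (hex h).elim⟩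
  · rw [hr]
    refine or_congr (and_congr_left fun _ => ?_) ?_
    · constructor
      · intro h e he
        obtain ⟨o, ho, -⟩ := (hstep e).1 he
        exact h o ho
      · exact fun h o ho => h (f o) ((hstep _).2 ⟨o, ho, rfl⟩)
    · constructor
      · rintro ⟨o, ho, h⟩
        exact ⟨f o, (hstep _).2 ⟨o, ho, rfl⟩, o, ho, rfl, h⟩
      · rintro ⟨_, _, o, ho, _, h⟩
        exact ⟨o, ho, h⟩

/-- Transfer along a map that is a functional bisimulation. -/
theorem map {D : Type*} {step' : D → D → Prop} {acc' safe' : D → Prop} (f : C → D)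
    (hstep : ∀ c d, step' (f c) d ↔ ∃ c', step c c' ∧ f c' = d)
    (hacc : ∀ c, acc' (f c) ↔ acc c) (hsafe : ∀ c, safe c → safe' (f c))
    (h : Settles step acc safe c r) : Settles step' acc' safe' (f c) r := by
  induction h with
  | mk c r rs hs _ hr ih =>
    refine of_image {c' | step c c'} f rs (hsafe c hs) ?_ ih ?_
    · intro d
      rw [hstep]
      exact exists_congr fun c' => and_congr_right fun _ => eq_comm
    · rw [hr, hacc]
      rfl

end Settles

/-! ### Register machines -/

section Registers

/-- A right hand side of a register assignment: `none` is zero, `some (k, b)` is the content of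
register `k`, plus one if `b` holds. -/
abbrev Rhs (κ : Type) : Type := Option (κ × Bool)

/-- The value of an expression in the natural numbers. -/
def Rhs.eval {κ : Type} (m : κ → ℕ) : Rhs κ → ℕ
  | none => 0
  | some (k, b) => m k + b.toNat

/-- A machine with a two-way input head and finitely many registers for natural numbers, which in
each step sees the input symbol under the head and which registers are equal. -/
structure RegMachine (Γ κ : Type) where
  State : Type
  finite_state : Finite State
  start : State
  accept : Set State
  trans : State → Γ → (κ → κ → Bool) → Set (State × Move × (κ → Rhs κ))

namespace RegMachine

variable {Γ κ : Type} (R : RegMachine Γ κ)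

/-- A configuration: state, position of the input head and register contents. -/
structure Cfg where
  state : R.State
  pos : ℕ
  reg : κ → ℕ

open Classical in
/-- Which registers are equal. -/
noncomputable def eqView (m : κ → ℕ) (i j : κ) : Bool := decide (m i = m j)

/-- The configuration after the action `o`. -/
def next (n : ℕ) (c : R.Cfg) (o : R.State × Move × (κ → Rhs κ)) : R.Cfg :=
  ⟨o.1, min (o.2.1.apply c.pos) (n + 1), fun k => (o.2.2 k).eval c.reg⟩

/-- One step on the input `inp` of length `n`. -/
def Step (inp : ℕ → Γ) (n : ℕ) (c c' : R.Cfg) : Prop :=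
  ∃ o ∈ R.trans c.state (inp c.pos) (eqView c.reg), c' = R.next n c o

/-- The state is an accepting one. -/
def Acc (c : R.Cfg) : Prop := c.state ∈ R.accept

end RegMachine

end Registers

/-! ### Binary increments -/

section Binary

/-- The carry into bit `i` when `b` is added to `m`. -/
def carry (b : Bool) (m : ℕ) : ℕ → Bool
  | 0 => b
  | i + 1 => carry b m i && m.testBit i

/-- The definition propagates the carry upwards; splitting off the lowest bit instead matches the
recursion of `Nat.testBit`. -/
theorem carry_succ' (b : Bool) (m i : ℕ) :
    carry b m (i + 1) = carry (b && m.testBit 0) (m / 2) i := by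
  induction i with
  | zero => simp [carry]
  | succ i ih => rw [carry, ih, carry, Nat.testBit_add_one]

/-- Halving `m + b` gives `m / 2` plus the carry out of bit `0`, so the induction is on the bit,
with `m` and `b` varying. -/
theorem testBit_add_toNat (b : Bool) (m i : ℕ) :
    (m + b.toNat).testBit i = (m.testBit i ^^ carry b m i) := by
  induction i generalizing m b with
  | zero =>
    cases b <;> simp [carry, Nat.testBit_zero]
    rcases Nat.mod_two_eq_zero_or_one m with h | h <;> simp [Nat.add_mod, h]
  | succ i ih =>
    rw [Nat.testBit_add_one, Nat.testBit_add_one, carry_succ', ← ih]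
    congr 1
    cases b
    · simp
    · rcases Nat.mod_two_eq_zero_or_one m with h | h <;> simp [Nat.testBit_zero, h] <;> omega

end Binary

/-! ### Registers in binary on one work tape -/

namespace RegMachine

variable {Γ κ : Type} (R : RegMachine Γ κ)

/-- Tape symbols: `none` is blank, `some none` marks the left end, and `some (some col)` is a
column with one bit for each register. -/
abbrev Column (κ : Type) : Type := Option (Option (κ → Bool))

/-- The bits written for the expressions `e` over a column; the flag of an expression is the
current carry. -/
def outBits (e : κ → Rhs κ) (col : κ → Bool) (k : κ) : Bool :=
  match e k with
  | none => false
  | some (j, b) => col j ^^ b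

/-- The expressions with the carry into the next column. -/
def nextCarry (e : κ → Rhs κ) (col : κ → Bool) (k : κ) : Rhs κ :=
  match e k with
  | none => none
  | some (j, b) => some (j, b && col j)

/-- Registers that have agreed so far and agree in the column. -/
def meetEq (E : κ → κ → Bool) (col : κ → Bool) (i j : κ) : Bool := E i j && (col i == col j)

/-- The column that holds bit `i` of all registers. -/
def bitColumn (m : κ → ℕ) (i : ℕ) : κ → Bool := fun k => (m k).testBit i

/-- The tape in the middle of an update: the first `i` columns hold the new values `m'`, the
columns from `i` to `D` the old values `m`. -/
def sweepTape (m' m : κ → ℕ) (i D : ℕ) : ℕ → Column κ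
  | 0 => some none
  | j + 1 => if j < i then some (some (bitColumn m' j))
    else if j < D then some (some (bitColumn m j)) else none

/-- Cell `0` holds the end marker, so column `i` lies in cell `i + 1`. For `i = D` the update
appends a column. -/
theorem sweepTape_update (m' m : κ → ℕ) (i D : ℕ) :
    Function.update (sweepTape m' m i D) (i + 1) (some (some (bitColumn m' i))) =
      sweepTape m' m (i + 1) D := by
  funext j
  rcases j with _ | j
  · simp [sweepTape]
  · by_cases hj : j = i
    · subst hj
      simp [sweepTape]
    · rw [Function.update_of_ne (by omega)]
      simp only [sweepTape]
      split_ifs <;> first | rfl | omega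

/-- The expressions `e` with the carries into column `i`. -/
def carriedRhs (e : κ → Rhs κ) (m : κ → ℕ) (i : ℕ) (k : κ) : Rhs κ :=
  match e k with
  | none => none
  | some (j, b) => some (j, carry b (m j) i)

theorem outBits_carriedRhs (e : κ → Rhs κ) (m : κ → ℕ) (i : ℕ) :
    outBits (carriedRhs e m i) (bitColumn m i) = bitColumn (fun k => (e k).eval m) i := by
  funext k
  simp only [outBits, carriedRhs, bitColumn]
  rcases e k with _ | ⟨j, b⟩
  · simp [Rhs.eval]
  · simp [Rhs.eval, testBit_add_toNat]

theorem nextCarry_carriedRhs (e : κ → Rhs κ) (m : κ → ℕ) (i : ℕ) :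
    nextCarry (carriedRhs e m i) (bitColumn m i) = carriedRhs e m (i + 1) := by
  funext k
  simp only [nextCarry, carriedRhs, bitColumn]
  rcases e k with _ | ⟨j, b⟩
  · rfl
  · simp [carry]

open Classical in
/-- Which registers agree on the first `i` bits. -/
noncomputable def eqUpTo (m : κ → ℕ) (i : ℕ) (k l : κ) : Bool :=
  decide (∀ j < i, (m k).testBit j = (m l).testBit j)

theorem meetEq_eqUpTo (m : κ → ℕ) (i : ℕ) :
    meetEq (eqUpTo m i) (bitColumn m i) = eqUpTo m (i + 1) := by
  funext k l
  rw [Bool.eq_iff_iff]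
  simp only [meetEq, eqUpTo, bitColumn, Bool.and_eq_true, decide_eq_true_eq, beq_iff_eq]
  constructor
  · rintro ⟨h1, h2⟩ j hj
    rcases Nat.lt_succ_iff_lt_or_eq.1 hj with h | rfl
    · exact h1 j h
    · exact h2
  · exact fun h => ⟨fun j hj => h j (by omega), h i (by omega)⟩

theorem eqUpTo_eq_eqView (m : κ → ℕ) (D : ℕ) (hm : ∀ k, m k < 2 ^ D) :
    eqUpTo m D = eqView m := by
  funext k l
  rw [Bool.eq_iff_iff]
  simp only [eqUpTo, eqView, decide_eq_true_eq]
  constructor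
  · intro h
    refine Nat.eq_of_testBit_eq fun j => ?_
    by_cases hj : j < D
    · exact h j hj
    · have hp : 2 ^ D ≤ 2 ^ j := Nat.pow_le_pow_right (by norm_num) (by omega)
      rw [Nat.testBit_eq_false_of_lt ((hm k).trans_le hp),
        Nat.testBit_eq_false_of_lt ((hm l).trans_le hp)]
  · intro h j _
    rw [h]

/-- Control states of the simulating machine: `none` at the start, `inl` when returning to the left
end, `inr` when updating the registers from the least to the most significant bit. -/
abbrev SweepState : Type :=
  Option ((R.State × (κ → κ → Bool)) ⊕ (R.State × (κ → Rhs κ) × (κ → κ → Bool)))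

open Classical in
/-- The actions of the simulating machine. -/
noncomputable def sweepTrans : R.SweepState → Γ → Column κ →
    Set (R.SweepState × Move × Column κ × Move)
  | none, _, _ => {(some (.inl (R.start, fun _ _ => true)), .stay, some none, .stay)}
  | some (.inl (s, E)), a, some none =>
    (fun o => (some (.inr (o.1, o.2.2, fun _ _ => true)), o.2.1, some none, .right)) ''
      R.trans s a E
  | some (.inl (s, E)), _, x => {(some (.inl (s, E)), .stay, x, .left)}
  | some (.inr (s, e, E)), _, some (some col) =>
    {(some (.inr (s, nextCarry e col, meetEq E (outBits e col))), .stay,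
      some (some (outBits e col)), .right)}
  | some (.inr (s, e, E)), _, none =>
    if outBits e (fun _ => false) = fun _ => false then {(some (.inl (s, E)), .stay, none, .left)}
    else {(some (.inl (s, meetEq E (outBits e fun _ => false))), .stay,
      some (some (outBits e fun _ => false)), .left)}
  | some (.inr _), _, some none => ∅

/-- The Turing machine that simulates a register machine on one work tape. -/
noncomputable def toTM [Finite κ] {A : Type*} (code : InSym A → Γ) : TM A where
  State := R.SweepState
  Sym := Column κ
  finite_state := by
    have := R.finite_state
    infer_instance
  finite_sym := inferInstance
  tapes := 1
  blank := none
  start := none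
  accept := {q | ∃ s E, q = some (.inl (s, E)) ∧ s ∈ R.accept}
  trans q a x := (fun o => (o.1, o.2.1, fun _ => (o.2.2.1, o.2.2.2))) ''
    R.sweepTrans q (code a) (x 0)

end RegMachine

namespace TM

variable {A : Type*} (M : TM A)

/-- The configuration after the action `o`. -/
def next (W : List A) (c : M.Cfg) (o : M.State × Move × (Fin M.tapes → M.Sym × Move)) :
    M.Cfg where
  state := o.1
  inPos := min (o.2.1.apply c.inPos) (W.length + 1)
  tape j := Function.update (c.tape j) (c.head j) (o.2.2 j).1
  head j := (o.2.2 j).2.apply (c.head j)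

theorem step_iff (W : List A) (c c' : M.Cfg) : M.Step W c c' ↔
    ∃ o ∈ M.trans c.state (readInput W c.inPos) (fun j => c.tape j (c.head j)),
      c' = M.next W c o := by
  unfold Step
  refine exists_congr fun o => and_congr_right fun _ => ?_
  constructor
  · rintro ⟨h1, h2, h3, h4⟩
    rcases c' with ⟨s, p, t, h⟩
    simp only [next, Cfg.mk.injEq]
    exact ⟨h1, h2, funext h3, funext h4⟩
  · rintro rfl
    exact ⟨rfl, rfl, fun _ => rfl, fun _ => rfl⟩

end TM

namespace RegMachine

variable {Γ κ : Type} (R : RegMachine Γ κ) [Finite κ] {A : Type*} (code : InSym A → Γ)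

theorem toTM_isDeterministic (h : ∀ s a E, (R.trans s a E).Subsingleton) :
    (R.toTM code).IsDeterministic := by
  intro q a x
  refine Set.Subsingleton.image ?_ _
  generalize x (0 : Fin 1) = y
  rcases q with _ | ⟨⟨s, E⟩ | ⟨s, e, E⟩⟩
  · exact Set.subsingleton_singleton
  · rcases y with _ | _ | col
    · exact Set.subsingleton_singleton
    · exact (h _ _ _).image _
    · exact Set.subsingleton_singleton
  · rcases y with _ | _ | col
    · simp only [sweepTrans]
      split_ifs
      · exact Set.subsingleton_singleton
      · exact Set.subsingleton_singleton
    · exact Set.subsingleton_empty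
    · exact Set.subsingleton_singleton

/-- A configuration of the simulating machine. -/
def tmCfg (q : R.SweepState) (p : ℕ) (tape : ℕ → Column κ) (h : ℕ) : (R.toTM code).Cfg where
  state := q
  inPos := p
  tape _ := tape
  head _ := h

theorem toTM_step_iff (W : List A) (q : R.SweepState) (p : ℕ) (tape : ℕ → Column κ) (h : ℕ)
    (c' : (R.toTM code).Cfg) :
    (R.toTM code).Step W (R.tmCfg code q p tape h) c' ↔
      ∃ o ∈ R.sweepTrans q (code (TM.readInput W p)) (tape h),
        c' = R.tmCfg code o.1 (min (o.2.1.apply p) (W.length + 1))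
          (Function.update tape h o.2.2.1) (o.2.2.2.apply h) := by
  rw [TM.step_iff]
  constructor
  · rintro ⟨_, ⟨o, ho, rfl⟩, rfl⟩
    exact ⟨o, ho, rfl⟩
  · rintro ⟨o, ho, rfl⟩
    exact ⟨_, ⟨o, ho, rfl⟩, rfl⟩

variable {W : List A} {B : ℕ}

/-- The heads stay within the bound for registers up to `B`. -/
def TapeSafe (B : ℕ) (c : (R.toTM code).Cfg) : Prop := ∀ j, c.head j ≤ Nat.log 2 B + 2

/-- Acceptance by the state of the simulating machine. -/
def TapeAcc (c : (R.toTM code).Cfg) : Prop := c.state ∈ (R.toTM code).accept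

theorem settles_return {s : R.State} {E : κ → κ → Bool} {p : ℕ} {m : κ → ℕ} {D : ℕ} {r : Prop}
    (hD : D ≤ Nat.log 2 B + 1) (hp : p ≤ W.length + 1)
    (h : Settles ((R.toTM code).Step W) (R.TapeAcc code) (R.TapeSafe code B)
      (R.tmCfg code (some (.inl (s, E))) p (sweepTape m m D D) 0) r) :
    ∀ i ≤ D + 1, Settles ((R.toTM code).Step W) (R.TapeAcc code) (R.TapeSafe code B)
      (R.tmCfg code (some (.inl (s, E))) p (sweepTape m m D D) i) r := by
  intro i
  induction i with
  | zero => exact fun _ => h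
  | succ i ih =>
    intro hi
    refine Settles.of_unique_step _ (fun _ => ?_) ?_ (ih (by omega))
    · simp only [tmCfg]
      omega
    · intro c'
      rw [toTM_step_iff]
      have ht : R.sweepTrans (some (.inl (s, E))) (code (TM.readInput W p))
          (sweepTape m m D D (i + 1)) =
          {(some (.inl (s, E)), .stay, sweepTape m m D D (i + 1), .left)} := by
        simp only [sweepTape]
        split_ifs <;> simp [sweepTrans]
      rw [ht]
      simp only [Set.mem_singleton_iff, exists_eq_left, Function.update_eq_self, Move.apply,
        Nat.add_sub_cancel, min_eq_left hp]

/-- Invariant of the sweep to the right: the columns below `i` are rewritten, and the control holds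
the carries into column `i` and the equalities of the new values on their first `i` bits. A blank
cell counts as a zero column. An expression adds at most one, so at most one further column is
needed, and it is written only if it contains a set bit. The width after the sweep is therefore `D`
or `D + 1`, whence the quantifier over `D'`. -/
theorem settles_update {s : R.State} {e : κ → Rhs κ} {p : ℕ} {m : κ → ℕ} {D : ℕ} {r : Prop}
    (hD : D ≤ Nat.log 2 B + 1) (hp : p ≤ W.length + 1) (hm : ∀ k, m k < 2 ^ D)
    (hB : ∀ k, (e k).eval m ≤ B)
    (h : ∀ D' ≤ Nat.log 2 B + 1, (∀ k, (e k).eval m < 2 ^ D') →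
      Settles ((R.toTM code).Step W) (R.TapeAcc code) (R.TapeSafe code B)
      (R.tmCfg code (some (.inl (s, eqView fun k => (e k).eval m))) p
        (sweepTape (fun k => (e k).eval m) (fun k => (e k).eval m) D' D') 0) r) :
    ∀ j i, i + j = D → Settles ((R.toTM code).Step W) (R.TapeAcc code) (R.TapeSafe code B)
      (R.tmCfg code (some (.inr (s, carriedRhs e m i, eqUpTo (fun k => (e k).eval m) i))) p
        (sweepTape (fun k => (e k).eval m) m i D) (i + 1)) r := by
  set m' : κ → ℕ := fun k => (e k).eval m with hm'
  have hself : ∀ i, sweepTape m' m i i = sweepTape m' m' i i := by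
    intro i
    funext j
    rcases j with _ | j
    · rfl
    · simp only [sweepTape]
      split_ifs <;> rfl
  intro j
  induction j with
  | zero =>
    rintro i rfl
    rw [add_zero] at *
    have hz : bitColumn m i = fun _ => false := by
      funext k
      exact Nat.testBit_eq_false_of_lt (hm k)
    have hout := outBits_carriedRhs e m i
    rw [hz] at hout
    have hlt : ∀ k, m' k < 2 ^ (i + 1) := by
      intro k
      have h2 : m' k ≤ 2 ^ i := by
        rw [hm']
        simp only
        rcases he : e k with _ | ⟨l, b⟩
        · simp [Rhs.eval]
        · have := hm l
          simp only [Rhs.eval]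
          cases b <;> simp <;> omega
      have : 2 ^ i < 2 ^ (i + 1) := Nat.pow_lt_pow_right (by norm_num) (by omega)
      omega
    have htape : sweepTape m' m i i (i + 1) = none := by simp [sweepTape]
    by_cases h0 : bitColumn m' i = fun _ => false
    · have hlt' : ∀ k, m' k < 2 ^ i := by
        intro k
        refine Nat.lt_of_testBit i (congrFun h0 k) (by simp) ?_
        intro l hl
        have hp : 2 ^ (i + 1) ≤ 2 ^ l := Nat.pow_le_pow_right (by norm_num) (by omega)
        rw [Nat.testBit_eq_false_of_lt ((hlt k).trans_le hp),
          Nat.testBit_eq_false_of_lt (Nat.pow_lt_pow_right (by norm_num) (by omega))]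
      refine Settles.of_unique_step
        (R.tmCfg code (some (.inl (s, eqView m'))) p (sweepTape m' m' i i) i) (fun _ => ?_) ?_
        (R.settles_return code hD hp (h i hD hlt') i (by omega))
      · simp only [tmCfg]
        omega
      · intro c'
        rw [toTM_step_iff, htape]
        simp only [sweepTrans]
        rw [if_pos (hout.trans h0)]
        simp only [Set.mem_singleton_iff, exists_eq_left, Move.apply,
          Nat.add_sub_cancel, min_eq_left hp]
        rw [← htape, Function.update_eq_self, hself, eqUpTo_eq_eqView _ _ hlt']
    -- A set bit `i` forces some value to be at least `2 ^ i`, while all values are at most `B`.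
    · have hi : i + 1 ≤ Nat.log 2 B + 1 := by
        by_contra hcon
        apply h0
        funext k
        refine Nat.testBit_eq_false_of_lt ?_
        have h1 : B < 2 ^ (Nat.log 2 B + 1) := Nat.lt_pow_succ_log_self (by norm_num) B
        have h2 : 2 ^ (Nat.log 2 B + 1) ≤ 2 ^ i := Nat.pow_le_pow_right (by norm_num) (by omega)
        exact (hB k).trans_lt (h1.trans_le h2)
      refine Settles.of_unique_step
        (R.tmCfg code (some (.inl (s, eqView m'))) p (sweepTape m' m' (i + 1) (i + 1)) i)
        (fun _ => ?_) ?_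
        (R.settles_return code hi hp (h (i + 1) hi hlt) i (by omega))
      · simp only [tmCfg]
        omega
      · intro c'
        rw [toTM_step_iff, htape]
        simp only [sweepTrans]
        rw [if_neg (fun h => h0 (hout.symm.trans h)), hout]
        simp only [Set.mem_singleton_iff, exists_eq_left, Move.apply,
          Nat.add_sub_cancel, min_eq_left hp]
        rw [meetEq_eqUpTo, eqUpTo_eq_eqView _ _ hlt, sweepTape_update]
        have : sweepTape m' m (i + 1) i = sweepTape m' m' (i + 1) (i + 1) := by
          funext j
          rcases j with _ | j
          · rfl
          · simp only [sweepTape]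
            split_ifs <;> first | rfl | omega
        rw [this]
  | succ j ih =>
    intro i hi
    refine Settles.of_unique_step _ (fun _ => ?_) ?_ (ih (i + 1) (by omega))
    · simp only [tmCfg]
      omega
    · intro c'
      have htape : sweepTape m' m i D (i + 1) = some (some (bitColumn m i)) := by
        simp only [sweepTape]
        rw [if_neg (by omega), if_pos (by omega)]
      rw [toTM_step_iff, htape]
      simp only [sweepTrans, outBits_carriedRhs, nextCarry_carriedRhs]
      simp only [Set.mem_singleton_iff, exists_eq_left, Move.apply, min_eq_left hp]
      rw [sweepTape_update, meetEq_eqUpTo]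

/-- One step of the register machine is an action on the end marker, a sweep and a return; the
equality view for the next step is gathered during the sweep. The bound on `c.pos` propagates
because every move is truncated at `W.length + 1`. -/
theorem settles_toTM {c : R.Cfg} {r : Prop}
    (h : Settles (R.Step (fun i => code (TM.readInput W i)) W.length) R.Acc
      (fun c => ∀ k, c.reg k ≤ B) c r) :
    c.pos ≤ W.length + 1 → ∀ D ≤ Nat.log 2 B + 1, (∀ k, c.reg k < 2 ^ D) →
    Settles ((R.toTM code).Step W) (R.TapeAcc code) (R.TapeSafe code B)
      (R.tmCfg code (some (.inl (c.state, eqView c.reg))) c.pos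
        (sweepTape c.reg c.reg D D) 0) r := by
  induction h with
  | mk c r rs hs hstep hr ih =>
    intro hpos D hD hlt
    let f : R.State × Move × (κ → Rhs κ) → (R.toTM code).Cfg := fun o =>
      R.tmCfg code (some (.inr (o.1, o.2.2, fun _ _ => true)))
        (min (o.2.1.apply c.pos) (W.length + 1)) (sweepTape c.reg c.reg D D) 1
    have hiff : ∀ e, (R.toTM code).Step W (R.tmCfg code (some (.inl (c.state, eqView c.reg)))
        c.pos (sweepTape c.reg c.reg D D) 0) e ↔
        ∃ o ∈ R.trans c.state (code (TM.readInput W c.pos)) (eqView c.reg), e = f o := by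
      intro e
      rw [toTM_step_iff]
      have h0 : sweepTape c.reg c.reg D D 0 = some none := rfl
      rw [h0]
      simp only [sweepTrans, Set.mem_image]
      constructor
      · rintro ⟨_, ⟨o, ho, rfl⟩, rfl⟩
        refine ⟨o, ho, ?_⟩
        simp only [← h0, Function.update_eq_self]
        rfl
      · rintro ⟨o, ho, rfl⟩
        refine ⟨_, ⟨o, ho, rfl⟩, ?_⟩
        simp only [← h0, Function.update_eq_self]
        rfl
    have key : ∀ o ∈ R.trans c.state (code (TM.readInput W c.pos)) (eqView c.reg),
        Settles ((R.toTM code).Step W) (R.TapeAcc code) (R.TapeSafe code B) (f o)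
          (rs (R.next W.length c o)) := by
      intro o ho
      have hst : R.Step (fun i => code (TM.readInput W i)) W.length c (R.next W.length c o) :=
        ⟨o, ho, rfl⟩
      have := R.settles_update (W := W) code (s := o.1) (e := o.2.2) (m := c.reg)
        (p := min (o.2.1.apply c.pos) (W.length + 1)) (r := rs (R.next W.length c o)) hD
        (min_le_right _ _) hlt ((hstep _ hst).safe_self)
        (fun D' hD' hlt' => ih _ hst (min_le_right _ _) D' hD' hlt') D 0 (by omega)
      have h1 : carriedRhs o.2.2 c.reg 0 = o.2.2 := by
        funext k
        simp only [carriedRhs]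
        rcases o.2.2 k with _ | ⟨j, b⟩ <;> rfl
      have h2 : eqUpTo (fun k => (o.2.2 k).eval c.reg) 0 = fun _ _ => true := by
        funext k l
        simp [eqUpTo]
      have h3 : sweepTape (fun k => (o.2.2 k).eval c.reg) c.reg 0 D =
          sweepTape c.reg c.reg D D := by
        funext j
        rcases j with _ | j
        · rfl
        · simp only [sweepTape]
          split_ifs <;> first | rfl | omega
      rw [h1, h2, h3] at this
      exact this
    refine Settles.of_image _ f (fun o => rs (R.next W.length c o)) (fun _ => ?_) hiff key ?_
    · simp only [tmCfg]
      omega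
    · rw [hr]
      refine or_congr (and_congr ?_ ?_) ?_
      · exact ⟨fun h o ho => h _ ⟨o, ho, rfl⟩, fun h _ ⟨o, ho, _⟩ => h o ho⟩
      · constructor
        · intro h
          exact ⟨_, _, rfl, h⟩
        · rintro ⟨s, E, hE, hs⟩
          simp only [tmCfg, Option.some.injEq, Sum.inl.injEq, Prod.mk.injEq] at hE
          rw [Acc, hE.1]
          exact hs
      · constructor
        · rintro ⟨_, ⟨o, ho, rfl⟩, h⟩
          exact ⟨o, ho, h⟩
        · rintro ⟨o, ho, h⟩
          exact ⟨_, ⟨o, ho, rfl⟩, h⟩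

theorem toTM_settles_init {r : Prop}
    (h : Settles (R.Step (fun i => code (TM.readInput W i)) W.length) R.Acc
      (fun c => ∀ k, c.reg k ≤ B) ⟨R.start, 0, fun _ => 0⟩ r) :
    Settles ((R.toTM code).Step W) (R.TapeAcc code) (R.TapeSafe code B) (R.toTM code).init r := by
  have hinit : (R.toTM code).init = R.tmCfg code none 0 (fun _ => none) 0 := rfl
  rw [hinit]
  refine Settles.of_unique_step _ (fun _ => ?_) ?_
    (R.settles_toTM code h (Nat.zero_le _) 0 (Nat.zero_le _) (fun _ => by simp))
  · simp [tmCfg]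
  · intro c'
    rw [toTM_step_iff]
    simp only [sweepTrans, Set.mem_singleton_iff, exists_eq_left, Move.apply]
    have h1 : eqView (fun _ : κ => 0) = fun _ _ => true := by
      funext k l
      simp [eqView]
    have h2 : Function.update (fun _ : ℕ => (none : Column κ)) 0 (some none) =
        sweepTape (fun _ : κ => 0) (fun _ => 0) 0 0 := by
      funext j
      rcases j with _ | j
      · simp [sweepTape]
      · simp [sweepTape]
    rw [h1, h2]
    simp

/-- A register machine that settles on every input with registers bounded by `n + 2` gives a
logarithmic space Turing machine. -/
theorem toTM_decides (K : _root_.Language A)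
    (h : ∀ W : List A, Settles (R.Step (fun i => code (TM.readInput W i)) W.length) R.Acc
      (fun c => ∀ k, c.reg k ≤ W.length + 2) ⟨R.start, 0, fun _ => 0⟩ (W ∈ K)) :
    (R.toTM code).IsLogSpace ∧ (R.toTM code).Decides K := by
  -- The heads stay within `Nat.log 2 (n + 2) + 2 ≤ Nat.log 2 n + 4`, which is less than `6 *
  -- (Nat.log 2 n + 1)`.
  refine ⟨⟨6, fun W c hc j => ?_⟩, fun W => ⟨?_, ?_⟩⟩
  · have h1 := (R.toTM_settles_init code (h W)).safe_of_reaches c hc j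
    have h2 : Nat.log 2 (W.length + 2) ≤ Nat.log 2 W.length + 2 := by
      rcases Nat.eq_zero_or_pos W.length with h0 | h0
      · rw [h0]
        exact (Nat.log_le_self 2 _).trans (by simp)
      · refine Nat.lt_succ_iff.1 (Nat.log_lt_of_lt_pow (by omega) ?_)
        have h3 := Nat.lt_pow_succ_log_self (b := 2) (by norm_num) W.length
        have h4 : 2 ^ (Nat.log 2 W.length + 2).succ = 2 ^ (Nat.log 2 W.length).succ * 4 := by
          rw [Nat.succ_eq_add_one, Nat.succ_eq_add_one]
          ring
        omega
    omega
  · rintro ⟨run, h0, hrun⟩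
    exact (R.toTM_settles_init code (h W)).not_infinite run h0 hrun
  · exact (R.toTM_settles_init code (h W)).accepts_iff

end RegMachine

end UnifLog

/-! ### Machines with pointers into a cyclic input -/

namespace UnifLog

/-- The value of a right hand side in `Fin (N + 1)`, where the successor of the last element
is `0`. -/
def Rhs.cyc {ι : Type} {N : ℕ} (m : ι → Fin (N + 1)) : Rhs ι → Fin (N + 1)
  | none => 0
  | some (k, b) => if b then m k + 1 else m k

/-- A machine with registers indexed by `ι` for elements of some `Fin (N + 1)`, which in each step
sees a view in `Vw` of the register contents. -/
structure ViewMachine (ι Vw : Type) where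
  State : Type
  finite_state : Finite State
  start : State
  accept : Set State
  trans : State → Vw → Set (State × (ι → Rhs ι))

namespace ViewMachine

variable {ι Vw : Type} (P : ViewMachine ι Vw) {N : ℕ}

/-- One step, for views given by `view`. -/
def Step (view : (ι → Fin (N + 1)) → Vw) (c c' : P.State × (ι → Fin (N + 1))) : Prop :=
  ∃ o ∈ P.trans c.1 (view c.2), c' = (o.1, fun k => (o.2 k).cyc c.2)

/-- The state is an accepting one. -/
def Acc (c : P.State × (ι → Fin (N + 1))) : Prop := c.1 ∈ P.accept

/-- At most one action is possible in any situation. -/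
def Det : Prop := ∀ s a, (P.trans s a).Subsingleton

end ViewMachine

/-- What a machine sees of registers that point to cells of a cyclic input: the symbols in these
cells, which pointers are equal, which ones are adjacent, and which ones point to the last cell. -/
structure PtrView (Γ ι : Type) where
  sym : ι → Γ
  eq : ι → ι → Bool
  adj : ι → ι → Bool
  top : ι → Bool

open Classical in
/-- The view of the pointers `m` into the cells `0, …, n` of an input word of length `n`. -/
noncomputable def ptrView {Γ ι : Type} (W : List Γ) (m : ι → Fin (W.length + 1)) :
    PtrView (InSym Γ) ι where
  sym i := TM.readInput W (m i)
  eq i j := decide (m i = m j)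
  adj i j := decide (m j = m i + 1)
  top i := decide (m i = Fin.last W.length)

theorem readInput_eq_leftEnd_iff {A : Type*} (W : List A) (i : ℕ) :
    TM.readInput W i = .leftEnd ↔ i = 0 := by
  rcases i with _ | i
  · simp [TM.readInput]
  · simp only [TM.readInput]
    rcases W[i]? with _ | a <;> simp

theorem readInput_eq_rightEnd_iff {A : Type*} (W : List A) (i : ℕ) :
    TM.readInput W i = .rightEnd ↔ W.length < i := by
  rcases i with _ | i
  · simp [TM.readInput]
  · simp only [TM.readInput]
    rcases h : W[i]? with _ | a
    · rw [List.getElem?_eq_none_iff] at h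
      simp
      omega
    · obtain ⟨h', -⟩ := List.getElem?_eq_some_iff.1 h
      simp
      omega

theorem InSym.finite {A : Type*} [Finite A] : Finite (InSym A) := by
  refine Finite.of_injective (β := Option (Option A)) (fun x => match x with
    | .leftEnd => none
    | .rightEnd => some none
    | .letter a => some (some a)) ?_
  rintro (_ | a | _) (_ | b | _) h <;> simp_all

namespace ViewMachine

variable {Γ ι : Type} (P : ViewMachine ι (PtrView (InSym Γ) ι))

/-- Registers of the simulating machine: the pointers, their successors, and three auxiliary ones:
a copy of the position of the input head, the length of the input plus one, and the number one. -/
abbrev ScanReg (ι : Type) : Type := (ι × Bool) ⊕ Fin 3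

/-- States of the simulating machine: `none` at the start, `some none` when the input is measured,
`inl` when the input head returns to the left end, and `inr` when it scans the input in order to
find the symbols in the cells to which the pointers point. -/
abbrev ScanState : Type := Option (Option (P.State ⊕ (P.State × (ι → InSym Γ))))

/-- No change. -/
def keep (k : ScanReg ι) : Rhs (ScanReg ι) := some (k, false)

/-- Increment the auxiliary register `t` and keep the others. -/
def incAux (t : Fin 3) : ScanReg ι → Rhs (ScanReg ι)
  | .inl k => some (.inl k, false)
  | .inr t' => some (.inr t', t' = t)

/-- Reset the position and keep the other registers. -/
def resetPos : ScanReg ι → Rhs (ScanReg ι)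
  | .inl k => some (.inl k, false)
  | .inr t => if t = 0 then none else some (.inr t, false)

/-- The first assignment: all pointers are `0`. -/
def firstAssign : ScanReg ι → Rhs (ScanReg ι)
  | .inl (_, b) => some (.inr 0, b)
  | .inr t => if t = 0 then none else some (.inr 0, true)

/-- The assignment that simulates the assignment `e`. -/
def liftAssign (E : ScanReg ι → ScanReg ι → Bool) (e : ι → Rhs ι) :
    ScanReg ι → Rhs (ScanReg ι)
  | .inr t => some (.inr t, false)
  | .inl (i, b) =>
    match e i with
    | none => if b then some (.inr 2, false) else none
    | some (j, false) => some (.inl (j, b), false)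
    | some (j, true) =>
      if E (.inl (j, true)) (.inr 1) then (if b then some (.inr 2, false) else none)
      else some (.inl (j, true), b)

/-- The view computed from the scanned symbols and the equality of registers. -/
def liftView (f : ι → InSym Γ) (E : ScanReg ι → ScanReg ι → Bool) : PtrView (InSym Γ) ι where
  sym := f
  eq i j := E (.inl (i, false)) (.inl (j, false))
  adj i j := if E (.inl (i, true)) (.inr 1) then E (.inl (j, true)) (.inr 2)
    else E (.inl (i, true)) (.inl (j, false))
  top i := E (.inl (i, true)) (.inr 1)

section Assignments

variable {W : List Γ}

/-- The registers of the simulating machine. -/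
def encode (m : ι → Fin (W.length + 1)) (p : ℕ) : ScanReg ι → ℕ
  | .inl (i, b) => m i + b.toNat
  | .inr t => if t = 0 then p else if t = 1 then W.length + 1 else 1

theorem eval_keep (m : ScanReg ι → ℕ) : (fun k => (keep k).eval m) = m := by
  funext k
  simp [keep, Rhs.eval]

theorem eval_resetPos (m : ι → Fin (W.length + 1)) (p : ℕ) :
    (fun k => (resetPos k).eval (encode m p)) = encode m 0 := by
  funext k
  rcases k with k | t
  · simp [resetPos, Rhs.eval, encode]
  · by_cases ht : t = 0 <;> simp [resetPos, Rhs.eval, encode, ht]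

theorem eval_incAux_zero (m : ι → Fin (W.length + 1)) (p : ℕ) :
    (fun k => (incAux 0 k).eval (encode m p)) = encode m (p + 1) := by
  funext k
  rcases k with k | t
  · simp [incAux, Rhs.eval, encode]
  · by_cases ht : t = 0 <;> simp [incAux, Rhs.eval, encode, ht]

theorem eqView_encode_top (m : ι → Fin (W.length + 1)) (p : ℕ) (i : ι) :
    RegMachine.eqView (encode m p) (.inl (i, true)) (.inr 1) = true ↔
      m i = Fin.last W.length := by
  simp [RegMachine.eqView, encode, Fin.ext_iff]

/-- A pointer to the last cell is recognised by its stored successor `n + 1`, the content of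
auxiliary register `1`. Incremented, it wraps to `0`, with successor `1` copied from auxiliary
register `2`. In the other cases the stored successor becomes the pointer. -/
theorem eval_liftAssign (m : ι → Fin (W.length + 1)) (p : ℕ) (e : ι → Rhs ι) :
    (fun k => (liftAssign (RegMachine.eqView (encode m p)) e k).eval (encode m p)) =
      encode (fun i => (e i).cyc m) p := by
  funext k
  rcases k with ⟨i, b⟩ | t
  · simp only [liftAssign]
    rcases he : e i with _ | ⟨j, _ | _⟩
    · cases b <;> simp [Rhs.eval, encode, Rhs.cyc, he]
    · simp [Rhs.eval, encode, Rhs.cyc, he]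
    · simp only [eqView_encode_top]
      by_cases hl : m j = Fin.last W.length
      · cases b <;> simp [Rhs.eval, encode, Rhs.cyc, he, hl]
      · simp [Rhs.eval, encode, Rhs.cyc, he, hl, Fin.val_add_one]
  · simp [liftAssign, Rhs.eval, encode]

/-- Only equality of registers can be tested, which is why successors are stored: adjacency becomes
equality of a successor with a pointer. If `m i` is the last cell, its cyclic successor is `0`, and
`m j = 0` is tested as the successor of `m j` being `1`. -/
theorem liftView_encode (m : ι → Fin (W.length + 1)) (p : ℕ) :
    liftView (fun i => TM.readInput W (m i)) (RegMachine.eqView (encode m p)) = ptrView W m := by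
  simp only [liftView, ptrView, PtrView.mk.injEq, true_and]
  refine ⟨?_, ?_, ?_⟩
  · funext i j
    simp [RegMachine.eqView, encode, Fin.ext_iff]
  · funext i j
    rw [Bool.eq_iff_iff]
    simp only [eqView_encode_top]
    by_cases hl : m i = Fin.last W.length
    · simp only [hl, if_true, decide_eq_true_eq, Fin.last_add_one]
      simp [RegMachine.eqView, encode]
    · simp [RegMachine.eqView, encode, Fin.ext_iff, hl, Fin.val_add_one, eq_comm]
  · funext i
    rw [Bool.eq_iff_iff, eqView_encode_top, decide_eq_true_eq]

end Assignments

/-- The actions of the simulating machine. -/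
def scanTrans : P.ScanState → InSym Γ → (ScanReg ι → ScanReg ι → Bool) →
    Set (P.ScanState × Move × (ScanReg ι → Rhs (ScanReg ι)))
  | none, _, _ => {(some none, .right, firstAssign)}
  | some none, .rightEnd, _ => {(some (some (.inl P.start)), .stay, keep)}
  | some none, _, _ => {(some none, .right, incAux 1)}
  | some (some (.inl s)), .leftEnd, _ =>
    {(some (some (.inr (s, fun _ => .leftEnd))), .stay, resetPos)}
  | some (some (.inl s)), _, _ => {(some (some (.inl s)), .left, keep)}
  | some (some (.inr (s, f))), .rightEnd, E =>
    (fun o => (some (some (.inl o.1)), .stay, liftAssign E o.2)) '' P.trans s (liftView f E)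
  | some (some (.inr (s, f))), a, E =>
    {(some (some (.inr (s, fun i => if E (.inl (i, false)) (.inr 0) then a else f i))), .right,
      incAux 0)}

/-- The register machine that simulates a machine with pointers into the input. -/
def toRegMachine [Finite ι] [Finite Γ] : RegMachine (InSym Γ) (ScanReg ι) where
  State := P.ScanState
  finite_state := by
    have := P.finite_state
    have := InSym.finite (A := Γ)
    infer_instance
  start := none
  accept := {q | ∃ s f, q = some (some (.inr (s, f))) ∧ s ∈ P.accept}
  trans := P.scanTrans

variable [Finite ι] [Finite Γ]

theorem toRegMachine_subsingleton (h : P.Det) (s : P.ScanState) (a : InSym Γ)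
    (E : ScanReg ι → ScanReg ι → Bool) : (P.toRegMachine.trans s a E).Subsingleton := by
  rcases s with _ | _ | s | ⟨s, f⟩ <;> rcases a with _ | a | _ <;>
    first
    | exact Set.subsingleton_singleton
    | exact (h _ _).image _

variable {W : List Γ}

/-- A configuration of the simulating machine. -/
def scanCfg (q : P.ScanState) (p : ℕ) (m : ScanReg ι → ℕ) : P.toRegMachine.Cfg := ⟨q, p, m⟩

theorem toRegMachine_step_iff (q : P.ScanState) (p : ℕ) (m : ScanReg ι → ℕ)
    (c' : P.toRegMachine.Cfg) :
    P.toRegMachine.Step (TM.readInput W) W.length (P.scanCfg q p m) c' ↔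
      ∃ o ∈ P.scanTrans q (TM.readInput W p) (RegMachine.eqView m),
        c' = P.scanCfg o.1 (min (o.2.1.apply p) (W.length + 1)) fun k => (o.2.2 k).eval m :=
  Iff.rfl

/-- The registers are at most the length of the input plus two. -/
def RegSafe (W : List Γ) (c : P.toRegMachine.Cfg) : Prop := ∀ k, c.reg k ≤ W.length + 2

theorem regSafe_scanCfg (q : P.ScanState) (p p' : ℕ) (m : ι → Fin (W.length + 1))
    (hp : p' ≤ W.length + 1) : P.RegSafe W (P.scanCfg q p (encode m p')) := by
  rintro (⟨i, b⟩ | t)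
  · have := (m i).isLt
    have := b.toNat_le
    simp only [scanCfg, encode]
    omega
  · simp only [scanCfg, encode]
    split_ifs <;> omega

/-- Settling of the simulating machine. -/
abbrev RegSettles (W : List Γ) : P.toRegMachine.Cfg → Prop → Prop :=
  Settles (P.toRegMachine.Step (TM.readInput W) W.length) P.toRegMachine.Acc (P.RegSafe W)

/-- Auxiliary register `0` copies the position of the head, so a pointer equal to it can learn the
symbol under the head. `leftEnd` is a placeholder for cells not yet scanned; all pointers are below
`n + 1`, so no placeholder survives the scan. -/
theorem settles_scan {s : P.State} {m : ι → Fin (W.length + 1)} {r : Prop}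
    (h : P.RegSettles W (P.scanCfg (some (some (.inr (s, fun i => TM.readInput W (m i)))))
      (W.length + 1) (encode m (W.length + 1))) r) :
    ∀ j i, i + j = W.length + 1 → P.RegSettles W (P.scanCfg
      (some (some (.inr (s, fun k => if m k < i then TM.readInput W (m k) else .leftEnd)))) i
      (encode m i)) r := by
  intro j
  induction j with
  | zero =>
    rintro i rfl
    convert h using 8 with k
    rw [if_pos (m k).isLt]
  | succ j ih =>
    intro i hi
    refine Settles.of_unique_step _ (P.regSafe_scanCfg _ _ _ _ (by omega)) ?_
      (ih (i + 1) (by omega))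
    intro c'
    rw [toRegMachine_step_iff]
    have hne : TM.readInput W i ≠ .rightEnd := by
      rw [Ne, readInput_eq_rightEnd_iff]
      omega
    have ht : ∀ (a : InSym Γ) f E, a ≠ .rightEnd → P.scanTrans (some (some (.inr (s, f)))) a E =
        {(some (some (.inr (s, fun i => if E (.inl (i, false)) (.inr 0) then a else f i))), .right,
          incAux 0)} := by
      rintro (_ | _ | _) f E ha <;> first | rfl | exact (ha rfl).elim
    rw [ht _ _ _ hne]
    simp only [Set.mem_singleton_iff, exists_eq_left, Move.apply, eval_incAux_zero]
    rw [min_eq_left (by omega)]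
    have hf : (fun k => if RegMachine.eqView (encode m i) (.inl (k, false)) (.inr 0) = true
        then TM.readInput W i else if (m k : ℕ) < i then TM.readInput W (m k) else .leftEnd) =
        fun k => if (m k : ℕ) < i + 1 then TM.readInput W (m k) else .leftEnd := by
      funext k
      have hE : RegMachine.eqView (encode m i) (.inl (k, false)) (.inr 0) = true ↔
          (m k : ℕ) = i := by simp [RegMachine.eqView, encode]
      rw [if_congr hE rfl rfl]
      by_cases hk : (m k : ℕ) = i
      · simp [hk]
      · rw [if_neg hk]
        exact if_congr (by omega) rfl rfl
    rw [hf]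

theorem settles_rewind {s : P.State} {m : ι → Fin (W.length + 1)} {r : Prop}
    (h : P.RegSettles W (P.scanCfg (some (some (.inr (s, fun i => TM.readInput W (m i)))))
      (W.length + 1) (encode m (W.length + 1))) r) (p' : ℕ) (hp' : p' ≤ W.length + 1) :
    ∀ p ≤ W.length + 1, P.RegSettles W (P.scanCfg (some (some (.inl s))) p (encode m p')) r := by
  intro p
  induction p with
  | zero =>
    intro _
    refine Settles.of_unique_step _ (P.regSafe_scanCfg _ _ _ _ hp') ?_
      (P.settles_scan h _ 0 (zero_add _))
    intro c'
    rw [toRegMachine_step_iff]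
    simp [TM.readInput, scanTrans, Move.apply, eval_resetPos]
  | succ p ih =>
    intro hp
    refine Settles.of_unique_step _ (P.regSafe_scanCfg _ _ _ _ hp') ?_ (ih (by omega))
    intro c'
    rw [toRegMachine_step_iff]
    have hne : TM.readInput W (p + 1) ≠ .leftEnd := by
      rw [Ne, readInput_eq_leftEnd_iff]
      omega
    have ht : ∀ (a : InSym Γ) E, a ≠ .leftEnd → P.scanTrans (some (some (.inl s))) a E =
        {(some (some (.inl s)), .left, keep)} := by
      rintro (_ | _ | _) E ha <;> first | rfl | exact (ha rfl).elim
    rw [ht _ _ hne]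
    simp only [Set.mem_singleton_iff, exists_eq_left, Move.apply, eval_keep, Nat.add_sub_cancel]
    rw [min_eq_left (by omega)]

/-- Simulated steps are taken on the right end marker, where all symbols are known. Rewinding and
scanning lead back there after each of them. -/
theorem settles_toRegMachine {c : P.State × (ι → Fin (W.length + 1))} {r : Prop}
    (h : Settles (P.Step (ptrView W)) P.Acc (fun _ => True) c r) :
    P.RegSettles W (P.scanCfg (some (some (.inr (c.1, fun i => TM.readInput W (c.2 i)))))
      (W.length + 1) (encode c.2 (W.length + 1))) r := by
  induction h with
  | mk c r rs _ hstep hr ih =>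
    obtain ⟨s, m⟩ := c
    refine Settles.of_image (P.trans s (ptrView W m))
      (fun o => P.scanCfg (some (some (.inl o.1))) (W.length + 1)
        (encode (fun i => (o.2 i).cyc m) (W.length + 1)))
      (fun o => rs (o.1, fun i => (o.2 i).cyc m)) (P.regSafe_scanCfg _ _ _ _ le_rfl) ?_ ?_ ?_
    · intro e
      rw [toRegMachine_step_iff]
      have hr : TM.readInput W (W.length + 1) = .rightEnd := by
        rw [readInput_eq_rightEnd_iff]
        omega
      rw [hr]
      simp only [scanTrans, liftView_encode, Set.mem_image]
      constructor
      · rintro ⟨_, ⟨o, ho, rfl⟩, rfl⟩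
        refine ⟨o, ho, ?_⟩
        simp only [eval_liftAssign, Move.apply, min_self]
      · rintro ⟨o, ho, rfl⟩
        refine ⟨_, ⟨o, ho, rfl⟩, ?_⟩
        simp only [eval_liftAssign, Move.apply, min_self]
    · intro o ho
      exact P.settles_rewind (ih _ ⟨o, ho, rfl⟩) _ le_rfl _ le_rfl
    · rw [hr]
      refine or_congr (and_congr ?_ ?_) ?_
      · exact ⟨fun h o ho => h _ ⟨o, ho, rfl⟩, fun h _ ⟨o, ho, _⟩ => h o ho⟩
      · constructor
        · exact fun h => ⟨_, _, rfl, h⟩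
        · rintro ⟨s', f, hE, hs⟩
          simp only [scanCfg, Option.some.injEq, Sum.inr.injEq, Prod.mk.injEq] at hE
          rw [Acc]
          rw [← hE.1] at hs
          exact hs
      · constructor
        · rintro ⟨_, ⟨o, ho, rfl⟩, h⟩
          exact ⟨o, ho, h⟩
        · rintro ⟨o, ho, h⟩
          exact ⟨_, ⟨o, ho, rfl⟩, h⟩

/-- The registers while the input is measured. -/
def measure (t : ℕ) : ScanReg ι → ℕ
  | .inl (_, b) => b.toNat
  | .inr i => if i = 0 then 0 else if i = 1 then t else 1

/-- Auxiliary register `1` moves in step with the head, so it holds `n + 1` when the right end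
marker is met. -/
theorem settles_measure {r : Prop}
    (h : P.RegSettles W (P.scanCfg (some (some (.inl P.start))) (W.length + 1)
      (encode (W := W) (fun _ => 0) 0)) r) :
    ∀ j i, i + j = W.length → P.RegSettles W (P.scanCfg (some none) (i + 1) (measure (i + 1))) r := by
  have hsafe : ∀ i ≤ W.length, P.RegSafe W (P.scanCfg (some none) (i + 1) (measure (i + 1))) := by
    rintro i hi (⟨k, b⟩ | t)
    · have := b.toNat_le
      simp only [scanCfg, measure]
      omega
    · simp only [scanCfg, measure]
      split_ifs <;> omega
  intro j
  induction j with
  | zero =>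
    rintro i rfl
    refine Settles.of_unique_step _ (hsafe _ le_rfl) ?_ h
    intro c'
    rw [toRegMachine_step_iff]
    have hr : TM.readInput W (W.length + 1) = .rightEnd := by
      rw [readInput_eq_rightEnd_iff]
      omega
    rw [hr]
    simp only [scanTrans, Set.mem_singleton_iff, exists_eq_left, Move.apply, eval_keep, min_self]
    have : measure (W.length + 1) = encode (ι := ι) (W := W) (fun _ => 0) 0 := by
      funext k
      rcases k with ⟨k, b⟩ | t <;> simp [measure, encode]
    rw [this]
  | succ j ih =>
    intro i hi
    refine Settles.of_unique_step _ (hsafe _ (by omega)) ?_ (ih (i + 1) (by omega))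
    intro c'
    rw [toRegMachine_step_iff]
    have hne : TM.readInput W (i + 1) ≠ .rightEnd := by
      rw [Ne, readInput_eq_rightEnd_iff]
      omega
    have ht : ∀ (a : InSym Γ) E, a ≠ .rightEnd → P.scanTrans (some none) a E =
        {(some none, .right, incAux 1)} := by
      rintro (_ | _ | _) E ha <;> first | rfl | exact (ha rfl).elim
    rw [ht _ _ hne]
    simp only [Set.mem_singleton_iff, exists_eq_left, Move.apply]
    rw [min_eq_left (by omega)]
    have : (fun k => (incAux 1 k).eval (measure (i + 1))) = measure (ι := ι) (i + 1 + 1) := by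
      funext k
      rcases k with k | t
      · simp [incAux, Rhs.eval, measure]
      · fin_cases t <;> simp [incAux, Rhs.eval, measure]
    rw [this]

theorem settles_toRegMachine_init {r : Prop}
    (h : Settles (P.Step (ptrView W)) P.Acc (fun _ => True) (P.start, fun _ => 0) r) :
    P.RegSettles W ⟨P.toRegMachine.start, 0, fun _ => 0⟩ r := by
  change P.RegSettles W (P.scanCfg none 0 fun _ => 0) r
  refine Settles.of_unique_step _ (fun _ => Nat.zero_le _) ?_
    (P.settles_measure (P.settles_rewind (P.settles_toRegMachine h) _ (Nat.zero_le _) _ le_rfl)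
      W.length 0 (zero_add _))
  intro c'
  rw [toRegMachine_step_iff]
  simp only [scanTrans, Set.mem_singleton_iff, exists_eq_left, Move.apply]
  rw [min_eq_left (by omega)]
  have : (fun k => (firstAssign k).eval fun _ => 0) = measure (ι := ι) (0 + 1) := by
    funext k
    rcases k with ⟨k, b⟩ | t
    · simp [firstAssign, Rhs.eval, measure]
    · fin_cases t <;> simp [firstAssign, Rhs.eval, measure]
  rw [this]

end ViewMachine

/-- The input symbols for a recoding of the letters. -/
def InSym.map {A B : Type*} (f : A → B) : InSym A → InSym B
  | .leftEnd => .leftEnd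
  | .letter a => .letter (f a)
  | .rightEnd => .rightEnd

theorem map_readInput {A B : Type*} (f : A → B) (W : List A) (i : ℕ) :
    (TM.readInput W i).map f = TM.readInput (W.map f) i := by
  rcases i with _ | i
  · rfl
  · simp only [TM.readInput, List.getElem?_map]
    rcases W[i]? with _ | a <;> rfl

namespace ViewMachine

variable {Γ ι : Type} (P : ViewMachine ι (PtrView (InSym Γ) ι)) [Finite ι] [Finite Γ]

/-- Scanned symbols are kept in the control, which has to be finite and to live in `Type`; hence the
letters are first recoded in `Γ`. -/
theorem exists_logspace {A : Type*} (code : A → Γ) (K : _root_.Language A)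
    (h : ∀ W : List A, Settles (P.Step (ptrView (W.map code))) P.Acc (fun _ => True)
      (P.start, fun _ => 0) (W ∈ K)) :
    K ∈ NLogspace A ∧ (P.Det → K ∈ Logspace A) := by
  have key := P.toRegMachine.toTM_decides (InSym.map code) K (fun W => by
    have := P.settles_toRegMachine_init (h W)
    simp only [map_readInput]
    rw [← List.length_map (as := W) code]
    exact this)
  exact ⟨⟨_, key⟩, fun hd => ⟨_, P.toRegMachine.toTM_isDeterministic _
    (P.toRegMachine_subsingleton hd), key⟩⟩

end ViewMachine

end UnifLog

/-! ### Vertices as tuples of pointers -/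

namespace UnifLog

section Odometer

/-- Mixed radix numbering: `(t, x)` has the number `e t + (M + 1) * x`, so `x` changes exactly when
`t` wraps around. -/
theorem exists_prod_enum {T : Type*} {M : ℕ} (e : T ≃ Fin (M + 1)) (next : T → T)
    (hnext : ∀ t, e (next t) = e t + 1) (b : ℕ) :
    ∃ (M' : ℕ) (e' : T × Fin (b + 1) ≃ Fin (M' + 1)),
      (∀ t, e t = 0 → e' (t, 0) = 0) ∧
      (∀ t x, e' (next t, if e t = Fin.last M then x + 1 else x) = e' (t, x) + 1) ∧
      ∀ t x, e' (t, x) = Fin.last M' ↔ e t = Fin.last M ∧ x = Fin.last b := by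
  have hM : (b + 1) * (M + 1) = ((b + 1) * M + b) + 1 := by ring
  let e' : T × Fin (b + 1) ≃ Fin (((b + 1) * M + b) + 1) :=
    (((e.prodCongr (Equiv.refl _)).trans (Equiv.prodComm _ _)).trans finProdFinEquiv).trans
      (finCongr hM)
  have hval : ∀ t x, (e' (t, x) : ℕ) = e t + (M + 1) * x := by
    intro t x
    simp [e']
  have hlast : ∀ t x, e' (t, x) = Fin.last _ ↔ e t = Fin.last M ∧ x = Fin.last b := by
    intro t x
    rw [Fin.ext_iff, hval, Fin.val_last, Fin.ext_iff, Fin.ext_iff, Fin.val_last, Fin.val_last]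
    have h1 := Fin.is_le (e t)
    have h2 := Fin.is_le x
    constructor
    · intro h
      by_contra hcon
      have : (e t : ℕ) + (M + 1) * x < M + (M + 1) * b := by
        rcases Nat.lt_or_ge x b with h3 | h3
        · have : (M + 1) * (x + 1 : ℕ) ≤ (M + 1) * b := Nat.mul_le_mul_left _ h3
          rw [Nat.mul_add] at this
          omega
        · have h4 : (x : ℕ) = b := by omega
          rw [h4]
          omega
      have h5 : (b + 1) * M + b = M + (M + 1) * b := by ring
      omega
    · rintro ⟨h3, h4⟩
      rw [h3, h4]
      ring
  refine ⟨_, e', ?_, ?_, hlast⟩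
  · intro t ht
    rw [Fin.ext_iff, hval, ht]
    simp
  · intro t x
    rw [Fin.ext_iff, hval, hnext, Fin.val_add_one, Fin.val_add_one]
    simp only [hlast, hval]
    by_cases h1 : e t = Fin.last M
    · by_cases h2 : x = Fin.last b
      · simp [h1, h2]
      · simp only [h1, h2, if_true, and_false, if_false, Fin.val_add_one, Fin.val_last]
        ring
    · simp only [h1, if_false, false_and]
      ring

open Classical in
/-- Add one to a number with the digits `d`, the least significant one being `d 0`. -/
noncomputable def digitsNext {n N : ℕ} (d : Fin N → Fin (n + 1)) (p : Fin N) : Fin (n + 1) :=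
  if ∀ q < p, d q = Fin.last n then d p + 1 else d p

/-- The induction adds the most significant digit, which leaves the carries among the other digits
unchanged. -/
theorem exists_digits_enum (n N : ℕ) :
    ∃ (M : ℕ) (e : (Fin N → Fin (n + 1)) ≃ Fin (M + 1)), e (fun _ => 0) = 0 ∧
      (∀ d, e (digitsNext d) = e d + 1) ∧
      ∀ d, e d = Fin.last M ↔ ∀ p, d p = Fin.last n := by
  induction N with
  | zero =>
    let _ : Unique (Fin (0 + 1)) := inferInstanceAs (Unique (Fin 1))
    refine ⟨0, Equiv.ofUnique _ _, Subsingleton.elim _ _, fun _ => Subsingleton.elim _ _,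
      fun d => ⟨fun _ p => p.elim0, fun _ => Subsingleton.elim _ _⟩⟩
  | succ N ih =>
    obtain ⟨M, e, h0, h1, h2⟩ := ih
    obtain ⟨M', e', h0', h1', h2'⟩ := exists_prod_enum e digitsNext h1 n
    let g : (Fin (N + 1) → Fin (n + 1)) ≃ (Fin N → Fin (n + 1)) × Fin (n + 1) :=
      { toFun := fun d => (fun p => d p.castSucc, d (Fin.last N))
        invFun := fun x => Fin.snoc (α := fun _ => Fin (n + 1)) x.1 x.2
        left_inv := fun d => Fin.snoc_init_self (α := fun _ => Fin (n + 1)) d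
        right_inv := fun x => by simp }
    have hg : ∀ d, g d = (fun p => d p.castSucc, d (Fin.last N)) := fun _ => rfl
    refine ⟨M', g.trans e', ?_, ?_, ?_⟩
    · rw [Equiv.trans_apply, hg]
      exact h0' _ h0
    · intro d
      rw [Equiv.trans_apply, Equiv.trans_apply, hg d, ← h1', hg]
      congr 2
      · funext p
        simp only [digitsNext]
        refine if_congr ?_ rfl rfl
        constructor
        · exact fun h q hq => h q.castSucc hq
        · intro h q hq
          have hqN : (q : ℕ) < N := lt_of_lt_of_le (Fin.lt_def.1 hq) (Nat.le_of_lt p.isLt)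
          exact h ⟨q, hqN⟩ hq
      · simp only [digitsNext, h2]
        refine if_congr ?_ rfl rfl
        constructor
        · exact fun h q => h q.castSucc (Fin.castSucc_lt_last q)
        · exact fun h q hq => h ⟨q, Fin.lt_def.1 hq⟩
    · intro d
      rw [Equiv.trans_apply, hg, h2', h2]
      constructor
      · rintro ⟨h3, h4⟩ p
        exact Fin.lastCases h4 h3 p
      · exact fun h => ⟨fun p => h _, h _⟩

open Classical in
/-- The successor of a pair of a number with digits `d` and a more significant digit `x`. -/
noncomputable def vertexNext {n N f : ℕ} (v : (Fin N → Fin (n + 1)) × Fin (f + 1)) :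
    (Fin N → Fin (n + 1)) × Fin (f + 1) :=
  (digitsNext v.1, if ∀ p, v.1 p = Fin.last n then v.2 + 1 else v.2)

theorem exists_vertex_enum (n N f : ℕ) :
    ∃ (M : ℕ) (e : (Fin N → Fin (n + 1)) × Fin (f + 1) ≃ Fin (M + 1)), e (fun _ => 0, 0) = 0 ∧
      (∀ v, e (vertexNext v) = e v + 1) ∧
      ∀ v, e v = Fin.last M ↔ (∀ p, v.1 p = Fin.last n) ∧ v.2 = Fin.last f := by
  obtain ⟨M, e, h0, h1, h2⟩ := exists_digits_enum n N
  obtain ⟨M', e', h0', h1', h2'⟩ := exists_prod_enum e digitsNext h1 f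
  refine ⟨M', e', h0' _ h0, fun v => ?_, fun v => ?_⟩
  · rw [← h1' v.1 v.2]
    simp only [h2]
    rfl
  · rw [← h2]
    exact h2' v.1 v.2

end Odometer

/-- What a machine sees of registers that hold vertices of a graph: which ones are equal, joined by
an edge, or equal to the last vertex. -/
structure GraphView (ρ : Type) where
  eq : ρ → ρ → Bool
  edge : ρ → ρ → Bool
  last : ρ → Bool

open Classical in
/-- The view of the vertices `m` of a graph on `0, …, M`. -/
noncomputable def graphView {ρ : Type} {M : ℕ} (E : Fin (M + 1) → Fin (M + 1) → Prop)
    (m : ρ → Fin (M + 1)) : GraphView ρ where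
  eq i j := decide (m i = m j)
  edge i j := decide (E (m i) (m j))
  last i := decide (m i = Fin.last M)

/-- The view of some of the pointers. -/
def PtrView.comap {Γ ι ι' : Type} (g : ι' → ι) (v : PtrView Γ ι) : PtrView Γ ι' where
  sym i := v.sym (g i)
  eq i j := v.eq (g i) (g j)
  adj i j := v.adj (g i) (g j)
  top i := v.top (g i)

/-- The edges of the graph with vertices `(d, x)`, where `d` is a tuple of pointers to the input
`W` and `x` a label, that are determined by the predicate `e` on labels and views. -/
def ViewEdge {Γ : Type} {N f : ℕ}
    (e : Fin (f + 1) → Fin (f + 1) → PtrView (InSym Γ) (Bool × Fin N) → Prop) (W : List Γ)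
    (u v : (Fin N → Fin (W.length + 1)) × Fin (f + 1)) : Prop :=
  e u.2 v.2 (ptrView W fun i => if i.1 then v.1 i.2 else u.1 i.2)

namespace ViewMachine

variable {ρ Γ : Type} (P : ViewMachine ρ (GraphView ρ)) {N f : ℕ}
  (e : Fin (f + 1) → Fin (f + 1) → PtrView (InSym Γ) (Bool × Fin N) → Prop)

open Classical in
/-- The view of the vertices from the labels and the view of the pointers. -/
noncomputable def tupleView (x : ρ → Fin (f + 1)) (v : PtrView (InSym Γ) (ρ × Fin N)) :
    GraphView ρ where
  eq a b := decide ((∀ p, v.eq (a, p) (b, p)) ∧ x a = x b)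
  edge a b := decide (e (x a) (x b) (v.comap fun i => (if i.1 then b else a, i.2)))
  last a := decide ((∀ p, v.top (a, p)) ∧ x a = Fin.last f)

open Classical in
/-- The assignments of pointers that perform an assignment of vertices. -/
noncomputable def tupleAssign (v : PtrView (InSym Γ) (ρ × Fin N)) (a : ρ → Rhs ρ)
    (i : ρ × Fin N) : Rhs (ρ × Fin N) :=
  match a i.1 with
  | none => none
  | some (b, false) => some ((b, i.2), false)
  | some (b, true) => some ((b, i.2), decide (∀ q < i.2, v.top (b, q)))

open Classical in
/-- The new labels after an assignment of vertices. -/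
noncomputable def labelAssign (x : ρ → Fin (f + 1)) (v : PtrView (InSym Γ) (ρ × Fin N))
    (a : ρ → Rhs ρ) (i : ρ) : Fin (f + 1) :=
  match a i with
  | none => 0
  | some (b, false) => x b
  | some (b, true) => if ∀ p, v.top (b, p) then x b + 1 else x b

/-- The simulation of a machine with vertex registers by one with pointers into the input. -/
noncomputable def toPtrMachine [Finite ρ] :
    ViewMachine (ρ × Fin N) (PtrView (InSym Γ) (ρ × Fin N)) where
  State := P.State × (ρ → Fin (f + 1))
  finite_state := by
    have := P.finite_state
    infer_instance
  start := (P.start, fun _ => 0)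
  accept := {s | s.1 ∈ P.accept}
  trans s v := (fun o => ((o.1, labelAssign s.2 v o.2), tupleAssign v o.2)) ''
    P.trans s.1 (tupleView e s.2 v)

variable [Finite ρ]

theorem toPtrMachine_det (h : P.Det) : (P.toPtrMachine e).Det :=
  fun _ _ => (h _ _).image _

/-- The numbering `E` belongs to the analysis only. Decoding vertex numbers into tuples and labels
is a functional bisimulation, because zero, the successor and the last vertex are all described
digit by digit, with every carry condition visible in the view of the pointers. -/
theorem settles_toPtrMachine {W : List Γ} {M : ℕ}
    (E : (Fin N → Fin (W.length + 1)) × Fin (f + 1) ≃ Fin (M + 1)) (h0 : E (fun _ => 0, 0) = 0)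
    (hnext : ∀ v, E (vertexNext v) = E v + 1)
    (hlast : ∀ v, E v = Fin.last M ↔ (∀ p, v.1 p = Fin.last W.length) ∧ v.2 = Fin.last f)
    {r : Prop}
    (h : Settles (P.Step (graphView fun i j => ViewEdge e W (E.symm i) (E.symm j))) P.Acc
      (fun _ => True) (P.start, fun _ => 0) r) :
    Settles ((P.toPtrMachine e).Step (ptrView W)) (P.toPtrMachine e).Acc (fun _ => True)
      ((P.toPtrMachine e).start, fun _ => 0) r := by
  let F : P.State × (ρ → Fin (M + 1)) →
      (P.State × (ρ → Fin (f + 1))) × (ρ × Fin N → Fin (W.length + 1)) := fun c =>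
    ((c.1, fun a => (E.symm (c.2 a)).2), fun i => (E.symm (c.2 i.1)).1 i.2)
  have hzero : E.symm 0 = (fun _ => 0, 0) := by rw [← h0, E.symm_apply_apply]
  have hsucc : ∀ i, E.symm (i + 1) = vertexNext (E.symm i) := by
    intro i
    rw [Equiv.symm_apply_eq, hnext, E.apply_symm_apply]
  have hview : ∀ m : ρ → Fin (M + 1),
      tupleView e (fun a => (E.symm (m a)).2) (ptrView W fun i => (E.symm (m i.1)).1 i.2) =
        graphView (fun i j => ViewEdge e W (E.symm i) (E.symm j)) m := by
    intro m
    simp only [tupleView, graphView, GraphView.mk.injEq]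
    refine ⟨?_, ?_, ?_⟩
    · funext a b
      rw [decide_eq_decide, ← E.symm.injective.eq_iff, Prod.ext_iff, funext_iff]
      simp [ptrView]
    · funext a b
      rw [decide_eq_decide, ViewEdge]
      have : ((ptrView W fun i : ρ × Fin N => (E.symm (m i.1)).1 i.2).comap
          fun i : Bool × Fin N => (if i.1 then b else a, i.2)) =
          ptrView W fun i => if i.1 then (E.symm (m b)).1 i.2 else (E.symm (m a)).1 i.2 := by
        simp only [PtrView.comap]
        unfold ptrView
        have hh : ∀ i : Bool × Fin N, (E.symm (m (if i.1 then b else a))).1 i.2 =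
            if i.1 then (E.symm (m b)).1 i.2 else (E.symm (m a)).1 i.2 := by
          intro i
          split_ifs <;> rfl
        simp only [hh]
      rw [this]
    · funext a
      rw [decide_eq_decide, ← E.apply_symm_apply (m a), hlast]
      simp [ptrView]
  have hnextCfg : ∀ (m : ρ → Fin (M + 1)) (o : P.State × (ρ → Rhs ρ)),
      F (o.1, fun k => (o.2 k).cyc m) =
        ((o.1, labelAssign (fun a => (E.symm (m a)).2)
          (ptrView W fun i => (E.symm (m i.1)).1 i.2) o.2),
          fun k => (tupleAssign (ptrView W fun i => (E.symm (m i.1)).1 i.2) o.2 k).cyc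
            fun i => (E.symm (m i.1)).1 i.2) := by
    intro m o
    simp only [F, Prod.mk.injEq, true_and]
    constructor
    · funext a
      simp only [labelAssign]
      rcases o.2 a with _ | ⟨b, _ | _⟩
      · simp [Rhs.cyc, hzero]
      · simp [Rhs.cyc]
      · simp [Rhs.cyc, hsucc, vertexNext, ptrView]
    · funext ⟨a, p⟩
      simp only [tupleAssign]
      rcases o.2 a with _ | ⟨b, _ | _⟩
      · simp [Rhs.cyc, hzero]
      · simp [Rhs.cyc]
      · simp [Rhs.cyc, hsucc, vertexNext, digitsNext, ptrView]
  have hF0 : F (P.start, fun _ => 0) = ((P.toPtrMachine e).start, fun _ => 0) := by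
    simp only [F, hzero]
    rfl
  rw [← hF0]
  refine Settles.map F ?_ (fun _ => Iff.rfl) (fun _ h => h) h
  rintro ⟨s, m⟩ d
  constructor
  · rintro ⟨_, ⟨o, ho, rfl⟩, rfl⟩
    simp only [F, hview] at ho
    exact ⟨_, ⟨o, ho, rfl⟩, hnextCfg m o⟩
  · rintro ⟨_, ⟨o, ho, rfl⟩, rfl⟩
    refine ⟨_, ⟨o, ?_, rfl⟩, hnextCfg m o⟩
    simp only [F, hview]
    exact ho

end ViewMachine

end UnifLog

/-! ### Walks in finite graphs -/

namespace UnifLog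

section Graphs

variable {V : Type*} (E : V → V → Prop)

/-- There is a walk with `t` edges that starts at `v`. -/
def HasWalk : ℕ → V → Prop
  | 0, _ => True
  | t + 1, v => ∃ u, E v u ∧ HasWalk t u

/-- The lengths of walks are bounded. -/
def BoundedWalks : Prop := ∃ t, ∀ v, ¬ HasWalk E t v

variable {E}

theorem HasWalk.of_succ {t : ℕ} {v : V} (h : HasWalk E (t + 1) v) : HasWalk E t v := by
  induction t generalizing v with
  | zero => trivial
  | succ t ih =>
    obtain ⟨u, hu, h⟩ := h
    exact ⟨u, hu, ih h⟩

theorem HasWalk.mono {s t : ℕ} (hst : s ≤ t) {v : V} (h : HasWalk E t v) : HasWalk E s v := by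
  induction t, hst using Nat.le_induction with
  | base => exact h
  | succ t _ ih => exact ih h.of_succ

variable {M : ℕ} {G : Fin (M + 1) → Fin (M + 1) → Prop}

variable (G) in
open Classical in
/-- The vertices other than the last one at which a walk of length `t` starts. -/
noncomputable def walkSet (t : ℕ) : Finset (Fin (M + 1)) :=
  {v | v ≠ Fin.last M ∧ HasWalk G t v}

theorem mem_walkSet {t : ℕ} {v : Fin (M + 1)} :
    v ∈ walkSet G t ↔ v ≠ Fin.last M ∧ HasWalk G t v := by simp [walkSet]

theorem card_walkSet_zero : (walkSet G 0).card = M := by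
  classical
  have : walkSet G 0 = Finset.univ.erase (Fin.last M) := by
    ext v
    simp [mem_walkSet, HasWalk]
  rw [this, Finset.card_erase_of_mem (Finset.mem_univ _)]
  simp

theorem walkSet_succ_subset (t : ℕ) : walkSet G (t + 1) ⊆ walkSet G t := by
  intro v hv
  rw [mem_walkSet] at hv ⊢
  exact ⟨hv.1, hv.2.of_succ⟩

/-- Leaving out the last vertex keeps the counts at most `M`, the largest value of a register. -/
theorem card_walkSet_le (t : ℕ) : (walkSet G t).card ≤ M := by
  induction t with
  | zero => exact card_walkSet_zero.le
  | succ t ih => exact (Finset.card_le_card (walkSet_succ_subset t)).trans ih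

/-- The last vertex is isolated. -/
def LastIsolated (G : Fin (M + 1) → Fin (M + 1) → Prop) : Prop :=
  ∀ u v, G u v → u ≠ Fin.last M ∧ v ≠ Fin.last M

/-- Isolation of the last vertex rules it out as a start and as a neighbour, so each set of the
sequence determines the next. -/
theorem mem_walkSet_succ (hG : LastIsolated G) {t : ℕ} {v : Fin (M + 1)} :
    v ∈ walkSet G (t + 1) ↔ ∃ u ∈ walkSet G t, G v u := by
  simp only [mem_walkSet, HasWalk]
  constructor
  · rintro ⟨_, u, hvu, h⟩
    exact ⟨u, ⟨(hG _ _ hvu).2, h⟩, hvu⟩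
  · rintro ⟨u, ⟨_, h⟩, hvu⟩
    exact ⟨(hG _ _ hvu).1, u, hvu, h⟩

theorem boundedWalks_of_walkSet_eq_empty (hG : LastIsolated G) {t : ℕ} (h : walkSet G t = ∅) :
    BoundedWalks G := by
  refine ⟨t + 1, fun v hv => ?_⟩
  have h1 : v ∈ walkSet G t := by
    obtain ⟨u, hu, -⟩ := id hv
    exact mem_walkSet.2 ⟨(hG _ _ hu).1, hv.of_succ⟩
  rw [h] at h1
  simp at h1

/-- Nested sets of equal size are equal, and as each set determines the next, the sequence stays
constant and nonempty from `t` on. -/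
theorem not_boundedWalks_of_card_eq (hG : LastIsolated G) {t : ℕ}
    (h : (walkSet G (t + 1)).card = (walkSet G t).card) (h0 : (walkSet G t).card ≠ 0) :
    ¬ BoundedWalks G := by
  have heq : walkSet G (t + 1) = walkSet G t :=
    Finset.eq_of_subset_of_card_le (walkSet_succ_subset t) h.ge
  have hall : ∀ k, walkSet G (t + k) = walkSet G t := by
    intro k
    induction k with
    | zero => rfl
    | succ k ih =>
      rw [← heq]
      ext v
      rw [← add_assoc, mem_walkSet_succ hG, mem_walkSet_succ hG, ih]
  obtain ⟨v, hv⟩ := Finset.card_ne_zero.1 h0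
  rintro ⟨s, hs⟩
  rw [← hall s, mem_walkSet] at hv
  exact hs v (hv.2.mono (by omega))

/-- By the previous lemma the sizes drop strictly, starting from `M`, until they are zero. -/
theorem card_walkSet_add_le (hG : LastIsolated G) (hb : BoundedWalks G) (t : ℕ) :
    (walkSet G t).card = 0 ∨ (walkSet G t).card + t ≤ M := by
  induction t with
  | zero => exact Or.inr card_walkSet_zero.le
  | succ t ih =>
    have hle := Finset.card_le_card (walkSet_succ_subset (G := G) t)
    rcases ih with h | h
    · left
      omega
    · by_cases h0 : (walkSet G t).card = 0
      · left
        omega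
      · have : (walkSet G (t + 1)).card ≠ (walkSet G t).card :=
          fun h' => not_boundedWalks_of_card_eq hG h' h0 hb
        right
        omega

theorem boundedWalks_iff (hG : LastIsolated G) :
    BoundedWalks G ↔ ∀ v, v ≠ Fin.last M → ¬ HasWalk G M v := by
  constructor
  · intro hb v hv hw
    have hmem : v ∈ walkSet G M := mem_walkSet.2 ⟨hv, hw⟩
    have hpos := Finset.card_pos.2 ⟨v, hmem⟩
    rcases card_walkSet_add_le hG hb M with h | h <;> omega
  · intro h
    refine boundedWalks_of_walkSet_eq_empty hG (t := M) ?_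
    rw [Finset.eq_empty_iff_forall_notMem]
    intro v hv
    rw [mem_walkSet] at hv
    exact h v hv.1 hv.2

open Classical in
/-- The number of elements of a set of vertices that are less than `k`. -/
noncomputable def cardBelow (S : Finset (Fin (M + 1))) (k : ℕ) : ℕ :=
  (S.filter fun v : Fin (M + 1) => (v : ℕ) < k).card

theorem cardBelow_zero (S : Finset (Fin (M + 1))) : cardBelow S 0 = 0 := by
  simp [cardBelow]

theorem cardBelow_le (S : Finset (Fin (M + 1))) (k : ℕ) : cardBelow S k ≤ S.card :=
  Finset.card_filter_le _ _

theorem cardBelow_walkSet_last (t : ℕ) : cardBelow (walkSet G t) M = (walkSet G t).card := by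
  rw [cardBelow, Finset.filter_true_of_mem]
  intro v hv
  exact Fin.val_lt_last (mem_walkSet.1 hv).1

theorem cardBelow_succ_of_mem {S : Finset (Fin (M + 1))} {v : Fin (M + 1)} (hv : v ∈ S) :
    cardBelow S (v + 1) = cardBelow S v + 1 := by
  classical
  have : S.filter (fun u : Fin (M + 1) => (u : ℕ) < v + 1) =
      insert v (S.filter fun u : Fin (M + 1) => (u : ℕ) < v) := by
    ext u
    simp only [Finset.mem_filter, Finset.mem_insert, Fin.ext_iff]
    constructor
    · rintro ⟨h1, h2⟩
      by_cases h : (u : ℕ) = v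
      · exact Or.inl h
      · exact Or.inr ⟨h1, by omega⟩
    · rintro (h | ⟨h1, h2⟩)
      · rw [Fin.ext h]
        exact ⟨hv, by omega⟩
      · exact ⟨h1, by omega⟩
  simp only [cardBelow]
  rw [← Finset.card_insert_of_notMem (a := v) (by simp)]
  convert congrArg Finset.card this

theorem cardBelow_succ_of_notMem {S : Finset (Fin (M + 1))} {v : Fin (M + 1)} (hv : v ∉ S) :
    cardBelow S (v + 1) = cardBelow S v := by
  classical
  simp only [cardBelow]
  congr 1
  refine Finset.filter_congr fun u hu => ?_
  have : (u : ℕ) ≠ v := fun h => hv (Fin.ext h ▸ hu)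
  omega

end Graphs

namespace ViewMachine

variable {ι Vw : Type} (P : ViewMachine ι Vw) {N : ℕ} {view : (ι → Fin (N + 1)) → Vw}
  {s : P.State} {m : ι → Fin (N + 1)}

/-- Settling, with no restriction on the configurations. -/
abbrev Ends (view : (ι → Fin (N + 1)) → Vw) (s : P.State) (m : ι → Fin (N + 1)) (r : Prop) :
    Prop := Settles (P.Step view) P.Acc (fun _ => True) (s, m) r

theorem Ends.of_halted {r : Prop} (h : P.trans s (view m) = ∅) (hr : r ↔ s ∈ P.accept) :
    P.Ends view s m r := by
  refine Settles.of_halted trivial ?_ hr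
  rintro e ⟨o, ho, -⟩
  simp [h] at ho

theorem Ends.of_singleton {r : Prop} (s' : P.State) (a : ι → Rhs ι)
    (h : P.trans s (view m) = {(s', a)})
    (h' : P.Ends view s' (fun k => (a k).cyc m) r) : P.Ends view s m r := by
  refine Settles.of_unique_step _ trivial ?_ h'
  intro e
  simp [Step, h]

theorem Ends.of_pair {r₁ r₂ : Prop} (s₁ s₂ : P.State) (a₁ a₂ : ι → Rhs ι)
    (h : P.trans s (view m) = {(s₁, a₁), (s₂, a₂)})
    (h₁ : P.Ends view s₁ (fun k => (a₁ k).cyc m) r₁)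
    (h₂ : P.Ends view s₂ (fun k => (a₂ k).cyc m) r₂) : P.Ends view s m (r₁ ∨ r₂) := by
  classical
  have hne : ¬ ∀ o, o ∉ ({(s₁, a₁), (s₂, a₂)} : Set (P.State × (ι → Rhs ι))) :=
    fun h => h _ (Or.inl rfl)
  -- The two actions may coincide, and then they share one result; it is chosen so that it agrees
  -- with `r₁ ∨ r₂`.
  by_cases hr : r₁
  · refine Settles.of_image {(s₁, a₁), (s₂, a₂)} (fun o => (o.1, fun k => (o.2 k).cyc m))
      (fun o => if o = (s₁, a₁) then r₁ else r₂) trivial ?_ ?_ ?_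
    · intro e
      rw [← h]
      rfl
    · rintro o (rfl | rfl)
      · simpa using h₁
      · by_cases heq : (s₂, a₂) = (s₁, a₁)
        · rw [if_pos heq, heq]
          exact h₁
        · rw [if_neg heq]
          exact h₂
    · simp only [hne, false_and, false_or]
      simp [hr]
  · refine Settles.of_image {(s₁, a₁), (s₂, a₂)} (fun o => (o.1, fun k => (o.2 k).cyc m))
      (fun o => if o = (s₂, a₂) then r₂ else r₁) trivial ?_ ?_ ?_
    · intro e
      rw [← h]
      rfl
    · rintro o (rfl | rfl)
      · by_cases heq : (s₁, a₁) = (s₂, a₂)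
        · rw [if_pos heq, heq]
          exact h₂
        · rw [if_neg heq]
          exact h₁
      · simpa using h₂
    · simp only [hne, false_and, false_or]
      simp only [Set.mem_insert_iff, Set.mem_singleton_iff, exists_eq_or_imp, exists_eq_left,
        if_true, hr]
      split_ifs <;> simp

end ViewMachine

/-! ### Inductive counting -/

section Programs

/-- Registers of the programs on graphs. -/
inductive GReg
  | v | u | w | x | t | r | r' | c | i | z

instance : Finite GReg :=
  Finite.of_surjective (![.v, .u, .w, .x, .t, .r, .r', .c, .i, .z] : Fin 10 → GReg) (by
    rintro (_ | _ | _ | _ | _ | _ | _ | _ | _ | _)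
    exacts [⟨0, rfl⟩, ⟨1, rfl⟩, ⟨2, rfl⟩, ⟨3, rfl⟩, ⟨4, rfl⟩, ⟨5, rfl⟩, ⟨6, rfl⟩, ⟨7, rfl⟩,
      ⟨8, rfl⟩, ⟨9, rfl⟩])

/-- States of the counting program. -/
inductive CountState
  | load | pick | scan (b : Bool) | walk (b : Bool) | guess (b : Bool) | yes | no

instance : Finite CountState :=
  Finite.of_surjective (![.load, .pick, .scan true, .scan false, .walk true, .walk false,
    .guess true, .guess false, .yes, .no] : Fin 10 → CountState) (by
    rintro (_ | _ | (_ | _) | (_ | _) | (_ | _) | _ | _)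
    exacts [⟨0, rfl⟩, ⟨1, rfl⟩, ⟨3, rfl⟩, ⟨2, rfl⟩, ⟨5, rfl⟩, ⟨4, rfl⟩, ⟨7, rfl⟩, ⟨6, rfl⟩,
      ⟨8, rfl⟩, ⟨9, rfl⟩])

namespace GReg

/-- No change. -/
def keep (k : GReg) : Rhs GReg := some (k, false)

/-- `r := r + 1`. -/
def incR : GReg → Rhs GReg
  | .r => some (.r, true)
  | k => some (k, false)

/-- `r := r'; t := t + 1; v := 0; r' := 0`. -/
def nextLength : GReg → Rhs GReg
  | .r => some (.r', false)
  | .t => some (.t, true)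
  | .v => none
  | .r' => none
  | k => some (k, false)

/-- `u := 0; c := 0`. -/
def startScan : GReg → Rhs GReg
  | .u => none
  | .c => none
  | k => some (k, false)

/-- `v := v + 1; r' := r' + b`. -/
def endScan (b : Bool) : GReg → Rhs GReg
  | .v => some (.v, true)
  | .r' => some (.r', b)
  | k => some (k, false)

/-- `u := u + 1`. -/
def incU : GReg → Rhs GReg
  | .u => some (.u, true)
  | k => some (k, false)

/-- `w := u; i := 0`. -/
def walkFromU : GReg → Rhs GReg
  | .w => some (.u, false)
  | .i => none
  | k => some (k, false)

/-- `c := c + 1; u := u + 1`. -/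
def endWalk : GReg → Rhs GReg
  | .c => some (.c, true)
  | .u => some (.u, true)
  | k => some (k, false)

/-- `x := 0`. -/
def resetX : GReg → Rhs GReg
  | .x => none
  | k => some (k, false)

/-- `x := x + 1`. -/
def incX : GReg → Rhs GReg
  | .x => some (.x, true)
  | k => some (k, false)

/-- `w := x; i := i + 1`. -/
def stepToX : GReg → Rhs GReg
  | .w => some (.x, false)
  | .i => some (.i, true)
  | k => some (k, false)

end GReg

/-- Inductive counting. When `pick` is entered with `v = 0`, register `r` holds the number of
vertices at which a walk of length `t` starts, and the loop over `v` computes in `r'` the number for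
length `t + 1`. For each `v` the loop over `u` guesses which `u` are starts of walks of length `t`,
verifies the positive guesses by guessing the walk, counts them in `c`, and remembers whether one of
them is a neighbour of `v`; the count has to be `r` in the end. -/
def countTrans : CountState → GraphView GReg → Set (CountState × (GReg → Rhs GReg))
  | .load, g => if g.last .r then {(.pick, GReg.keep)} else {(.load, GReg.incR)}
  | .pick, g =>
    if g.last .v then
      if g.eq .r' .z then {(.yes, GReg.keep)}
      else if g.eq .r' .r then {(.no, GReg.keep)}
      else {(.pick, GReg.nextLength)}
    else {(.scan false, GReg.startScan)}
  | .scan b, g =>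
    if g.last .u then
      if g.eq .c .r then {(.pick, GReg.endScan b)} else {(.no, GReg.keep)}
    else {(.scan b, GReg.incU), (.walk b, GReg.walkFromU)}
  | .walk b, g =>
    if g.eq .i .t then {(.scan (b || g.edge .v .u), GReg.endWalk)}
    else {(.guess b, GReg.resetX)}
  | .guess b, g =>
    {o | (g.edge .w .x = true ∧ o = (.walk b, GReg.stepToX)) ∨
      (g.last .x = false ∧ o = (.guess b, GReg.incX))}
  | .yes, _ => ∅
  | .no, _ => ∅

/-- The counting program. -/
abbrev countMachine : ViewMachine GReg (GraphView GReg) where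
  State := CountState
  finite_state := inferInstance
  start := .load
  accept := {.yes}
  trans := countTrans

variable {M : ℕ} {G : Fin (M + 1) → Fin (M + 1) → Prop}

/-- The registers not used by the verification of a walk agree. -/
def AgreeOff (m m' : GReg → Fin (M + 1)) : Prop :=
  ∀ k, k ≠ .w → k ≠ .x → k ≠ .i → m' k = m k

theorem AgreeOff.trans {m₁ m₂ m₃ : GReg → Fin (M + 1)} (h : AgreeOff m₁ m₂)
    (h' : AgreeOff m₂ m₃) : AgreeOff m₁ m₃ :=
  fun k h1 h2 h3 => (h' k h1 h2 h3).trans (h k h1 h2 h3)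

theorem val_add_one_of_ne {a : Fin (M + 1)} (h : a ≠ Fin.last M) :
    ((a + 1 : Fin (M + 1)) : ℕ) = a + 1 := by
  rw [Fin.val_add_one, if_neg h]

theorem agreeOff_incX (m : GReg → Fin (M + 1)) : AgreeOff m fun k => (GReg.incX k).cyc m := by
  intro k h1 h2 h3
  cases k <;> first | rfl | contradiction

theorem agreeOff_resetX (m : GReg → Fin (M + 1)) : AgreeOff m fun k => (GReg.resetX k).cyc m := by
  intro k h1 h2 h3
  cases k <;> first | rfl | contradiction

theorem agreeOff_stepToX (m : GReg → Fin (M + 1)) :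
    AgreeOff m fun k => (GReg.stepToX k).cyc m := by
  intro k h1 h2 h3
  cases k <;> first | rfl | contradiction

theorem agreeOff_walkFromU (m : GReg → Fin (M + 1)) :
    AgreeOff m fun k => (GReg.walkFromU k).cyc m := by
  intro k h1 h2 h3
  cases k <;> first | rfl | contradiction

/-- The loop offers every `x` in turn: an edge to it may be taken, or the search goes on. `K` is the
result of what follows the verification of the walk. It does not depend on the guesses, so it splits
off as a conjunct. The assignment `m₀` fixes the registers at the entry of the loop. -/
theorem ends_guess (b : Bool) {k : ℕ} {K : Prop} {m₀ : GReg → Fin (M + 1)}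
    (hwalk : ∀ m, AgreeOff m₀ m → (m .i : ℕ) + k = m .t → G (m₀ .w) (m .w) →
      countMachine.Ends (graphView G) (.walk b) m (HasWalk G k (m .w) ∧ K)) :
    ∀ j m, AgreeOff m₀ m → m .w = m₀ .w → (m .i : ℕ) + (k + 1) = m .t → (m .x : ℕ) + j = M →
      countMachine.Ends (graphView G) (.guess b) m
        ((∃ y, m .x ≤ y ∧ G (m .w) y ∧ HasWalk G k y) ∧ K) := by
  intro j
  induction j with
  | zero =>
    intro m hm hw hi hx
    have hlast : m .x = Fin.last M := Fin.ext hx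
    have hiff : (∃ y, m .x ≤ y ∧ G (m .w) y ∧ HasWalk G k y) ↔
        G (m .w) (m .x) ∧ HasWalk G k (m .x) := by
      constructor
      · rintro ⟨y, hy, h⟩
        have : y = m .x := by
          rw [hlast] at hy ⊢
          exact Fin.last_le_iff.1 hy
        rwa [← this]
      · exact fun h => ⟨_, le_rfl, h⟩
    rw [hiff]
    by_cases hE : G (m .w) (m .x)
    · refine (ViewMachine.Ends.of_singleton countMachine (.walk b) GReg.stepToX ?_
        (hwalk _ (hm.trans (agreeOff_stepToX m)) ?_ ?_)).congr ?_
      · ext o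
        simp [countTrans, graphView, hlast, hlast ▸ hE]
      · have : m .i ≠ Fin.last M := by
          intro h
          have := (m .t).isLt
          rw [h, Fin.val_last] at hi
          omega
        change ((m .i + 1 : Fin (M + 1)) : ℕ) + k = m .t
        rw [val_add_one_of_ne this]
        omega
      · rw [← hw]
        exact hE
      · change HasWalk G k (m .x) ∧ K ↔ _
        simp [hE]
    · refine ViewMachine.Ends.of_halted countMachine ?_ ?_
      · ext o
        simp [countTrans, graphView, hlast, hlast ▸ hE]
      · simp only [hE, false_and, false_iff]
        exact fun h => CountState.noConfusion h
  | succ j ih =>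
    intro m hm hw hi hx
    have hlast : m .x ≠ Fin.last M := by
      intro h
      rw [h, Fin.val_last] at hx
      omega
    have hnext := ih _ (hm.trans (agreeOff_incX m)) hw hi (by
        change ((m .x + 1 : Fin (M + 1)) : ℕ) + j = M
        rw [val_add_one_of_ne hlast]
        omega)
    have hsucc : ∀ y, m .x + 1 ≤ y ↔ m .x ≤ y ∧ m .x ≠ y := by
      intro y
      rw [Fin.le_def, Fin.le_def, val_add_one_of_ne hlast, Ne, Fin.ext_iff]
      omega
    have hsimp : (∃ y, (GReg.incX .x).cyc m ≤ y ∧ G ((GReg.incX .w).cyc m) y ∧ HasWalk G k y) ↔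
        ∃ y, (m .x ≤ y ∧ m .x ≠ y) ∧ G (m .w) y ∧ HasWalk G k y := by
      change (∃ y, m .x + 1 ≤ y ∧ G (m .w) y ∧ HasWalk G k y) ↔ _
      simp only [hsucc]
    rw [hsimp] at hnext
    by_cases hE : G (m .w) (m .x)
    · have hw' := hwalk _ (hm.trans (agreeOff_stepToX m)) (by
          have : m .i ≠ Fin.last M := by
            intro h
            have := (m .t).isLt
            rw [h, Fin.val_last] at hi
            omega
          change ((m .i + 1 : Fin (M + 1)) : ℕ) + k = m .t
          rw [val_add_one_of_ne this]
          omega) (by rw [← hw]; exact hE)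
      refine (ViewMachine.Ends.of_pair countMachine (.walk b) (.guess b) _ _ ?_ hw' hnext).congr ?_
      · ext o
        simp [countTrans, graphView, hE, hlast]
      · change (HasWalk G k (m .x) ∧ K) ∨ _ ↔ _
        constructor
        · rintro (⟨h, hK⟩ | ⟨⟨y, ⟨h1, -⟩, h2⟩, hK⟩)
          · exact ⟨⟨_, le_rfl, hE, h⟩, hK⟩
          · exact ⟨⟨y, h1, h2⟩, hK⟩
        · rintro ⟨⟨y, h1, h2, h3⟩, hK⟩
          by_cases hy : m .x = y
          · rw [← hy] at h3
            exact Or.inl ⟨h3, hK⟩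
          · exact Or.inr ⟨⟨y, ⟨h1, hy⟩, h2, h3⟩, hK⟩
    · refine (ViewMachine.Ends.of_singleton countMachine (.guess b) _ ?_ hnext).congr ?_
      · ext o
        simp [countTrans, graphView, hE, hlast]
      · refine and_congr_left fun _ => exists_congr fun y => ?_
        constructor
        · rintro ⟨⟨h1, -⟩, h2⟩
          exact ⟨h1, h2⟩
        · rintro ⟨h1, h2, h3⟩
          refine ⟨⟨h1, fun h => ?_⟩, h2, h3⟩
          rw [← h] at h2
          exact hE h2

/-- The continuation has to be analysed only when the walk exists, since otherwise no branch reaches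
it. This is what makes positive guesses trustworthy in `ends_scan`. -/
theorem ends_walk (b : Bool) {K : Prop} :
    ∀ k m, (m .i : ℕ) + k = m .t →
      (HasWalk G k (m .w) → ∀ m', AgreeOff m m' → m' .i = m' .t →
        countMachine.Ends (graphView G) (.walk b) m' K) →
      countMachine.Ends (graphView G) (.walk b) m (HasWalk G k (m .w) ∧ K) := by
  intro k
  induction k with
  | zero =>
    intro m hi h
    exact (h trivial m (fun _ _ _ _ => rfl) (Fin.ext hi)).congr (by simp [HasWalk])
  | succ k ih =>
    intro m hi h
    have hne : m .i ≠ m .t := by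
      intro h'
      rw [h'] at hi
      omega
    refine (ViewMachine.Ends.of_singleton countMachine (.guess b) GReg.resetX ?_
      (ends_guess (m₀ := m) (k := k) (K := K) b ?_ M _ (agreeOff_resetX m) rfl hi ?_)).congr ?_
    · simp [countTrans, graphView, hne]
    · intro m' hm' hi' hG
      exact ih m' hi' fun hw m'' hm'' => h ⟨_, hG, hw⟩ m'' (hm'.trans hm'')
    · change ((0 : Fin (M + 1)) : ℕ) + M = M
      simp
    · change (∃ y, (0 : Fin (M + 1)) ≤ y ∧ G (m .w) y ∧ HasWalk G k y) ∧ K ↔ _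
      simp [HasWalk]

/-- Heart of the counting argument. Positive guesses are verified, so `c` never exceeds the true
number of elements below `u`; an element that is skipped leaves `c` behind for good, and the final
comparison with `r`, the size of the whole set, fails. Only the branch with all guesses right
survives, and there the flag `b` correctly tells whether a neighbour of `v` was seen. Hence
correctness of `b` is required only under equality of the counts. -/
theorem ends_scan (hG : LastIsolated G) {t : ℕ} {Q : Prop} {m₀ : GReg → Fin (M + 1)}
    (ht : (m₀ .t : ℕ) = t) (hr : (m₀ .r : ℕ) = (walkSet G t).card)
    (hQ : ∀ m b, m .v = m₀ .v + 1 → m .t = m₀ .t → m .r = m₀ .r → m .z = m₀ .z →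
      (b = true ↔ m₀ .v ∈ walkSet G (t + 1)) → m .r' = (if b then m₀ .r' + 1 else m₀ .r') →
      countMachine.Ends (graphView G) .pick m Q) :
    ∀ j m b, (m .u : ℕ) + j = M → m .v = m₀ .v → m .t = m₀ .t → m .r = m₀ .r → m .z = m₀ .z →
      m .r' = m₀ .r' → (m .c : ℕ) ≤ cardBelow (walkSet G t) (m .u) →
      ((m .c : ℕ) = cardBelow (walkSet G t) (m .u) →
        (b = true ↔ ∃ x ∈ walkSet G t, x < m .u ∧ G (m₀ .v) x)) →
      countMachine.Ends (graphView G) (.scan b) m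
        ((m .c : ℕ) = cardBelow (walkSet G t) (m .u) ∧ Q) := by
  intro j
  induction j with
  | zero =>
    intro m b hu h1 h2 h3 h4 h5 hc hb
    have hlast : m .u = Fin.last M := Fin.ext hu
    have hcard : cardBelow (walkSet G t) (m .u) = m .r := by
      rw [hlast, Fin.val_last, cardBelow_walkSet_last, h3, hr]
    rw [hcard, ← Fin.ext_iff] at hb ⊢
    by_cases hcr : m .c = m .r
    · refine (ViewMachine.Ends.of_singleton countMachine .pick (GReg.endScan b) ?_
        (hQ _ b ?_ h2 h3 h4 ?_ ?_)).congr (by simp [hcr])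
      · simp [countTrans, graphView, hlast, hcr]
      · change m .v + 1 = _
        rw [h1]
      · rw [hb hcr, mem_walkSet_succ hG]
        refine exists_congr fun x => and_congr_right fun hx => ?_
        simp only [hlast, and_iff_right_iff_imp]
        exact fun _ => Fin.lt_last_iff_ne_last.2 (mem_walkSet.1 hx).1
      · change (if b then m .r' + 1 else m .r') = _
        rw [h5]
    · refine ViewMachine.Ends.of_singleton countMachine .no GReg.keep ?_
        (ViewMachine.Ends.of_halted countMachine rfl ?_)
      · simp [countTrans, graphView, hlast, hcr]
      · simp only [hcr, false_and, false_iff]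
        exact fun h => CountState.noConfusion h
  | succ j ih =>
    intro m b hu h1 h2 h3 h4 h5 hc hb
    have hlast : m .u ≠ Fin.last M := by
      intro h
      rw [h, Fin.val_last] at hu
      omega
    have hval := val_add_one_of_ne hlast
    have hlt : ∀ x, x < m .u + 1 ↔ x < m .u ∨ x = m .u := by
      intro x
      rw [Fin.lt_def, Fin.lt_def, hval, Fin.ext_iff]
      omega
    have hflag : (∃ x ∈ walkSet G t, x < m .u + 1 ∧ G (m₀ .v) x) ↔
        (∃ x ∈ walkSet G t, x < m .u ∧ G (m₀ .v) x) ∨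
          (m .u ∈ walkSet G t ∧ G (m₀ .v) (m .u)) := by
      constructor
      · rintro ⟨x, hx, hxu, hg⟩
        rcases (hlt x).1 hxu with h | rfl
        · exact Or.inl ⟨x, hx, h, hg⟩
        · exact Or.inr ⟨hx, hg⟩
      · rintro (⟨x, hx, hxu, hg⟩ | ⟨hx, hg⟩)
        · exact ⟨x, hx, (hlt x).2 (Or.inl hxu), hg⟩
        · exact ⟨_, hx, (hlt _).2 (Or.inr rfl), hg⟩
    have hmem : m .u ∈ walkSet G t ↔ HasWalk G t (m .u) := by
      rw [mem_walkSet, and_iff_right hlast]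
    have hskip : countMachine.Ends (graphView G) (.scan b) (fun k => (GReg.incU k).cyc m)
        ((m .c : ℕ) = cardBelow (walkSet G t) (m .u + 1) ∧ Q) := by
      rw [← hval]
      refine ih _ b ?_ h1 h2 h3 h4 h5 ?_ ?_
      · change ((m .u + 1 : Fin (M + 1)) : ℕ) + j = M
        omega
      · change (m .c : ℕ) ≤ cardBelow _ ((m .u + 1 : Fin (M + 1)) : ℕ)
        rw [hval]
        by_cases hm : m .u ∈ walkSet G t
        · rw [cardBelow_succ_of_mem hm]
          omega
        · rw [cardBelow_succ_of_notMem hm]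
          exact hc
      · change (m .c : ℕ) = cardBelow _ ((m .u + 1 : Fin (M + 1)) : ℕ) →
          (b = true ↔ ∃ x ∈ walkSet G t, x < m .u + 1 ∧ _)
        rw [hval, hflag]
        intro hc'
        by_cases hm : m .u ∈ walkSet G t
        · rw [cardBelow_succ_of_mem hm] at hc'
          omega
        · rw [cardBelow_succ_of_notMem hm] at hc'
          rw [hb hc']
          simp [hm]
    have hwalk : countMachine.Ends (graphView G) (.walk b) (fun k => (GReg.walkFromU k).cyc m)
        (HasWalk G t (m .u) ∧ (m .c : ℕ) + 1 = cardBelow (walkSet G t) (m .u + 1) ∧ Q) := by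
      refine ends_walk b t _ ?_ ?_
      · change ((0 : Fin (M + 1)) : ℕ) + t = m .t
        rw [h2, ht]
        simp
      · intro hw m' hm' hi
        have hm : m .u ∈ walkSet G t := hmem.2 hw
        have ha := (agreeOff_walkFromU m).trans hm'
        have av : m' .v = m .v := ha _ nofun nofun nofun
        have au : m' .u = m .u := ha _ nofun nofun nofun
        have ac : m' .c = m .c := ha _ nofun nofun nofun
        have at' : m' .t = m .t := ha _ nofun nofun nofun
        have ar : m' .r = m .r := ha _ nofun nofun nofun
        have ar' : m' .r' = m .r' := ha _ nofun nofun nofun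
        have az : m' .z = m .z := ha _ nofun nofun nofun
        -- The counter does not wrap: it is at most the number of elements below `u`, and `u` is one
        -- more element among at most `M`.
        have hcne : m .c ≠ Fin.last M := by
          intro h
          have h6 := cardBelow_succ_of_mem hm
          have h7 := cardBelow_le (walkSet G t) (m .u + 1)
          have h8 := card_walkSet_le (G := G) t
          rw [h, Fin.val_last] at hc
          omega
        have hcval := val_add_one_of_ne hcne
        refine ViewMachine.Ends.of_singleton countMachine
          (.scan (b || (graphView G m').edge .v .u)) GReg.endWalk ?_ ?_
        · simp [countTrans, graphView, hi]
        · rw [← hcval, ← hval, ← ac, ← au]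
          refine ih _ _ ?_ (av.trans h1) (at'.trans h2) (ar.trans h3) (az.trans h4)
            (ar'.trans h5) ?_ ?_
          · change ((m' .u + 1 : Fin (M + 1)) : ℕ) + j = M
            rw [au]
            omega
          · change ((m' .c + 1 : Fin (M + 1)) : ℕ) ≤
              cardBelow _ ((m' .u + 1 : Fin (M + 1)) : ℕ)
            rw [au, ac, hval, hcval, cardBelow_succ_of_mem hm]
            omega
          · change ((m' .c + 1 : Fin (M + 1)) : ℕ) =
              cardBelow _ ((m' .u + 1 : Fin (M + 1)) : ℕ) →
              (_ ↔ ∃ x ∈ walkSet G t, x < m' .u + 1 ∧ _)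
            rw [au, ac, hval, hcval, cardBelow_succ_of_mem hm, hflag]
            intro hc'
            rw [Bool.or_eq_true, hb (by omega)]
            simp [graphView, av, au, hm, h1]
    refine (ViewMachine.Ends.of_pair countMachine _ _ _ _ ?_ hskip hwalk).congr ?_
    · simp [countTrans, graphView, hlast]
    · rw [← hmem]
      -- For a member, the skipping branch can no longer catch up; for a nonmember, no guessed walk
      -- succeeds.
      by_cases hm : m .u ∈ walkSet G t
      · rw [cardBelow_succ_of_mem hm]
        constructor
        · rintro (⟨h, -⟩ | ⟨-, h, hq⟩)
          · omega
          · exact ⟨by omega, hq⟩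
        · rintro ⟨h, hq⟩
          exact Or.inr ⟨hm, by omega, hq⟩
      · rw [cardBelow_succ_of_notMem hm]
        simp [hm]

/-- The outer induction is on the count for length `t`, the inner one on the vertices left in the
round. At the end of a round a zero count means bounded walks, a repeated nonzero count means a
constant nonempty sequence, and otherwise the count has dropped. The invariant `n + t ≤ M` keeps the
length register from wrapping. -/
theorem ends_pick (hG : LastIsolated G) :
    ∀ n t, (walkSet G t).card = n → n + t ≤ M → ∀ j m, (m .v : ℕ) + j = M → (m .t : ℕ) = t →
      (m .r : ℕ) = n → m .z = 0 → (m .r' : ℕ) = cardBelow (walkSet G (t + 1)) (m .v) →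
      countMachine.Ends (graphView G) .pick m (BoundedWalks G) := by
  intro n
  induction n using Nat.strong_induction_on with
  | _ n ihn =>
    intro t hn hnt j
    induction j with
    | zero =>
      intro m hv ht hr hz hr'
      have hlast : m .v = Fin.last M := Fin.ext hv
      rw [hlast, Fin.val_last, cardBelow_walkSet_last] at hr'
      have hle := Finset.card_le_card (walkSet_succ_subset (G := G) t)
      by_cases h0 : m .r' = m .z
      · refine ViewMachine.Ends.of_singleton countMachine .yes GReg.keep ?_
          (ViewMachine.Ends.of_halted countMachine rfl ?_)
        · simp [countTrans, graphView, hlast, h0]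
        · rw [h0, hz] at hr'
          simp only [Set.mem_singleton_iff, iff_true]
          exact boundedWalks_of_walkSet_eq_empty hG (Finset.card_eq_zero.1 hr'.symm)
      · by_cases h1 : m .r' = m .r
        · refine ViewMachine.Ends.of_singleton countMachine .no GReg.keep ?_
            (ViewMachine.Ends.of_halted countMachine rfl ?_)
          · simp only [countTrans, graphView, hlast, h0]
            simp [h1]
          · have : ¬ BoundedWalks G := by
              refine not_boundedWalks_of_card_eq hG (t := t) ?_ ?_
              · rw [← hr', h1, hr, hn]
              · intro hc
                apply h0
                rw [hz]
                apply Fin.ext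
                rw [hr', Fin.val_zero]
                omega
            simp only [this, false_iff]
            exact fun h => CountState.noConfusion h
        · have hlt : (walkSet G (t + 1)).card < n := by
            have : (m .r' : ℕ) ≠ m .r := fun h => h1 (Fin.ext h)
            omega
          have hpos : (walkSet G (t + 1)).card ≠ 0 := by
            intro hc
            apply h0
            rw [hz]
            apply Fin.ext
            rw [hr', hc, Fin.val_zero]
          have htl : m .t ≠ Fin.last M := by
            intro h
            rw [h, Fin.val_last] at ht
            omega
          refine ViewMachine.Ends.of_singleton countMachine .pick GReg.nextLength ?_
            (ihn _ hlt (t + 1) rfl (by omega) M _ ?_ ?_ hr' hz ?_)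
          · simp only [countTrans, graphView, hlast, h0, h1]
            simp
          · change ((0 : Fin (M + 1)) : ℕ) + M = M
            simp
          · change ((m .t + 1 : Fin (M + 1)) : ℕ) = t + 1
            rw [val_add_one_of_ne htl, ht]
          · change ((0 : Fin (M + 1)) : ℕ) = cardBelow _ ((0 : Fin (M + 1)) : ℕ)
            simp [cardBelow_zero]
    | succ j ih =>
      intro m hv ht hr hz hr'
      have hlast : m .v ≠ Fin.last M := by
        intro h
        rw [h, Fin.val_last] at hv
        omega
      have hval := val_add_one_of_ne hlast
      refine (ViewMachine.Ends.of_singleton countMachine (.scan false) GReg.startScan ?_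
        (ends_scan hG (t := t) (Q := BoundedWalks G) (m₀ := m) ht (hr.trans hn.symm) ?_ M _ false
          ?_ rfl rfl rfl rfl rfl ?_ ?_)).congr ?_
      · simp [countTrans, graphView, hlast]
      · intro m' b h1 h2 h3 h4 hb h5
        refine ih m' ?_ (by rw [h2, ht]) (by rw [h3, hr]) (by rw [h4, hz]) ?_
        · rw [h1, hval]
          omega
        · rw [h1, hval, h5]
          by_cases hm : m .v ∈ walkSet G (t + 1)
          · rw [if_pos (hb.2 hm), cardBelow_succ_of_mem hm, val_add_one_of_ne, hr']
            intro h
            have h6 := cardBelow_succ_of_mem hm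
            have h7 := cardBelow_le (walkSet G (t + 1)) (m .v + 1)
            have h8 := card_walkSet_le (G := G) (t + 1)
            rw [h, Fin.val_last] at hr'
            omega
          · rw [if_neg (fun h => hm (hb.1 h)), cardBelow_succ_of_notMem hm, hr']
      · change ((0 : Fin (M + 1)) : ℕ) + M = M
        simp
      · change ((0 : Fin (M + 1)) : ℕ) ≤ _
        simp
      · change _ → (_ ↔ ∃ x ∈ walkSet G t, x < (0 : Fin (M + 1)) ∧ _)
        simp
      · change ((0 : Fin (M + 1)) : ℕ) = cardBelow _ ((0 : Fin (M + 1)) : ℕ) ∧ _ ↔ _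
        simp [cardBelow_zero]

/-- Every vertex but the last starts a walk of length `0`, so the initial count is `M`, reached by
counting up to the largest register value. -/
theorem ends_load (hG : LastIsolated G) :
    ∀ j m, (m .r : ℕ) + j = M → m .v = 0 → m .t = 0 → m .z = 0 → m .r' = 0 →
      countMachine.Ends (graphView G) .load m (BoundedWalks G) := by
  intro j
  induction j with
  | zero =>
    intro m hr hv ht hz hr'
    have hlast : m .r = Fin.last M := Fin.ext hr
    refine ViewMachine.Ends.of_singleton countMachine .pick GReg.keep ?_
      (ends_pick hG M 0 card_walkSet_zero (by omega) M _ ?_ ?_ hr hz ?_)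
    · simp [countTrans, graphView, hlast]
    · change (m .v : ℕ) + M = M
      simp [hv]
    · change (m .t : ℕ) = 0
      simp [ht]
    · change (m .r' : ℕ) = cardBelow _ (m .v : ℕ)
      simp [hv, hr', cardBelow_zero]
  | succ j ih =>
    intro m hr hv ht hz hr'
    have hlast : m .r ≠ Fin.last M := by
      intro h
      rw [h, Fin.val_last] at hr
      omega
    refine ViewMachine.Ends.of_singleton countMachine .load GReg.incR ?_
      (ih _ ?_ hv ht hz hr')
    · simp [countTrans, graphView, hlast]
    · change ((m .r + 1 : Fin (M + 1)) : ℕ) + j = M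
      rw [val_add_one_of_ne hlast]
      omega

theorem countMachine_ends (hG : LastIsolated G) :
    countMachine.Ends (graphView G) countMachine.start (fun _ => 0) (BoundedWalks G) :=
  ends_load hG M _ (by simp) rfl rfl rfl rfl

/-! ### Tracing walks deterministically -/

/-- States of the program for graphs with at most one edge out of each vertex. -/
inductive TraceState
  | pick | walk | search | yes | no

instance : Finite TraceState :=
  Finite.of_surjective (![.pick, .walk, .search, .yes, .no] : Fin 5 → TraceState) (by
    rintro (_ | _ | _ | _ | _)
    exacts [⟨0, rfl⟩, ⟨1, rfl⟩, ⟨2, rfl⟩, ⟨3, rfl⟩, ⟨4, rfl⟩])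

namespace GReg

/-- `w := v; i := 0`. -/
def walkFromV : GReg → Rhs GReg
  | .w => some (.v, false)
  | .i => none
  | k => some (k, false)

/-- `v := v + 1`. -/
def incV : GReg → Rhs GReg
  | .v => some (.v, true)
  | k => some (k, false)

end GReg

/-- For each vertex `v`, follow the walk from `v` until it ends or has as many edges as there are
vertices other than the last one. -/
def traceTrans : TraceState → GraphView GReg → Set (TraceState × (GReg → Rhs GReg))
  | .pick, g => if g.last .v then {(.yes, GReg.keep)} else {(.walk, GReg.walkFromV)}
  | .walk, g => if g.last .i then {(.no, GReg.keep)} else {(.search, GReg.resetX)}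
  | .search, g =>
    if g.edge .w .x then {(.walk, GReg.stepToX)}
    else if g.last .x then {(.pick, GReg.incV)} else {(.search, GReg.incX)}
  | .yes, _ => ∅
  | .no, _ => ∅

/-- The program for graphs with at most one edge out of each vertex. -/
abbrev traceMachine : ViewMachine GReg (GraphView GReg) where
  State := TraceState
  finite_state := inferInstance
  start := .pick
  accept := {.yes}
  trans := traceTrans

theorem traceMachine_det : traceMachine.Det := by
  rintro (_ | _ | _ | _ | _) g <;> simp only [traceMachine, traceTrans]
  · split_ifs <;> exact Set.subsingleton_singleton
  · split_ifs <;> exact Set.subsingleton_singleton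
  · split_ifs <;> exact Set.subsingleton_singleton
  · exact Set.subsingleton_empty
  · exact Set.subsingleton_empty

/-- By `hfun` the first neighbour found is the only one, so no alternative has to be explored. If
none is found, the walk from the current start has ended. `Q` is the result for the remaining
starts. -/
theorem ends_trace_search {k : ℕ} {Q : Prop} {m₀ : GReg → Fin (M + 1)}
    (hfun : ∀ a b c, G a b → G a c → b = c)
    (hwalk : ∀ m, m .v = m₀ .v → (m .i : ℕ) + k = M →
      traceMachine.Ends (graphView G) .walk m (¬ HasWalk G k (m .w) ∧ Q))
    (hpick : ∀ m, m .v = m₀ .v + 1 → traceMachine.Ends (graphView G) .pick m Q) :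
    ∀ j m, m .v = m₀ .v → (m .i : ℕ) + (k + 1) = M → (m .x : ℕ) + j = M →
      (∀ y < m .x, ¬ G (m .w) y) →
      traceMachine.Ends (graphView G) .search m (¬ HasWalk G (k + 1) (m .w) ∧ Q) := by
  have hedge : ∀ m : GReg → Fin (M + 1), m .v = m₀ .v → (m .i : ℕ) + (k + 1) = M →
      G (m .w) (m .x) →
      traceMachine.Ends (graphView G) .search m (¬ HasWalk G (k + 1) (m .w) ∧ Q) := by
    intro m hv hi hE
    refine (ViewMachine.Ends.of_singleton traceMachine .walk GReg.stepToX ?_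
      (hwalk _ hv ?_)).congr ?_
    · simp [traceTrans, graphView, hE]
    · have : m .i ≠ Fin.last M := by
        intro h
        rw [h, Fin.val_last] at hi
        omega
      change ((m .i + 1 : Fin (M + 1)) : ℕ) + k = M
      rw [val_add_one_of_ne this]
      omega
    · change ¬ HasWalk G k (m .x) ∧ Q ↔ _
      refine and_congr_left fun _ => not_congr ⟨fun h => ⟨_, hE, h⟩, ?_⟩
      rintro ⟨y, hy, h⟩
      rwa [hfun _ _ _ hE hy]
  intro j
  induction j with
  | zero =>
    intro m hv hi hx hno
    have hlast : m .x = Fin.last M := Fin.ext hx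
    by_cases hE : G (m .w) (m .x)
    · exact hedge m hv hi hE
    · refine (ViewMachine.Ends.of_singleton traceMachine .pick GReg.incV ?_
        (hpick _ ?_)).congr ?_
      · simp only [traceTrans, graphView, hE]
        simp [hlast]
      · change m .v + 1 = _
        rw [hv]
      · refine (and_iff_right ?_).symm
        rintro ⟨y, hy, -⟩
        by_cases h : y = m .x
        · exact hE (h ▸ hy)
        · refine hno y ?_ hy
          rw [hlast] at h ⊢
          exact Fin.lt_last_iff_ne_last.2 h
  | succ j ih =>
    intro m hv hi hx hno
    by_cases hE : G (m .w) (m .x)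
    · exact hedge m hv hi hE
    · have hlast : m .x ≠ Fin.last M := by
        intro h
        rw [h, Fin.val_last] at hx
        omega
      refine ViewMachine.Ends.of_singleton traceMachine .search GReg.incX ?_
        (ih _ hv hi ?_ ?_)
      · simp only [traceTrans, graphView, hE]
        simp [hlast]
      · change ((m .x + 1 : Fin (M + 1)) : ℕ) + j = M
        rw [val_add_one_of_ne hlast]
        omega
      · change ∀ y < m .x + 1, ¬ G (m .w) y
        intro y hy hw
        rw [Fin.lt_def, val_add_one_of_ne hlast] at hy
        by_cases h : y = m .x
        · exact hE (h ▸ hw)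
        · refine hno y ?_ hw
          rw [Fin.lt_def]
          have : (y : ℕ) ≠ m .x := fun h' => h (Fin.ext h')
          omega

/-- The register `i` counts the edges followed; once `i = M`, the walk is long enough for rejection
by `boundedWalks_iff`. -/
theorem ends_trace_walk {Q : Prop} {v : Fin (M + 1)} (hfun : ∀ a b c, G a b → G a c → b = c)
    (hpick : ∀ m, m .v = v + 1 → traceMachine.Ends (graphView G) .pick m Q) :
    ∀ k m, m .v = v → (m .i : ℕ) + k = M →
      traceMachine.Ends (graphView G) .walk m (¬ HasWalk G k (m .w) ∧ Q) := by
  intro k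
  induction k with
  | zero =>
    intro m hv hi
    have hlast : m .i = Fin.last M := Fin.ext hi
    refine ViewMachine.Ends.of_singleton traceMachine .no GReg.keep ?_
      (ViewMachine.Ends.of_halted traceMachine rfl ?_)
    · simp [traceTrans, graphView, hlast]
    · simp only [HasWalk, not_true_eq_false, false_and, false_iff]
      exact fun h => TraceState.noConfusion h
  | succ k ih =>
    intro m hv hi
    have hlast : m .i ≠ Fin.last M := by
      intro h
      rw [h, Fin.val_last] at hi
      omega
    refine ViewMachine.Ends.of_singleton traceMachine .search GReg.resetX ?_
      (ends_trace_search (m₀ := m) hfun (fun m' hv' hi' => ih m' (hv'.trans hv) hi')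
        (fun m' hv' => hpick m' (by rw [hv', hv])) M _ rfl hi ?_ ?_)
    · simp [traceTrans, graphView, hlast]
    · change ((0 : Fin (M + 1)) : ℕ) + M = M
      simp
    · change ∀ y < (0 : Fin (M + 1)), _
      simp

theorem ends_trace_pick (hfun : ∀ a b c, G a b → G a c → b = c) :
    ∀ j m, (m .v : ℕ) + j = M → traceMachine.Ends (graphView G) .pick m
      (∀ y, m .v ≤ y → y ≠ Fin.last M → ¬ HasWalk G M y) := by
  intro j
  induction j with
  | zero =>
    intro m hv
    have hlast : m .v = Fin.last M := Fin.ext hv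
    refine ViewMachine.Ends.of_singleton traceMachine .yes GReg.keep ?_
      (ViewMachine.Ends.of_halted traceMachine rfl ?_)
    · simp [traceTrans, graphView, hlast]
    · simp only [Set.mem_singleton_iff, iff_true, hlast]
      intro y hy hy'
      exact (hy' (Fin.last_le_iff.1 hy)).elim
  | succ j ih =>
    intro m hv
    have hlast : m .v ≠ Fin.last M := by
      intro h
      rw [h, Fin.val_last] at hv
      omega
    have hval := val_add_one_of_ne hlast
    refine (ViewMachine.Ends.of_singleton traceMachine .walk GReg.walkFromV ?_
      (ends_trace_walk (v := m .v)
        (Q := ∀ y, m .v + 1 ≤ y → y ≠ Fin.last M → ¬ HasWalk G M y) hfun ?_ M _ rfl ?_)).congr ?_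
    · simp [traceTrans, graphView, hlast]
    · intro m' hm'
      rw [← hm']
      refine ih m' ?_
      rw [hm', hval]
      omega
    · change ((0 : Fin (M + 1)) : ℕ) + M = M
      simp
    · change ¬ HasWalk G M (m .v) ∧ _ ↔ _
      constructor
      · rintro ⟨h1, h2⟩ y hy hy'
        by_cases h : y = m .v
        · rwa [h]
        · refine h2 y ?_ hy'
          rw [Fin.le_def] at hy ⊢
          have : (y : ℕ) ≠ m .v := fun h' => h (Fin.ext h')
          omega
      · intro h
        refine ⟨h _ le_rfl hlast, fun y hy => h y ?_⟩
        rw [Fin.le_def] at hy ⊢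
        omega

theorem traceMachine_ends (hG : LastIsolated G) (hfun : ∀ a b c, G a b → G a c → b = c) :
    traceMachine.Ends (graphView G) traceMachine.start (fun _ => 0) (BoundedWalks G) := by
  refine (ends_trace_pick hfun M _ ?_).congr ?_
  · simp
  · rw [boundedWalks_iff hG]
    simp

end Programs

end UnifLog

/-! ### Substitution and most general unifiers -/

namespace UnifLog

open FirstOrder

universe u v

section Substitution

variable {L : FirstOrder.Language.{u, v}} {α β γ : Type*}

theorem subst_subst (t : L.Term α) (θ : α → L.Term β) (σ : β → L.Term γ) :
    (t.subst θ).subst σ = t.subst fun x => (θ x).subst σ := by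
  induction t with
  | var x => rfl
  | func f ts ih => simp [Language.Term.subst, ih]

theorem relabel_subst (t : L.Term α) (g : α → β) (σ : β → L.Term γ) :
    (t.relabel g).subst σ = t.subst fun x => σ (g x) := by
  induction t with
  | var x => rfl
  | func f ts ih => simp [Language.Term.subst, Language.Term.relabel, ih]

theorem subst_var (t : L.Term α) : t.subst Language.Term.var = t := by
  induction t with
  | var x => rfl
  | func f ts ih => simp [Language.Term.subst, ih]

theorem subst_congr [DecidableEq α] {t : L.Term α} {θ σ : α → L.Term β}
    (h : ∀ x ∈ t.varFinset, θ x = σ x) : t.subst θ = t.subst σ := by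
  induction t with
  | var x => exact h x (by simp)
  | func f ts ih =>
    simp only [Language.Term.subst]
    congr 1
    funext i
    refine ih i fun x hx => h x ?_
    simp only [Language.Term.varFinset, Finset.mem_biUnion]
    exact ⟨i, Finset.mem_univ i, hx⟩

theorem varFinset_relabel (t : L.Term ℕ) (g : ℕ → ℕ) :
    (t.relabel g).varFinset = t.varFinset.image g := by
  induction t with
  | var x => simp
  | func f ts ih =>
    ext y
    simp only [Language.Term.relabel, Language.Term.varFinset, Finset.mem_biUnion, ih,
      Finset.mem_image]
    constructor
    · rintro ⟨i, hi, x, hx, rfl⟩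
      exact ⟨x, ⟨i, hi, hx⟩, rfl⟩
    · rintro ⟨x, ⟨i, hi, hx⟩, rfl⟩
      exact ⟨i, hi, x, hx, rfl⟩

/-- The number of symbols of a term. -/
def termSize : L.Term α → ℕ
  | .var _ => 1
  | .func _ ts => 1 + ∑ i, termSize (ts i)

theorem termSize_pos (t : L.Term α) : 0 < termSize t := by
  cases t <;> simp [termSize]

/-- The strict inequality provides the occurs check. -/
theorem termSize_le_of_mem [DecidableEq α] {t : L.Term α} {x : α} (h : x ∈ t.varFinset)
    (θ : α → L.Term β) :
    termSize (θ x) ≤ termSize (t.subst θ) ∧ (t ≠ .var x → termSize (θ x) < termSize (t.subst θ)) := by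
  induction t with
  | var y =>
    rw [Language.Term.varFinset, Finset.mem_singleton] at h
    subst h
    exact ⟨le_rfl, fun h => (h rfl).elim⟩
  | func f ts ih =>
    simp only [Language.Term.varFinset, Finset.mem_biUnion] at h
    obtain ⟨i, -, hi⟩ := h
    have h1 := (ih i hi).1
    have h2 : termSize ((ts i).subst θ) ≤ ∑ j, termSize ((ts j).subst θ) :=
      Finset.single_le_sum (f := fun j => termSize ((ts j).subst θ)) (fun _ _ => Nat.zero_le _)
        (Finset.mem_univ i)
    simp only [Language.Term.subst, termSize]
    exact ⟨by omega, fun _ => by omega⟩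

end Substitution

section Unification

variable {L : FirstOrder.Language.{u, v}}

/-- `θ` unifies all pairs in the list. -/
def UnifiesAll (θ : ℕ → L.Term ℕ) (l : List (L.Term ℕ × L.Term ℕ)) : Prop :=
  ∀ e ∈ l, IsUnifier θ e.1 e.2

/-- `θ` is a most general unifier of all pairs in the list. -/
def IsMGUAll (θ : ℕ → L.Term ℕ) (l : List (L.Term ℕ × L.Term ℕ)) : Prop :=
  UnifiesAll θ l ∧ ∀ ψ, UnifiesAll ψ l → ∃ σ : ℕ → L.Term ℕ, ∀ x, ψ x = (θ x).subst σ

theorem unifiesAll_cons {θ : ℕ → L.Term ℕ} {e : L.Term ℕ × L.Term ℕ}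
    {l : List (L.Term ℕ × L.Term ℕ)} :
    UnifiesAll θ (e :: l) ↔ IsUnifier θ e.1 e.2 ∧ UnifiesAll θ l := by
  simp [UnifiesAll]

theorem IsMGUAll.congr {θ : ℕ → L.Term ℕ} {l l' : List (L.Term ℕ × L.Term ℕ)}
    (h : ∀ ψ, UnifiesAll ψ l ↔ UnifiesAll ψ l') (hθ : IsMGUAll θ l) : IsMGUAll θ l' :=
  ⟨(h θ).1 hθ.1, fun ψ hψ => hθ.2 ψ ((h ψ).2 hψ)⟩

/-- The size of the left hand sides after a substitution. -/
def sizeUnder (ψ : ℕ → L.Term ℕ) (l : List (L.Term ℕ × L.Term ℕ)) : ℕ :=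
  (l.map fun e => termSize (e.1.subst ψ)).sum

/-- Replacing `x` by `s` does not change sizes under `ψ`, because `ψ x = s.subst ψ`; every unifier
of the whole list factors in the same way through this replacement. If `x` occurred in some `s`
other than `x`, then `ψ x` would be smaller than itself. -/
theorem exists_isMGUAll_var {ψ : ℕ → L.Term ℕ} {x : ℕ} {s : L.Term ℕ}
    {l : List (L.Term ℕ × L.Term ℕ)}
    (ih : ∀ l' : List (L.Term ℕ × L.Term ℕ), UnifiesAll ψ l' → sizeUnder ψ l' ≤ sizeUnder ψ l →
      ∃ θ, IsMGUAll θ l') (hψ : UnifiesAll ψ ((.var x, s) :: l)) :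
    ∃ θ, IsMGUAll θ ((.var x, s) :: l) := by
  rw [unifiesAll_cons] at hψ
  obtain ⟨hx, hl⟩ := hψ
  by_cases hs : s = .var x
  · obtain ⟨θ, hθ⟩ := ih l hl le_rfl
    refine ⟨θ, hθ.congr fun ψ' => ?_⟩
    rw [unifiesAll_cons, hs]
    simp [IsUnifier]
  · have hxs : x ∉ s.varFinset := by
      intro hmem
      have h1 := (termSize_le_of_mem hmem ψ).2 hs
      have h2 : ψ x = s.subst ψ := hx
      rw [h2] at h1
      exact lt_irrefl _ h1
    let τ : ℕ → L.Term ℕ := Function.update Language.Term.var x s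
    have hτ : ∀ ψ' : ℕ → L.Term ℕ, ψ' x = s.subst ψ' → (fun y => (τ y).subst ψ') = ψ' := by
      intro ψ' h
      funext y
      by_cases hy : y = x
      · subst hy
        simp [τ, h]
      · simp [τ, hy, Language.Term.subst]
    have hτs : s.subst τ = s := by
      rw [subst_congr (σ := Language.Term.var), subst_var]
      intro y hy
      have : y ≠ x := fun h => hxs (h ▸ hy)
      simp [τ, this]
    have hunif : ∀ ψ' : ℕ → L.Term ℕ, UnifiesAll ψ' (l.map fun e => (e.1.subst τ, e.2.subst τ)) ↔
        UnifiesAll (fun y => (τ y).subst ψ') l := by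
      intro ψ'
      simp only [UnifiesAll, IsUnifier, List.forall_mem_map, subst_subst]
    obtain ⟨θ, hθ, hθ'⟩ := ih (l.map fun e => (e.1.subst τ, e.2.subst τ))
      (by rw [hunif, hτ ψ hx]; exact hl)
      (by simp [sizeUnder, subst_subst, hτ ψ hx, Function.comp_def])
    refine ⟨fun y => (τ y).subst θ, ?_, ?_⟩
    · rw [unifiesAll_cons]
      refine ⟨?_, (hunif θ).1 hθ⟩
      change (τ x).subst θ = s.subst _
      rw [← subst_subst, hτs]
      simp [τ]
    · intro ψ' hψ'
      rw [unifiesAll_cons] at hψ'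
      have hx' : ψ' x = s.subst ψ' := hψ'.1
      obtain ⟨σ, hσ⟩ := hθ' ψ' (by rw [hunif, hτ ψ' hx']; exact hψ'.2)
      refine ⟨σ, fun y => ?_⟩
      rw [subst_subst, ← funext hσ]
      exact (congrFun (hτ ψ' hx') y).symm

/-- Unification terminates by the size of the left hand sides under the fixed unifier `ψ`:
decomposition removes a root symbol, and elimination of a variable removes a pair without changing
the size of the rest. -/
theorem exists_isMGUAll (ψ : ℕ → L.Term ℕ) (n : ℕ) :
    ∀ l : List (L.Term ℕ × L.Term ℕ), sizeUnder ψ l ≤ n → UnifiesAll ψ l →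
      ∃ θ, IsMGUAll θ l := by
  induction n using Nat.strong_induction_on with
  | _ n ih =>
    intro l hn hl
    rcases l with _ | ⟨⟨t, s⟩, l⟩
    · exact ⟨Language.Term.var, by simp [UnifiesAll], fun ψ' _ => ⟨ψ', fun _ => rfl⟩⟩
    have hlt : sizeUnder ψ l < n := by
      have := termSize_pos (t.subst ψ)
      simp only [sizeUnder, List.map_cons, List.sum_cons] at hn ⊢
      omega
    have ih' : ∀ l' : List (L.Term ℕ × L.Term ℕ), UnifiesAll ψ l' →
        sizeUnder ψ l' ≤ sizeUnder ψ l → ∃ θ, IsMGUAll θ l' :=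
      fun l' h1 h2 => ih _ hlt l' h2 h1
    rcases t with x | ⟨f, ts⟩
    · exact exists_isMGUAll_var ih' hl
    · rcases s with x | ⟨g, ss⟩
      · have hswap : ∀ ψ' : ℕ → L.Term ℕ, UnifiesAll ψ' ((.var x, .func f ts) :: l) ↔
            UnifiesAll ψ' ((.func f ts, .var x) :: l) := by
          intro ψ'
          rw [unifiesAll_cons, unifiesAll_cons]
          exact and_congr_left fun _ => eq_comm
        obtain ⟨θ, hθ⟩ := exists_isMGUAll_var ih' ((hswap ψ).2 hl)
        exact ⟨θ, hθ.congr hswap⟩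
      · rename_i k k'
        have h0 := (unifiesAll_cons.1 hl).1
        simp only [IsUnifier, Language.Term.subst, Language.Term.func.injEq] at h0
        obtain ⟨rfl, h1, -⟩ := h0
        obtain rfl := eq_of_heq h1
        have hdec : ∀ ψ' : ℕ → L.Term ℕ,
            UnifiesAll ψ' (List.ofFn (fun i => (ts i, ss i)) ++ l) ↔
              UnifiesAll ψ' ((.func f ts, .func f ss) :: l) := by
          intro ψ'
          rw [unifiesAll_cons]
          have : IsUnifier ψ' (.func f ts) (.func f ss) ↔
              ∀ i, (ts i).subst ψ' = (ss i).subst ψ' := by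
            simp [IsUnifier, Language.Term.subst, funext_iff]
          rw [this]
          simp only [UnifiesAll, List.mem_append, List.mem_ofFn, IsUnifier]
          constructor
          · exact fun h => ⟨fun i => h _ (Or.inl ⟨i, rfl⟩), fun e he => h e (Or.inr he)⟩
          · rintro ⟨h1, h2⟩ e (⟨i, rfl⟩ | he)
            · exact h1 i
            · exact h2 e he
        have hsize : sizeUnder ψ (List.ofFn (fun i => (ts i, ss i)) ++ l) < n := by
          have : sizeUnder ψ (List.ofFn (fun i => (ts i, ss i)) ++ l) + 1 =
              sizeUnder ψ ((.func f ts, .func f ss) :: l) := by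
            simp only [sizeUnder, List.map_append, List.sum_append, List.map_cons, List.sum_cons,
              List.map_ofFn, Function.comp_def, List.sum_ofFn, Language.Term.subst, termSize]
            omega
          omega
        obtain ⟨θ, hθ⟩ := ih _ hsize _ le_rfl ((hdec ψ).2 hl)
        exact ⟨θ, hθ.congr hdec⟩

theorem exists_isMGU {t s : L.Term ℕ} {ψ : ℕ → L.Term ℕ} (h : IsUnifier ψ t s) :
    ∃ θ, IsMGU θ t s := by
  obtain ⟨θ, h1, h2⟩ := exists_isMGUAll ψ _ [(t, s)] le_rfl (by simpa [UnifiesAll] using h)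
  exact ⟨θ, by simpa [UnifiesAll] using h1, fun ψ' hψ' => h2 ψ' (by simpa [UnifiesAll] using hψ')⟩

/-- The permutation that exchanges `x` and `N + x` for `x < N`. -/
def blockSwap (N : ℕ) : Equiv.Perm ℕ :=
  Function.Involutive.toPerm
    (fun x => if x < N then N + x else if x < N + N then x - N else x) (by
      intro x
      dsimp only
      split_ifs <;> omega)

theorem exists_perm_disjoint (s t : Finset ℕ) :
    ∃ α : Equiv.Perm ℕ, Disjoint s (t.image α) := by
  let N := (s ∪ t).sup id + 1
  have hN : ∀ x ∈ s ∪ t, x < N := fun x hx => Nat.lt_succ_of_le (Finset.le_sup (f := id) hx)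
  refine ⟨blockSwap N, ?_⟩
  rw [Finset.disjoint_left]
  intro x hx hx'
  obtain ⟨y, hy, rfl⟩ := Finset.mem_image.1 hx'
  have h1 := hN _ (Finset.mem_union_left _ hx)
  have h2 := hN _ (Finset.mem_union_right _ hy)
  have h3 : blockSwap N y = N + y := if_pos h2
  omega

/-- Substitutions on disjoint sets of variables can be merged. -/
theorem exists_isUnifier_of_disjoint {t s : L.Term ℕ} (hd : Disjoint t.varFinset s.varFinset)
    {ψ₁ ψ₂ : ℕ → L.Term ℕ} (h : t.subst ψ₁ = s.subst ψ₂) :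
    ∃ ψ, IsUnifier ψ t s ∧ (∀ x ∈ t.varFinset, ψ x = ψ₁ x) ∧ ∀ x ∈ s.varFinset, ψ x = ψ₂ x := by
  let ψ : ℕ → L.Term ℕ := fun x => if x ∈ t.varFinset then ψ₁ x else ψ₂ x
  have h1 : ∀ x ∈ t.varFinset, ψ x = ψ₁ x := fun x hx => if_pos hx
  have h2 : ∀ x ∈ s.varFinset, ψ x = ψ₂ x := fun x hx =>
    if_neg fun hx' => Finset.disjoint_left.1 hd hx' hx
  refine ⟨ψ, ?_, h1, h2⟩
  rw [IsUnifier, subst_congr h1, subst_congr h2, h]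

theorem matchable_of_subst_eq {t s : L.Term ℕ} {ψ₁ ψ₂ : ℕ → L.Term ℕ}
    (h : t.subst ψ₁ = s.subst ψ₂) : Matchable t s := by
  obtain ⟨β, hβ⟩ := exists_perm_disjoint t.varFinset s.varFinset
  have hd : Disjoint (t.relabel (Equiv.refl ℕ)).varFinset (s.relabel β).varFinset := by
    rw [varFinset_relabel, varFinset_relabel]
    simpa using hβ
  refine ⟨Equiv.refl ℕ, β, hd, ?_⟩
  obtain ⟨ψ, hψ, -⟩ := exists_isUnifier_of_disjoint (ψ₁ := ψ₁) (ψ₂ := fun x => ψ₂ (β.symm x)) hd (by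
    rw [relabel_subst, relabel_subst]
    simpa using h)
  exact ⟨ψ, hψ⟩

end Unification

/-! ### Flows and wirings as relations on terms -/

section FlowRelations

variable {L : FirstOrder.Language.{u, v}}

/-- The relation on terms given by the instances of a representative of a flow. -/
def PreFlow.Rel (a : PreFlow L) (s t : L.Term ℕ) : Prop :=
  ∃ θ : ℕ → L.Term ℕ, s = a.tgt.subst θ ∧ t = a.src.subst θ

/-- The relation on terms given by the instances of a flow. -/
def Flow.Rel (f : Flow L) (s t : L.Term ℕ) : Prop := ∃ a : PreFlow L, a.toFlow = f ∧ a.Rel s t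

theorem PreFlow.Rel.of_relabel {a b : PreFlow L} {α : Equiv.Perm ℕ}
    (h₁ : a.tgt.relabel α = b.tgt) (h₂ : a.src.relabel α = b.src) {s t : L.Term ℕ}
    (h : a.Rel s t) : b.Rel s t := by
  obtain ⟨θ, rfl, rfl⟩ := h
  refine ⟨fun x => θ (α.symm x), ?_, ?_⟩
  · rw [← h₁, relabel_subst]
    simp
  · rw [← h₂, relabel_subst]
    simp

theorem PreFlow.rel_toFlow (a : PreFlow L) (s t : L.Term ℕ) : a.toFlow.Rel s t ↔ a.Rel s t := by
  constructor
  · rintro ⟨b, hb, h⟩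
    obtain ⟨α, h₁, h₂⟩ := Quotient.exact hb
    exact h.of_relabel h₁ h₂
  · exact fun h => ⟨a, rfl, h⟩

theorem Flow.exists_rel (f : Flow L) : ∃ s t, f.Rel s t := by
  obtain ⟨a, rfl⟩ := Quotient.exists_rep f
  exact ⟨_, _, a, rfl, Language.Term.var, rfl, rfl⟩

/-- Substitutions for the two factors with a common middle term `z` involve disjoint variables, so
they merge to a unifier, which factors through the most general one. As both sides of a flow have
the same variables, the merged substitution is also correct on the outer terms. -/
theorem Flow.IsProduct.rel_iff {f g h : Flow L} (hp : Flow.IsProduct f g h) (s t : L.Term ℕ) :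
    h.Rel s t ↔ ∃ z, f.Rel s z ∧ g.Rel z t := by
  obtain ⟨a, b, θ, hθ, rfl, rfl, hd, rfl⟩ := hp
  simp only [PreFlow.rel_toFlow]
  constructor
  · rintro ⟨η, rfl, rfl⟩
    refine ⟨a.src.subst fun x => (θ x).subst η, ⟨fun x => (θ x).subst η, subst_subst _ _ _, rfl⟩,
      fun x => (θ x).subst η, ?_, subst_subst _ _ _⟩
    rw [← subst_subst, ← subst_subst, show a.src.subst θ = b.tgt.subst θ from hθ.1]
  · rintro ⟨z, ⟨ψ₁, rfl, rfl⟩, ψ₂, hz, rfl⟩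
    obtain ⟨ψ, hψ, h1, h2⟩ := exists_isUnifier_of_disjoint hd hz
    obtain ⟨σ, hσ⟩ := hθ.2 ψ hψ
    refine ⟨σ, ?_, ?_⟩
    · simp only [PreFlow.resolve, subst_subst]
      refine subst_congr fun x hx => ?_
      rw [← hσ, h1 x (a.vars_eq ▸ hx)]
    · simp only [PreFlow.resolve, subst_subst]
      refine subst_congr fun x hx => ?_
      rw [← hσ, h2 x (b.vars_eq ▸ hx)]

/-- A common middle term provides a unifier once one flow has been renamed apart. -/
theorem Flow.exists_isProduct {f g : Flow L} {s z t : L.Term ℕ} (hf : f.Rel s z)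
    (hg : g.Rel z t) : ∃ h, Flow.IsProduct f g h := by
  obtain ⟨a, rfl, ψ₁, rfl, rfl⟩ := hf
  obtain ⟨b, rfl, ψ₂, hz, rfl⟩ := hg
  obtain ⟨β, hβ⟩ := exists_perm_disjoint a.src.varFinset b.tgt.varFinset
  let b' : PreFlow L := ⟨b.tgt.relabel β, b.src.relabel β, by
    rw [varFinset_relabel, varFinset_relabel, b.vars_eq]⟩
  have hb' : b'.toFlow = b.toFlow := (Quotient.sound ⟨β, rfl, rfl⟩ : b.toFlow = b'.toFlow).symm
  have hd : Disjoint a.src.varFinset b'.tgt.varFinset := by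
    rw [varFinset_relabel]
    exact hβ
  obtain ⟨ψ, hψ, -⟩ := exists_isUnifier_of_disjoint (ψ₁ := ψ₁) (ψ₂ := fun x => ψ₂ (β.symm x)) hd
    (by
      rw [relabel_subst]
      simpa using hz)
  obtain ⟨θ, hθ⟩ := exists_isMGU hψ
  exact ⟨_, a, b', θ, hθ, rfl, hb', hd, rfl⟩

namespace Wiring

/-- All coefficients are natural numbers. -/
def NatCoeff (F : Wiring L) : Prop := ∀ f, ∃ n : ℕ, F.coeff f = n

/-- The relation on terms given by the instances of the flows that occur in a wiring. -/
def Rel (F : Wiring L) (s t : L.Term ℕ) : Prop := ∃ f, F.coeff f ≠ 0 ∧ f.Rel s t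

theorem coeff_add (F G : Wiring L) (f : Flow L) : (F + G).coeff f = F.coeff f + G.coeff f := rfl

theorem coeff_zero (f : Flow L) : (0 : Wiring L).coeff f = 0 := rfl

theorem coeff_single (f g : Flow L) (c : ℂ) [Decidable (f = g)] :
    (single f c).coeff g = if f = g then c else 0 :=
  Finsupp.single_apply

theorem ext_coeff {F G : Wiring L} (h : ∀ f, F.coeff f = G.coeff f) : F = G := Finsupp.ext h

theorem NatCoeff.zero : NatCoeff (0 : Wiring L) := fun f => ⟨0, by simp [coeff_zero]⟩

theorem NatCoeff.single_one (f : Flow L) : NatCoeff (single f 1) := by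
  classical
  intro g
  rw [coeff_single]
  split_ifs
  · exact ⟨1, by simp⟩
  · exact ⟨0, by simp⟩

theorem IsConcrete.natCoeff {F : Wiring L} (h : F.IsConcrete) : F.NatCoeff := by
  intro f
  by_cases hf : F.coeff f = 0
  · exact ⟨0, by simp [hf]⟩
  · exact ⟨1, by simp [h f hf]⟩

theorem NatCoeff.add {F G : Wiring L} (hF : F.NatCoeff) (hG : G.NatCoeff) :
    (F + G).NatCoeff := by
  intro f
  obtain ⟨m, hm⟩ := hF f
  obtain ⟨n, hn⟩ := hG f
  exact ⟨m + n, by rw [coeff_add, hm, hn, Nat.cast_add]⟩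

/-- Natural coefficients cannot cancel. -/
theorem rel_add {F G : Wiring L} (hF : F.NatCoeff) (hG : G.NatCoeff) (s t : L.Term ℕ) :
    (F + G).Rel s t ↔ F.Rel s t ∨ G.Rel s t := by
  have : ∀ f, (F + G).coeff f ≠ 0 ↔ F.coeff f ≠ 0 ∨ G.coeff f ≠ 0 := by
    intro f
    obtain ⟨m, hm⟩ := hF f
    obtain ⟨n, hn⟩ := hG f
    rw [coeff_add, hm, hn]
    norm_cast
    omega
  simp only [Rel, this, or_and_right, exists_or]

theorem rel_single_one (f : Flow L) (s t : L.Term ℕ) : (single f 1).Rel s t ↔ f.Rel s t := by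
  classical
  simp [Rel, coeff_single]

theorem not_rel_zero (s t : L.Term ℕ) : ¬ (0 : Wiring L).Rel s t := by
  simp [Rel, coeff_zero]

theorem natCoeff_sum {ι : Type*} (S : Finset ι) (F : ι → Wiring L) (h : ∀ i, (F i).NatCoeff) :
    (∑ i ∈ S, F i).NatCoeff := by
  classical
  induction S using Finset.induction_on with
  | empty => exact NatCoeff.zero
  | insert i S hi ih =>
    rw [Finset.sum_insert hi]
    exact (h i).add ih

theorem rel_sum {ι : Type*} (S : Finset ι) (F : ι → Wiring L) (h : ∀ i, (F i).NatCoeff)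
    (s t : L.Term ℕ) : (∑ i ∈ S, F i).Rel s t ↔ ∃ i ∈ S, (F i).Rel s t := by
  classical
  induction S using Finset.induction_on with
  | empty => simp [not_rel_zero]
  | insert i S hi ih =>
    rw [Finset.sum_insert hi, rel_add (h i) (natCoeff_sum S F h), ih]
    simp

theorem flowMul_apply (f g h : Flow L) : flowMul f g h = 0 ∨ flowMul f g h = 1 := by
  classical
  unfold flowMul
  split_ifs with hex
  · rw [Finsupp.single_apply]
    split_ifs <;> simp
  · simp

theorem isProduct_of_flowMul_ne_zero {f g h : Flow L} (hne : flowMul f g h ≠ 0) :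
    Flow.IsProduct f g h := by
  classical
  unfold flowMul at hne
  split_ifs at hne with hex
  · rw [Finsupp.single_apply] at hne
    split_ifs at hne with heq
    · rw [← heq]
      exact hex.choose_spec
    · exact (hne rfl).elim
  · exact (hne rfl).elim

theorem exists_flowMul_ne_zero {f g : Flow L} (hex : ∃ h, Flow.IsProduct f g h) :
    ∃ h, flowMul f g h ≠ 0 := by
  refine ⟨hex.choose, ?_⟩
  unfold flowMul
  rw [dif_pos hex, Finsupp.single_eq_same]
  exact one_ne_zero

theorem coeff_mul (F G : Wiring L) (h : Flow L) : (F * G).coeff h =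
    ∑ f ∈ Finsupp.support F, ∑ g ∈ Finsupp.support G, F.coeff f * G.coeff g * flowMul f g h := by
  change (mul F G) h = _
  simp only [mul, Finsupp.sum, Finsupp.finsetSum_apply, Finsupp.smul_apply, smul_eq_mul]
  rfl

theorem exists_nat_coeff_mul {F G : Wiring L} (hF : F.NatCoeff) (hG : G.NatCoeff) (h : Flow L) :
    ∃ n : ℕ, (F * G).coeff h = n ∧
      (n ≠ 0 ↔ ∃ f g, F.coeff f ≠ 0 ∧ G.coeff g ≠ 0 ∧ flowMul f g h ≠ 0) := by
  choose a ha using hF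
  choose b hb using hG
  have hm : ∀ f g : Flow L, ∃ n : ℕ, flowMul f g h = n := by
    intro f g
    rcases flowMul_apply f g h with h0 | h1
    · exact ⟨0, by simp [h0]⟩
    · exact ⟨1, by simp [h1]⟩
  choose c hc using hm
  refine ⟨∑ f ∈ Finsupp.support F, ∑ g ∈ Finsupp.support G, a f * b g * c f g, ?_, ?_⟩
  · rw [coeff_mul]
    simp only [ha, hb, hc]
    push_cast
    rfl
  · rw [Ne, Finset.sum_eq_zero_iff]
    simp only [Finset.sum_eq_zero_iff, not_forall]
    have hsF : ∀ f, f ∈ Finsupp.support F ↔ F.coeff f ≠ 0 := fun f => Finsupp.mem_support_iff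
    have hsG : ∀ f, f ∈ Finsupp.support G ↔ G.coeff f ≠ 0 := fun f => Finsupp.mem_support_iff
    simp only [hsF, hsG, ha, hb, hc, Nat.cast_ne_zero]
    constructor
    · rintro ⟨f, hf, g, hg, hne⟩
      refine ⟨f, g, hf, hg, fun h0 => hne ?_⟩
      rw [h0, mul_zero]
    · rintro ⟨f, g, hf, hg, hne⟩
      exact ⟨f, hf, g, hg, mul_ne_zero (mul_ne_zero hf hg) hne⟩

theorem NatCoeff.mul {F G : Wiring L} (hF : F.NatCoeff) (hG : G.NatCoeff) : (F * G).NatCoeff :=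
  fun h => (exists_nat_coeff_mul hF hG h).imp fun _ h => h.1

/-- A sum of natural numbers vanishes only if all summands do, and whichever product `flowMul`
selects, its relation is the composite. -/
theorem rel_mul {F G : Wiring L} (hF : F.NatCoeff) (hG : G.NatCoeff) (s t : L.Term ℕ) :
    (F * G).Rel s t ↔ ∃ z, F.Rel s z ∧ G.Rel z t := by
  have hne : ∀ h, (F * G).coeff h ≠ 0 ↔
      ∃ f g, F.coeff f ≠ 0 ∧ G.coeff g ≠ 0 ∧ flowMul f g h ≠ 0 := by
    intro h
    obtain ⟨n, hn, hiff⟩ := exists_nat_coeff_mul hF hG h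
    rw [hn, ← hiff, Nat.cast_ne_zero]
  constructor
  · rintro ⟨h, hh, hst⟩
    obtain ⟨f, g, hf, hg, hfg⟩ := (hne h).1 hh
    obtain ⟨z, h1, h2⟩ := ((isProduct_of_flowMul_ne_zero hfg).rel_iff s t).1 hst
    exact ⟨z, ⟨f, hf, h1⟩, g, hg, h2⟩
  · rintro ⟨z, ⟨f, hf, h1⟩, g, hg, h2⟩
    obtain ⟨h, hh⟩ := exists_flowMul_ne_zero (Flow.exists_isProduct h1 h2)
    exact ⟨h, (hne h).2 ⟨f, g, hf, hg, hh⟩,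
      ((isProduct_of_flowMul_ne_zero hh).rel_iff s t).2 ⟨z, h1, h2⟩⟩

theorem rel_one (s t : L.Term ℕ) : (1 : Wiring L).Rel s t ↔ s = t := by
  change (single _ 1).Rel s t ↔ _
  rw [rel_single_one, PreFlow.rel_toFlow]
  constructor
  · rintro ⟨θ, rfl, rfl⟩
    rfl
  · rintro rfl
    exact ⟨fun _ => s, rfl, rfl⟩

theorem pow_zero' (F : Wiring L) : F ^ 0 = 1 := rfl

theorem pow_succ' (F : Wiring L) (k : ℕ) : F ^ (k + 1) = F ^ k * F := rfl

theorem NatCoeff.pow {F : Wiring L} (hF : F.NatCoeff) (k : ℕ) : (F ^ k).NatCoeff := by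
  induction k with
  | zero => exact NatCoeff.single_one _
  | succ k ih => exact ih.mul hF

/-- Walks run from sources to targets, so the rightmost factor of a power is the first edge. -/
theorem exists_rel_pow_iff {F : Wiring L} (hF : F.NatCoeff) (k : ℕ) (t : L.Term ℕ) :
    (∃ s, (F ^ k).Rel s t) ↔ HasWalk (fun t s => F.Rel s t) k t := by
  induction k generalizing t with
  | zero => simp [pow_zero', rel_one, HasWalk]
  | succ k ih =>
    simp only [pow_succ', rel_mul (hF.pow k) hF, HasWalk, ← ih]
    constructor
    · rintro ⟨s, z, h1, h2⟩
      exact ⟨z, h2, s, h1⟩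
    · rintro ⟨z, h2, s, h1⟩
      exact ⟨s, z, h1, h2⟩

/-- Every flow has an instance, so an empty relation leaves no flow. -/
theorem eq_zero_iff (F : Wiring L) : F = 0 ↔ ∀ s t, ¬ F.Rel s t := by
  constructor
  · rintro rfl
    exact not_rel_zero
  · intro h
    refine ext_coeff fun f => ?_
    by_contra hf
    obtain ⟨s, t, hst⟩ := f.exists_rel
    exact h s t ⟨f, hf, hst⟩

theorem isNilpotent_iff {F : Wiring L} (hF : F.NatCoeff) :
    IsNilpotent F ↔ BoundedWalks fun t s => F.Rel s t := by
  refine exists_congr fun k => ?_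
  rw [eq_zero_iff, forall_comm]
  refine forall_congr' fun t => ?_
  rw [← exists_rel_pow_iff hF, not_exists]

end Wiring

end FlowRelations

end UnifLog

namespace UnifLog

open FirstOrder

universe u v

theorem hasWalk_comap {V V' : Type*} (g : V' ≃ V) (R : V → V → Prop) (k : ℕ) (x : V') :
    HasWalk (fun a b => R (g a) (g b)) k x ↔ HasWalk R k (g x) := by
  induction k generalizing x with
  | zero => rfl
  | succ k ih =>
    simp only [HasWalk, ih]
    exact g.exists_congr_left.trans (by simp)

theorem boundedWalks_comap {V V' : Type*} (g : V' ≃ V) (R : V → V → Prop) :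
    BoundedWalks (fun a b => R (g a) (g b)) ↔ BoundedWalks R := by
  refine exists_congr fun k => ?_
  simp only [hasWalk_comap]
  exact g.forall_congr_left.trans (by simp)

/-! ### Stacks of positions -/

section Stacks

variable {L : FirstOrder.Language.{u, v}}

/-- The first argument of a binary symbol. -/
def fstArg : L.Term ℕ → L.Term ℕ
  | @Language.Term.func _ _ 2 _ ts => ts 0
  | t => t

/-- The second argument of a binary symbol. -/
def sndArg : L.Term ℕ → L.Term ℕ
  | @Language.Term.func _ _ 2 _ ts => ts 1
  | t => t

/-- The term `tₐ` in `t₀ • t₁ • ⋯ • tₐ • s`. -/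
def stackElem (a : ℕ) (t : L.Term ℕ) : L.Term ℕ := fstArg (sndArg^[a] t)

/-- A permutation of the numbers less than `n` extended by the identity. -/
def natPerm {n : ℕ} (σ : Equiv.Perm (Fin n)) (a : ℕ) : ℕ := if h : a < n then σ ⟨a, h⟩ else a

theorem natPerm_lt {n : ℕ} (σ : Equiv.Perm (Fin n)) {a : ℕ} (h : a < n) : natPerm σ a < n := by
  rw [natPerm, dif_pos h]
  exact (σ _).isLt

theorem natPerm_of_le {n : ℕ} (σ : Equiv.Perm (Fin n)) {a : ℕ} (h : n ≤ a) : natPerm σ a = a := by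
  rw [natPerm, dif_neg (by omega)]

theorem natPerm_lt_of_le {n N : ℕ} (σ : Equiv.Perm (Fin n)) (hn : n ≤ N) {a : ℕ} (h : a < N) :
    natPerm σ a < N := by
  by_cases ha : a < n
  · exact (natPerm_lt σ ha).trans_le hn
  · rwa [natPerm_of_le σ (by omega)]

theorem natPerm_injective {n : ℕ} (σ : Equiv.Perm (Fin n)) : Function.Injective (natPerm σ) := by
  intro a b h
  by_cases ha : a < n <;> by_cases hb : b < n
  · rw [natPerm, natPerm, dif_pos ha, dif_pos hb] at h
    simpa using σ.injective (Fin.ext h)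
  · have := natPerm_lt σ ha
    rw [h, natPerm_of_le σ (by omega)] at this
    omega
  · have := natPerm_lt σ hb
    rw [← h, natPerm_of_le σ (by omega)] at this
    omega
  · rwa [natPerm_of_le σ (by omega), natPerm_of_le σ (by omega)] at h

/-- The extension of a permutation of the numbers less than `n` to the numbers up to `K`. -/
def slot {n : ℕ} (σ : Equiv.Perm (Fin n)) {K : ℕ} (a : Fin (K + 1)) : Fin (K + 1) :=
  Fin.ofNat (K + 1) (natPerm σ a)

theorem val_slot {n K : ℕ} (σ : Equiv.Perm (Fin n)) (hn : n ≤ K + 1) (a : Fin (K + 1)) :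
    (slot σ a : ℕ) = natPerm σ a :=
  Nat.mod_eq_of_lt (natPerm_lt_of_le σ hn a.isLt)

theorem slot_surjective {n K : ℕ} (σ : Equiv.Perm (Fin n)) (hn : n ≤ K + 1) :
    Function.Surjective (slot σ : Fin (K + 1) → Fin (K + 1)) := by
  refine Finite.surjective_of_injective fun a b h => Fin.ext (natPerm_injective σ ?_)
  rw [← val_slot σ hn, ← val_slot σ hn, h]

namespace Vocabulary

variable (V : Vocabulary L)

theorem cons_inj {a b a' b' : L.Term ℕ} : V.cons a b = V.cons a' b' ↔ a = a' ∧ b = b' := by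
  constructor
  · intro h
    exact ⟨congrArg fstArg h, congrArg sndArg h⟩
  · rintro ⟨rfl, rfl⟩
    rfl

theorem const_inj {c c' : L.Constants} : (const c : L.Term ℕ) = const c' ↔ c = c' := by
  constructor
  · intro h
    simp only [const, Language.Constants.term, Language.Term.func.injEq, heq_eq_eq] at h
    exact h.2.1
  · rintro rfl
    rfl

theorem subst_cons (a b : L.Term ℕ) (θ : ℕ → L.Term ℕ) :
    (V.cons a b).subst θ = V.cons (a.subst θ) (b.subst θ) := by
  simp only [cons, Language.Functions.apply₂, Language.Term.subst]
  congr 1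
  funext i
  fin_cases i <;> rfl

theorem subst_const (c : L.Constants) (θ : ℕ → L.Term ℕ) :
    (const c : L.Term ℕ).subst θ = const c := by
  simp only [const, Language.Constants.term, Language.Term.subst]
  congr 1
  funext i
  exact i.elim0

theorem subst_head (c d q : L.Constants) (θ : ℕ → L.Term ℕ) :
    (V.head c d q).subst θ = V.head c d q := by
  simp [head, subst_cons, subst_const]

theorem consList_cons (t : L.Term ℕ) (ts : List (L.Term ℕ)) (s : L.Term ℕ) :
    V.consList (t :: ts) s = V.cons t (V.consList ts s) := rfl

theorem consList_append (ts ts' : List (L.Term ℕ)) (s : L.Term ℕ) :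
    V.consList (ts ++ ts') s = V.consList ts (V.consList ts' s) :=
  List.foldr_append

theorem subst_consList (ts : List (L.Term ℕ)) (s : L.Term ℕ) (θ : ℕ → L.Term ℕ) :
    (V.consList ts s).subst θ = V.consList (ts.map fun t => t.subst θ) (s.subst θ) := by
  induction ts with
  | nil => rfl
  | cons t ts ih => rw [consList_cons, subst_cons, ih, List.map_cons, consList_cons]

theorem consList_range_add (m k : ℕ) (g : ℕ → L.Term ℕ) (z : L.Term ℕ) :
    V.consList ((List.range (m + k)).map g) z =
      V.consList ((List.range m).map g) (V.consList ((List.range k).map fun a => g (m + a)) z) := by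
  rw [List.range_add, List.map_append, consList_append, List.map_map]
  rfl

theorem consList_range_succ (k : ℕ) (g : ℕ → L.Term ℕ) (z : L.Term ℕ) :
    V.consList ((List.range (k + 1)).map g) z =
      V.cons (g 0) (V.consList ((List.range k).map fun a => g (a + 1)) z) := by
  rw [List.range_succ_eq_map, List.map_cons, consList_cons, List.map_map]
  rfl

theorem stackElem_cons_zero (x y : L.Term ℕ) : stackElem 0 (V.cons x y) = x := rfl

theorem stackElem_cons_succ (a : ℕ) (x y : L.Term ℕ) :
    stackElem (a + 1) (V.cons x y) = stackElem a y := rfl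

theorem stackElem_consList_range (m a : ℕ) (g : ℕ → L.Term ℕ) (z : L.Term ℕ) :
    stackElem a (V.consList ((List.range m).map g) z) =
      if a < m then g a else stackElem (a - m) z := by
  induction m generalizing a g with
  | zero => simp [consList]
  | succ m ih =>
    rw [consList_range_succ]
    rcases a with _ | a
    · simp [stackElem_cons_zero]
    · rw [stackElem_cons_succ, ih, Nat.add_sub_add_right]
      exact if_congr (by omega) rfl rfl

theorem ofFn_natPerm {n : ℕ} (σ : Equiv.Perm (Fin n)) {X : Type*} (g : ℕ → X) :
    List.ofFn (fun i : Fin n => g (σ i : ℕ)) = (List.range n).map fun a => g (natPerm σ a) := by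
  refine List.ext_getElem (by simp) fun i h1 h2 => ?_
  rw [List.length_ofFn] at h1
  simp [natPerm, h1]

theorem subst_obsFlow_tgt {n : ℕ} (c' d' q' c d q : L.Constants) (σ : Equiv.Perm (Fin n))
    (θ : ℕ → L.Term ℕ) : (V.obsFlow c' d' q' c d q σ).tgt.subst θ =
      V.cons (V.head c' d' q') (V.consList ((List.range n).map θ) (θ n)) := by
  simp only [obsFlow, perm, subst_cons, subst_head, subst_consList]
  congr 2
  refine List.ext_getElem (by simp) fun i h1 h2 => ?_
  simp [Language.Term.subst]

theorem subst_obsFlow_src {n : ℕ} (c' d' q' c d q : L.Constants) (σ : Equiv.Perm (Fin n))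
    (θ : ℕ → L.Term ℕ) : (V.obsFlow c' d' q' c d q σ).src.subst θ =
      V.cons (V.head c d q)
        (V.consList ((List.range n).map fun a => θ (natPerm σ a)) (θ n)) := by
  simp only [obsFlow, perm, subst_cons, subst_head, subst_consList]
  rw [ofFn_natPerm σ fun a => Language.Term.var a, List.map_map]
  rfl

theorem rel_obsFlow {n : ℕ} (c' d' q' c d q : L.Constants) (σ : Equiv.Perm (Fin n))
    (s t : L.Term ℕ) : (V.obsFlow c' d' q' c d q σ).Rel s t ↔
      ∃ (g : ℕ → L.Term ℕ) (z : L.Term ℕ),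
        s = V.cons (V.head c' d' q') (V.consList ((List.range n).map g) z) ∧
        t = V.cons (V.head c d q)
          (V.consList ((List.range n).map fun a => g (natPerm σ a)) z) := by
  simp only [PreFlow.Rel, subst_obsFlow_tgt, subst_obsFlow_src]
  constructor
  · rintro ⟨θ, rfl, rfl⟩
    exact ⟨θ, θ n, rfl, rfl⟩
  · rintro ⟨g, z, rfl, rfl⟩
    -- Variable `n` is the tail of both stacks in the representative.
    refine ⟨fun a => if a < n then g a else z, ?_, ?_⟩
    · simp only [lt_irrefl, if_false]
      congr 2
      refine List.map_congr_left fun a ha => ?_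
      rw [if_pos (List.mem_range.1 ha)]
    · simp only [lt_irrefl, if_false]
      congr 2
      refine List.map_congr_left fun a ha => ?_
      rw [if_pos (natPerm_lt σ (List.mem_range.1 ha))]

/-- From depth `n` on the two stacks share their tail and `natPerm` is the identity, so one formula
covers all depths, whatever `n` is. -/
theorem stackElem_of_rel_obsFlow {n : ℕ} {c' d' q' c d q : L.Constants}
    {σ : Equiv.Perm (Fin n)} {s t : L.Term ℕ} (h : (V.obsFlow c' d' q' c d q σ).Rel s t) :
    ∃ S T, s = V.cons (V.head c' d' q') S ∧ t = V.cons (V.head c d q) T ∧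
      ∀ a, stackElem a T = stackElem (natPerm σ a) S := by
  obtain ⟨g, z, rfl, rfl⟩ := (V.rel_obsFlow _ _ _ _ _ _ _ _ _).1 h
  refine ⟨_, _, rfl, rfl, fun a => ?_⟩
  rw [stackElem_consList_range, stackElem_consList_range]
  by_cases ha : a < n
  · rw [if_pos ha, if_pos (natPerm_lt σ ha)]
  · rw [natPerm_of_le σ (by omega), if_neg ha]

/-- Observations with the same source head have unifiable sources. -/
theorem matchable_obsFlow_src {n₁ n₂ : ℕ} (c₁ d₁ q₁ c₂ d₂ q₂ c d q : L.Constants)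
    (σ₁ : Equiv.Perm (Fin n₁)) (σ₂ : Equiv.Perm (Fin n₂)) :
    Matchable (V.obsFlow c₁ d₁ q₁ c d q σ₁).src (V.obsFlow c₂ d₂ q₂ c d q σ₂).src := by
  -- Padding both stacks to a common depth `B` with equal entries gives a common instance: the
  -- permutations no longer matter.
  have key : ∀ {n : ℕ} (σ : Equiv.Perm (Fin n)) (c' d' q' : L.Constants) (B : ℕ), n ≤ B →
      ∃ θ, (V.obsFlow c' d' q' c d q σ).src.subst θ = V.cons (V.head c d q)
        (V.consList ((List.range B).map fun _ => .var 0) (.var 0)) := by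
    intro n σ c' d' q' B hB
    refine ⟨fun a => if a < n then .var 0 else
      V.consList ((List.range (B - n)).map fun _ => .var 0) (.var 0), ?_⟩
    rw [subst_obsFlow_src, if_neg (lt_irrefl n)]
    obtain ⟨k, rfl⟩ := Nat.exists_eq_add_of_le hB
    rw [consList_range_add, Nat.add_sub_cancel_left]
    congr 2
    refine List.map_congr_left fun a ha => ?_
    rw [if_pos (natPerm_lt σ (List.mem_range.1 ha))]
  obtain ⟨θ₁, h₁⟩ := key σ₁ c₁ d₁ q₁ (max n₁ n₂) (le_max_left _ _)
  obtain ⟨θ₂, h₂⟩ := key σ₂ c₂ d₂ q₂ (max n₁ n₂) (le_max_right _ _)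
  exact matchable_of_subst_eq (h₁.trans h₂.symm)

theorem rel_wordFlow (c' d' p' c d p : L.Constants) (s t : L.Term ℕ) :
    (V.wordFlow c' d' p' c d p).Rel s t ↔ ∃ x y : L.Term ℕ,
      s = V.cons (V.cons (const c') (V.cons (const d') x)) (V.cons (const p') y) ∧
      t = V.cons (V.cons (const c) (V.cons (const d) x)) (V.cons (const p) y) := by
  simp only [PreFlow.Rel, wordFlow, cell, subst_cons, subst_const]
  constructor
  · rintro ⟨θ, rfl, rfl⟩
    exact ⟨θ 0, θ 1, rfl, rfl⟩
  · rintro ⟨x, y, rfl, rfl⟩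
    exact ⟨fun a => if a = 0 then x else y, rfl, rfl⟩

theorem natCoeff_wordRep (W : List V.alphabet) (p : Fin (W.length + 1) → L.Constants) :
    (V.wordRep W p).NatCoeff :=
  Wiring.natCoeff_sum _ _ fun _ =>
    (Wiring.NatCoeff.single_one _).add (Wiring.NatCoeff.single_one _)

/-- The relation of a cyclic word with the letters `ℓ i` at the positions `p i`. -/
def WordRel {n : ℕ} (ℓ p : Fin (n + 1) → L.Constants) (s t : L.Term ℕ) : Prop :=
  ∃ i, (V.wordFlow (ℓ i) V.rgt (p i) (ℓ (i + 1)) V.lft (p (i + 1))).Rel s t ∨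
    (V.wordFlow (ℓ (i + 1)) V.lft (p (i + 1)) (ℓ i) V.rgt (p i)).Rel s t

theorem rel_wordRep (W : List V.alphabet) (p : Fin (W.length + 1) → L.Constants)
    (s t : L.Term ℕ) : (V.wordRep W p).Rel s t ↔ V.WordRel (V.letter W) p s t := by
  rw [wordRep, Wiring.rel_sum _ _ fun _ =>
    (Wiring.NatCoeff.single_one _).add (Wiring.NatCoeff.single_one _)]
  simp only [Finset.mem_univ, true_and, WordRel]
  refine exists_congr fun i => ?_
  rw [Wiring.rel_add (Wiring.NatCoeff.single_one _) (Wiring.NatCoeff.single_one _),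
    Wiring.rel_single_one, Wiring.rel_single_one, PreFlow.rel_toFlow, PreFlow.rel_toFlow]

end Vocabulary

end Stacks

/-! ### The finite graph of an observation on a word -/

/-- The data of a flow of an observation. -/
structure ObsData (L : FirstOrder.Language.{u, v}) where
  n : ℕ
  σ : Equiv.Perm (Fin n)
  c' : L.Constants
  d' : L.Constants
  q' : L.Constants
  c : L.Constants
  d : L.Constants
  q : L.Constants

namespace Vocabulary

variable {L : FirstOrder.Language.{u, v}} (V : Vocabulary L)

/-- The flow with the given data. -/
def dataFlow (o : ObsData L) : PreFlow L := V.obsFlow o.c' o.d' o.q' o.c o.d o.q o.σ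

theorem exists_data {φ : Wiring L} (hφ : V.IsObservation φ) :
    ∃ (f : ℕ) (o : Fin f → ObsData L), Function.Injective (fun j => (V.dataFlow (o j)).toFlow) ∧
      ∀ g, φ.coeff g ≠ 0 ↔ ∃ j, (V.dataFlow (o j)).toFlow = g := by
  have hmem : ∀ g, g ∈ Finsupp.support φ ↔ φ.coeff g ≠ 0 := fun g => Finsupp.mem_support_iff
  have hdata : ∀ g : Finsupp.support φ, ∃ o : ObsData L, (V.dataFlow o).toFlow = g := by
    rintro ⟨g, hg⟩
    obtain ⟨n, σ, c', d', q', c, d, q, -, -, -, -, -, -, h⟩ := hφ.2 g ((hmem g).1 hg)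
    exact ⟨⟨n, σ, c', d', q', c, d, q⟩, h.symm⟩
  choose o ho using hdata
  let e := (Finsupp.support φ).equivFin
  refine ⟨_, fun j => o (e.symm j), ?_, ?_⟩
  · intro i j h
    simp only [ho] at h
    exact e.symm.injective (Subtype.ext h)
  · intro g
    rw [← hmem]
    constructor
    · intro hg
      exact ⟨e ⟨g, hg⟩, by simp [ho]⟩
    · rintro ⟨j, rfl⟩
      rw [ho]
      exact (e.symm j).2

variable {f K n : ℕ} (o : Fin f → ObsData L)

/-- Vertices of the graph of an observation on a cyclic word: a stack of positions and the flow
that was applied last; the last label stands for no flow. -/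
abbrev ObsVertex (f K n : ℕ) : Type := (Fin (K + 1) → Fin (n + 1)) × Fin (f + 1)

/-- One step of the word followed by one step of the observation. -/
def ObsEdge (ℓ : Fin (n + 1) → L.Constants) (u v : ObsVertex f K n) : Prop :=
  ∃ j k : Fin f, u.2 = j.castSucc ∧ v.2 = k.castSucc ∧
    (o j).c' = ℓ (u.1 0) ∧ (o j).q' = (o k).q ∧ (o k).c = ℓ (v.1 (slot (o k).σ 0)) ∧
    (((o j).d' = V.rgt ∧ (o k).d = V.lft ∧ v.1 (slot (o k).σ 0) = u.1 0 + 1) ∨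
      ((o j).d' = V.lft ∧ (o k).d = V.rgt ∧ u.1 0 = v.1 (slot (o k).σ 0) + 1)) ∧
    ∀ a, a ≠ 0 → u.1 a = v.1 (slot (o k).σ a)

/-- The direction and the top position left by the flow `j` determine the step of the word, and with
it the letter, direction and state that the next flow has to match. By `huniq` these determine the
next flow, and its permutation determines the new stack. -/
theorem obsEdge_unique {ℓ : Fin (n + 1) → L.Constants} (hK : ∀ j, (o j).n ≤ K + 1)
    (huniq : ∀ j k, (o j).c = (o k).c → (o j).d = (o k).d → (o j).q = (o k).q → j = k)
    (u v w : ObsVertex f K n) (hv : V.ObsEdge o ℓ u v) (hw : V.ObsEdge o ℓ u w) : v = w := by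
  obtain ⟨j, k, hj, hk, h1, h2, h3, h4, h5⟩ := hv
  obtain ⟨j', k', hj', hk', h1', h2', h3', h4', h5'⟩ := hw
  obtain rfl : j = j' := Fin.castSucc_injective _ (hj.symm.trans hj')
  have hpos : v.1 (slot (o k).σ 0) = w.1 (slot (o k').σ 0) ∧ (o k).d = (o k').d := by
    rcases h4 with ⟨h6, h7, h8⟩ | ⟨h6, h7, h8⟩ <;> rcases h4' with ⟨h6', h7', h8'⟩ | ⟨h6', h7', h8'⟩
    · exact ⟨h8.trans h8'.symm, h7.trans h7'.symm⟩
    · exact (V.lft_ne_rgt (h6'.symm.trans h6)).elim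
    · exact (V.lft_ne_rgt (h6.symm.trans h6')).elim
    · exact ⟨add_right_cancel (h8.symm.trans h8'), h7.trans h7'.symm⟩
  obtain rfl : k = k' := huniq k k' (by rw [h3, h3', hpos.1]) hpos.2 (h2.symm.trans h2')
  refine Prod.ext (funext fun b => ?_) (hk.trans hk'.symm)
  obtain ⟨a, rfl⟩ := slot_surjective (o k).σ (hK k) b
  by_cases ha : a = 0
  · rw [ha]
    exact hpos.1
  · rw [← h5 a ha, ← h5' a ha]

/-- The relation on terms of an observation applied after a cyclic word. -/
def ObsRel (ℓ p : Fin (n + 1) → L.Constants) (t s : L.Term ℕ) : Prop :=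
  ∃ z, (∃ k, (V.dataFlow (o k)).Rel s z) ∧ V.WordRel ℓ p z t

open Classical in
/-- The index of a position, with default `0`. -/
noncomputable def posIndex (p : Fin (n + 1) → L.Constants) (t : L.Term ℕ) : Fin (n + 1) :=
  if h : ∃ i, t = const (p i) then h.choose else 0

theorem posIndex_const {p : Fin (n + 1) → L.Constants} (hp : Function.Injective p)
    (i : Fin (n + 1)) : posIndex p (const (p i)) = i := by
  have h : ∃ j, (const (p i) : L.Term ℕ) = const (p j) := ⟨i, rfl⟩
  rw [posIndex, dif_pos h]
  exact (hp (const_inj.1 h.choose_spec)).symm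

/-- The vertex of a stack under the label `j`. -/
noncomputable def stackVertex (K : ℕ) (p : Fin (n + 1) → L.Constants) (j : Fin f) (S : L.Term ℕ) :
    ObsVertex f K n :=
  (fun a => posIndex p (stackElem a S), j.castSucc)

/-- The default value of `posIndex` is harmless: a step of the word forces the top entry to be a
genuine position before and after it, and all other entries are merely carried along. -/
theorem obsEdge_of_obsRel {ℓ p : Fin (n + 1) → L.Constants} (hp : Function.Injective p)
    (hK : ∀ j, (o j).n ≤ K + 1) (j : Fin f) (S s : L.Term ℕ)
    (h : V.ObsRel o ℓ p (V.cons (V.head (o j).c' (o j).d' (o j).q') S) s) :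
    ∃ k S', s = V.cons (V.head (o k).c' (o k).d' (o k).q') S' ∧
      V.ObsEdge o ℓ (stackVertex K p j S) (stackVertex K p k S') := by
  obtain ⟨z, ⟨k, hk⟩, hz⟩ := h
  obtain ⟨S', T, rfl, rfl, hST⟩ := V.stackElem_of_rel_obsFlow hk
  refine ⟨k, S', rfl, j, k, rfl, rfl, ?_⟩
  have hslot : ∀ a : Fin (K + 1), (stackVertex K p k S').1 (slot (o k).σ a) =
      posIndex p (stackElem a T) := by
    intro a
    simp only [stackVertex, val_slot _ (hK k), hST]
  have hS : ∀ a : Fin (K + 1), (stackVertex K p j S).1 a = posIndex p (stackElem a S) :=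
    fun _ => rfl
  have hsucc : ∀ (x y w : L.Term ℕ) (a : Fin (K + 1)), a ≠ 0 →
      stackElem a (V.cons x w) = stackElem a (V.cons y w) := by
    intro x y w a ha
    obtain ⟨b, hb⟩ := Nat.exists_eq_succ_of_ne_zero (fun h => ha (Fin.ext h))
    rw [hb]
    rfl
  simp only [hslot, hS, Fin.val_zero]
  obtain ⟨i, hi | hi⟩ := hz
  · obtain ⟨x, y, h1, h2⟩ := (V.rel_wordFlow _ _ _ _ _ _ _ _).1 hi
    simp only [head, cons_inj, const_inj] at h1 h2
    obtain ⟨⟨hc, hd, hq⟩, rfl⟩ := h1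
    obtain ⟨⟨hc', hd', hq'⟩, rfl⟩ := h2
    simp only [stackElem_cons_zero, posIndex_const hp]
    refine ⟨hc', const_inj.1 (hq'.trans hq.symm), hc, Or.inr ⟨hd', hd, trivial⟩, fun a ha => ?_⟩
    rw [hsucc _ _ _ a ha]
  · obtain ⟨x, y, h1, h2⟩ := (V.rel_wordFlow _ _ _ _ _ _ _ _).1 hi
    simp only [head, cons_inj, const_inj] at h1 h2
    obtain ⟨⟨hc, hd, hq⟩, rfl⟩ := h1
    obtain ⟨⟨hc', hd', hq'⟩, rfl⟩ := h2
    simp only [stackElem_cons_zero, posIndex_const hp]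
    refine ⟨hc', const_inj.1 (hq'.trans hq.symm), hc, Or.inl ⟨hd', hd, trivial⟩, fun a ha => ?_⟩
    rw [hsucc _ _ _ a ha]

theorem hasWalk_obsEdge {ℓ p : Fin (n + 1) → L.Constants} (hp : Function.Injective p)
    (hK : ∀ j, (o j).n ≤ K + 1) (t : ℕ) (j : Fin f) (S : L.Term ℕ)
    (h : HasWalk (V.ObsRel o ℓ p) t (V.cons (V.head (o j).c' (o j).d' (o j).q') S)) :
    HasWalk (V.ObsEdge o ℓ) t (stackVertex K p j S) := by
  induction t generalizing j S with
  | zero => trivial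
  | succ t ih =>
    obtain ⟨s, hs, hw⟩ := h
    obtain ⟨k, S', rfl, hE⟩ := V.obsEdge_of_obsRel o hp hK j S s hs
    exact ⟨_, hE, ih k S' hw⟩

/-- The stack of the positions `p (v 0), p (v 1), …`. -/
def stackTerm (p : Fin (n + 1) → L.Constants) (v : Fin (K + 1) → Fin (n + 1)) : L.Term ℕ :=
  V.consList ((List.range (K + 1)).map fun a => const (p (v (Fin.ofNat (K + 1) a)))) (.var 0)

/-- The positions are realised by a stack of depth `K + 1`, deep enough for every permutation. The
intermediate term has the new position `i₁` on top of the unchanged rest `y`. -/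
theorem obsRel_of_obsEdge {ℓ : Fin (n + 1) → L.Constants} (p : Fin (n + 1) → L.Constants)
    (hK : ∀ j, (o j).n ≤ K + 1) {j k : Fin f} {v v' : Fin (K + 1) → Fin (n + 1)}
    (h : V.ObsEdge o ℓ (v, j.castSucc) (v', k.castSucc)) :
    V.ObsRel o ℓ p (V.cons (V.head (o j).c' (o j).d' (o j).q') (V.stackTerm p v))
      (V.cons (V.head (o k).c' (o k).d' (o k).q') (V.stackTerm p v')) := by
  obtain ⟨j₀, k₀, hj, hk, h1, h2, h3, h4, h5⟩ := h
  obtain rfl := Fin.castSucc_injective _ hj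
  obtain rfl := Fin.castSucc_injective _ hk
  dsimp only at h1 h2 h3 h4 h5
  set i₁ := v' (slot (o k).σ 0) with hi₁
  let y : L.Term ℕ := V.consList
    ((List.range K).map fun a => const (p (v (Fin.ofNat (K + 1) (a + 1))))) (.var 0)
  have hv : V.stackTerm p v = V.cons (const (p (v 0))) y := by
    rw [stackTerm, consList_range_succ]
    rfl
  refine ⟨V.cons (V.head (o k).c (o k).d (o k).q) (V.cons (const (p i₁)) y), ⟨k, ?_⟩, ?_⟩
  · refine (V.rel_obsFlow _ _ _ _ _ _ _ _ _).2
      ⟨fun a => const (p (v' (Fin.ofNat (K + 1) a))), V.consList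
        ((List.range (K + 1 - (o k).n)).map fun a =>
          const (p (v' (Fin.ofNat (K + 1) ((o k).n + a))))) (.var 0), ?_, ?_⟩
    · rw [← consList_range_add, Nat.add_sub_cancel' (hK k)]
      rfl
    · congr 1
      -- Beyond depth `n` the permutation is the identity, so the tail takes the same form as the
      -- permuted entries and joins them in one list.
      have hrest : (fun a => (const (p (v' (Fin.ofNat (K + 1) ((o k).n + a)))) : L.Term ℕ)) =
          fun a => const (p (v' (Fin.ofNat (K + 1) (natPerm (o k).σ ((o k).n + a))))) := by
        funext a
        rw [natPerm_of_le _ (by omega)]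
      rw [hrest, ← V.consList_range_add _ _ fun a =>
        const (p (v' (Fin.ofNat (K + 1) (natPerm (o k).σ a)))), Nat.add_sub_cancel' (hK k),
        consList_range_succ]
      refine congrArg₂ V.cons rfl (congrArg (V.consList · _) ?_)
      refine List.map_congr_left fun a ha => ?_
      have ha' : a + 1 < K + 1 := by
        have := List.mem_range.1 ha
        omega
      have hval : ((Fin.ofNat (K + 1) (a + 1) : Fin (K + 1)) : ℕ) = a + 1 :=
        Nat.mod_eq_of_lt ha'
      rw [h5 (Fin.ofNat (K + 1) (a + 1)) (fun h0 => by
        have := congrArg Fin.val h0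
        rw [hval] at this
        simp at this), slot, hval]
  · rw [hv]
    rcases h4 with ⟨hd, hd', hi⟩ | ⟨hd, hd', hi⟩
    · refine ⟨v 0, Or.inr ((V.rel_wordFlow _ _ _ _ _ _ _ _).2 ⟨const (o j).q', y, ?_, ?_⟩)⟩
      · rw [← hi, ← h3, ← hd', h2]
        rfl
      · rw [← h1, ← hd]
        rfl
    · refine ⟨i₁, Or.inl ((V.rel_wordFlow _ _ _ _ _ _ _ _).2 ⟨const (o j).q', y, ?_, ?_⟩)⟩
      · rw [← h3, ← hd', h2]
        rfl
      · rw [← hi, ← h1, ← hd]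
        rfl

theorem hasWalk_obsRel {ℓ : Fin (n + 1) → L.Constants} (p : Fin (n + 1) → L.Constants)
    (hK : ∀ j, (o j).n ≤ K + 1) (t : ℕ) (j : Fin f) (v : Fin (K + 1) → Fin (n + 1))
    (h : HasWalk (V.ObsEdge o ℓ) t (v, j.castSucc)) :
    HasWalk (V.ObsRel o ℓ p) t
      (V.cons (V.head (o j).c' (o j).d' (o j).q') (V.stackTerm p v)) := by
  induction t generalizing j v with
  | zero => trivial
  | succ t ih =>
    obtain ⟨⟨v', x⟩, hE, hw⟩ := h
    obtain ⟨_, k, _, rfl, _⟩ := id hE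
    exact ⟨_, V.obsRel_of_obsEdge o p hK hE, ih k v' hw⟩

theorem boundedWalks_obsRel_iff {ℓ p : Fin (n + 1) → L.Constants} (hp : Function.Injective p)
    (hK : ∀ j, (o j).n ≤ K + 1) :
    BoundedWalks (V.ObsRel o ℓ p) ↔
      BoundedWalks (V.ObsEdge o ℓ : ObsVertex f K n → ObsVertex f K n → Prop) := by
  constructor
  · rintro ⟨t, ht⟩
    -- The extra edge shows that the start does not carry the padding label.
    refine ⟨t + 1, ?_⟩
    rintro ⟨v, x⟩ hw
    obtain ⟨_, ⟨j, _, hj, _⟩, _⟩ := id hw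
    dsimp only at hj
    subst hj
    exact ht _ (V.hasWalk_obsRel o p hK _ j v hw).of_succ
  · rintro ⟨t, ht⟩
    -- An arbitrary term need not correspond to a vertex, but after one step it is an instance of
    -- the target of some flow.
    refine ⟨t + 1, ?_⟩
    rintro s ⟨s', ⟨z, ⟨k, hk⟩, -⟩, hw⟩
    obtain ⟨S', -, rfl, -⟩ := V.stackElem_of_rel_obsFlow hk
    exact ht _ (V.hasWalk_obsEdge o hp hK t k S' hw)

theorem mem_language_iff {φ : Wiring L} (hφ : V.IsObservation φ)
    (ho : ∀ g, φ.coeff g ≠ 0 ↔ ∃ j, (V.dataFlow (o j)).toFlow = g)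
    (hK : ∀ j, (o j).n ≤ K + 1) (W : List V.alphabet) :
    W ∈ V.language φ ↔ BoundedWalks
      (V.ObsEdge o (V.letter W) : ObsVertex f K W.length → ObsVertex f K W.length → Prop) := by
  have hrel : ∀ s z, φ.Rel s z ↔ ∃ j, (V.dataFlow (o j)).Rel s z := by
    intro s z
    simp only [Wiring.Rel, ho]
    constructor
    · rintro ⟨_, ⟨j, rfl⟩, h⟩
      exact ⟨j, ((V.dataFlow (o j)).rel_toFlow s z).1 h⟩
    · rintro ⟨j, h⟩
      exact ⟨_, ⟨j, rfl⟩, ((V.dataFlow (o j)).rel_toFlow s z).2 h⟩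
  have key : ∀ p : Fin (W.length + 1) → L.Constants, Function.Injective p →
      (IsNilpotent (φ * V.wordRep W p) ↔ BoundedWalks (V.ObsEdge o (V.letter W) :
        ObsVertex f K W.length → ObsVertex f K W.length → Prop)) := by
    intro p hp
    have hn := hφ.1.natCoeff
    have hw := V.natCoeff_wordRep W p
    rw [Wiring.isNilpotent_iff (hn.mul hw), ← V.boundedWalks_obsRel_iff o hp hK]
    have : (fun t s => (φ * V.wordRep W p).Rel s t) = V.ObsRel o (V.letter W) p := by
      funext t s
      rw [Wiring.rel_mul hn hw]
      simp only [hrel, rel_wordRep, ObsRel]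
    rw [this]
  constructor
  · intro h
    -- Infinitely many positions guarantee an admissible choice, so the universal condition is not
    -- vacuous; by `key` one choice suffices.
    let g := V.positions_infinite.natEmbedding
    let p : Fin (W.length + 1) → L.Constants := fun i => g i
    have hp : Function.Injective p := fun i j hij =>
      Fin.ext (g.injective (Subtype.ext hij))
    exact (key p hp).1 (h p hp fun i => (g i).2)
  · exact fun h p hp _ => (key p hp).2 h

/-- The letter for an input symbol, where the letters are numbered. -/
def symLetter {m : ℕ} (dec : Fin m → V.alphabet) : InSym (Fin m) → L.Constants
  | .letter a => dec a
  | _ => V.star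

theorem letter_eq_symLetter {m : ℕ} (e : V.alphabet ≃ Fin m) (W : List V.alphabet)
    (i : Fin (W.length + 1)) :
    V.letter W i = V.symLetter e.symm (TM.readInput (W.map e) i) := by
  refine Fin.cases ?_ (fun j => ?_) i
  · rfl
  · simp [letter, TM.readInput, symLetter]

/-- The edges of the graph in terms of views. -/
def obsViewEdge {m : ℕ} (dec : Fin m → V.alphabet) (x y : Fin (f + 1))
    (w : PtrView (InSym (Fin m)) (Bool × Fin (K + 1))) : Prop :=
  ∃ j k : Fin f, x = j.castSucc ∧ y = k.castSucc ∧
    (o j).c' = V.symLetter dec (w.sym (false, 0)) ∧ (o j).q' = (o k).q ∧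
    (o k).c = V.symLetter dec (w.sym (true, slot (o k).σ 0)) ∧
    (((o j).d' = V.rgt ∧ (o k).d = V.lft ∧ w.adj (false, 0) (true, slot (o k).σ 0) = true) ∨
      ((o j).d' = V.lft ∧ (o k).d = V.rgt ∧ w.adj (true, slot (o k).σ 0) (false, 0) = true)) ∧
    ∀ a, a ≠ 0 → w.eq (false, a) (true, slot (o k).σ a) = true

theorem viewEdge_obsViewEdge {m : ℕ} (dec : Fin m → V.alphabet) (W : List (Fin m))
    (u v : ObsVertex f K W.length) :
    ViewEdge (V.obsViewEdge o dec) W u v ↔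
      V.ObsEdge o (fun i => V.symLetter dec (TM.readInput W i)) u v := by
  simp [ViewEdge, obsViewEdge, ObsEdge, ptrView]

/-- Needed because a word and its recoding have lengths that are equal only propositionally, while
the vertex types depend on them. -/
theorem boundedWalks_obsEdge_congr {n n' : ℕ} (h : n = n') {ℓ : Fin (n + 1) → L.Constants}
    {ℓ' : Fin (n' + 1) → L.Constants}
    (hℓ : ∀ (i : Fin (n + 1)) (i' : Fin (n' + 1)), (i : ℕ) = i' → ℓ i = ℓ' i') :
    BoundedWalks (V.ObsEdge o ℓ : ObsVertex f K n → ObsVertex f K n → Prop) ↔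
      BoundedWalks (V.ObsEdge o ℓ' : ObsVertex f K n' → ObsVertex f K n' → Prop) := by
  subst h
  obtain rfl : ℓ = ℓ' := funext fun i => hℓ i i rfl
  rfl

/-- A program that decides boundedness of walks on the graphs of `o` decides the language. -/
theorem language_mem_of_program {φ : Wiring L} (hφ : V.IsObservation φ)
    (ho : ∀ g, φ.coeff g ≠ 0 ↔ ∃ j, (V.dataFlow (o j)).toFlow = g)
    (hK : ∀ j, (o j).n ≤ K + 1) {ρ : Type} [Finite ρ] (P : ViewMachine ρ (GraphView ρ))
    (hP : ∀ (n M : ℕ) (ℓ : Fin (n + 1) → L.Constants) (E : Fin (M + 1) ≃ ObsVertex f K n),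
      LastIsolated (fun i j => V.ObsEdge o ℓ (E i) (E j)) →
      P.Ends (graphView fun i j => V.ObsEdge o ℓ (E i) (E j)) P.start (fun _ => 0)
        (BoundedWalks fun i j => V.ObsEdge o ℓ (E i) (E j))) :
    V.language φ ∈ NLogspace V.alphabet ∧ (P.Det → V.language φ ∈ Logspace V.alphabet) := by
  let e := V.alphabet.equivFin
  have key := (P.toPtrMachine (V.obsViewEdge (K := K) o e.symm)).exists_logspace e
    (V.language φ) (fun W => by
      obtain ⟨M, E, h0, hnext, hlast⟩ := exists_vertex_enum (W.map e).length (K + 1) f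
      refine P.settles_toPtrMachine _ E h0 hnext hlast ?_
      simp only [viewEdge_obsViewEdge]
      refine (hP _ M _ E.symm ?_).congr ?_
      -- The last vertex carries the padding label, and the endpoints of an edge carry labels of
      -- flows.
      · have hne : ∀ x : Fin (M + 1), ∀ j : Fin f, (E.symm x).2 = j.castSucc →
            x ≠ Fin.last M := by
          intro x j hj hx
          rw [← E.apply_symm_apply x, hlast, hj] at hx
          exact (Fin.castSucc_lt_last j).ne hx.2
        rintro x y ⟨j, k, hj, hk, -⟩
        exact ⟨hne x j hj, hne y k hk⟩
      · rw [boundedWalks_comap, V.mem_language_iff o hφ ho hK]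
        refine (V.boundedWalks_obsEdge_congr o (List.length_map e).symm ?_).symm
        intro i i' hi
        rw [V.letter_eq_symLetter e, hi])
  exact ⟨key.1, fun hd => key.2 (P.toPtrMachine_det _ hd)⟩

end Vocabulary

end UnifLog

theorem theorem3p2 {L : FirstOrder.Language} (V : UnifLog.Vocabulary L)
    (φ : UnifLog.Wiring L) (hφ : V.IsObservation φ) :
    V.language φ ∈ UnifLog.NLogspace V.alphabet ∧
      (φ.IsIsometric → V.language φ ∈ UnifLog.Logspace V.alphabet) := by
  obtain ⟨f, o, hinj, ho⟩ := V.exists_data hφ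
  -- Any common bound on the sizes of the permutations would do; here it is their sum plus one.
  have hK : ∀ j, (o j).n ≤ (∑ i, (o i).n) + 1 := fun j =>
    (Finset.single_le_sum (f := fun i => (o i).n) (fun _ _ => Nat.zero_le _)
      (Finset.mem_univ j)).trans (Nat.le_succ _)
  refine ⟨(V.language_mem_of_program o hφ ho hK UnifLog.countMachine
    fun n M ℓ E hG => UnifLog.countMachine_ends hG).1, fun hiso => ?_⟩
  -- Sources with equal heads are matchable, which an isometric wiring excludes for distinct flows.
  have huniq : ∀ j k, (o j).c = (o k).c → (o j).d = (o k).d → (o j).q = (o k).q → j = k := by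
    intro j k hc hd hq
    by_contra hjk
    refine (hiso.2 (V.dataFlow (o j)) (V.dataFlow (o k)) ((ho _).2 ⟨j, rfl⟩) ((ho _).2 ⟨k, rfl⟩)
      fun h => hjk (hinj h)).2 ?_
    rw [UnifLog.Vocabulary.dataFlow, UnifLog.Vocabulary.dataFlow, hc, hd, hq]
    exact V.matchable_obsFlow_src _ _ _ _ _ _ _ _ _ _ _
  exact (V.language_mem_of_program o hφ ho hK UnifLog.traceMachine
    fun n M ℓ E hG => UnifLog.traceMachine_ends hG fun a b c hab hac =>
      E.injective (V.obsEdge_unique o hK huniq _ _ _ hab hac)).2 UnifLog.traceMachine_det
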